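/- Let $\Omega=\{x\in\mathbb R^3:|x|>1\}$ and let $k\in\mathbb R$ with $2+k\neq0$ and $3+2k\neq 0$. For a matrix field $A$ put $(\operatorname{div}A)_i=\sum_\ell\partial_\ell A_{\ell i}$ and $$(\mathcal D A)_{ij}=-\Delta A_{ij}-\tfrac k2\big(\partial_j(\operatorname{div}A)_i+\partial_i(\operatorname{div}A)_j-\tfrac23\,(\operatorname{div}\operatorname{div}A)\,\delta_{ij}\big),$$ $$(\mathcal D^*A)_{ij}=-\Delta A_{ij}-\tfrac k2\big(\partial_i(\operatorname{div}A)_j+\partial_j(\operatorname{div}A)_i-\tfrac23\,\partial_i\partial_j\operatorname{Tr}A\big).$$ For $m,n\in\{1,2,3\}$ let $S^{mm}=e_m\otimes e_m$, and $S^{mn}=e_m\otimes e_n+e_n\otimes e_m$ if $m\ne n$. Let $F^{mn}$ be the fundamental solution of $\mathcal D^*$ with right-hand side $S^{mn}\delta_0$; explicitly, with $S=S^{mn}$ and $r=|y|$, $$F^{mn}_{ij}(y)=\frac{1}{32\pi(2+k)(3+2k)r^5}\Big[(48+32k+2k^2)r^4S_{ij}+(12k+6k^2)r^2\big(y_i(Sy)_j+y_j(Sy)_i\big)+(8k+5k^2)(\operatorname{Tr}S)\,(r^4\delta_{ij}-r^2y_iy_j)-k^2r^2(y\cdot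 Sy)\,\delta_{ij}+3k^2(y\cdot Sy)\,y_iy_j\Big].$$ For $s\in\Omega$ let $G^{mn}(y)=F^{mn}(y-s)-\Phi(y)$ be the $mn$-th Green's function of $\mathcal D^*$ with pole $s$. This means that the corrector $\Phi=\Phi^{mn}_s$ is a symmetric matrix field in $C^2(\Omega)\cap C^1(\overline\Omega)$ with $\mathcal D^*\Phi=0$ in $\Omega$, $\Phi(y)=F^{mn}(y-s)$ for $|y|=1$, and $\Phi(y)=O(|y|^{-1})$, $\nabla\Phi(y)=O(|y|^{-2})$ as $|y|\to\infty$. Let $Q\in C^2(\Omega)\cap C^0(\overline\Omega)$ be a field of symmetric matrices with $\mathcal DQ=0$ in $\Omega$ and $Q(x)\to Q_\infty$ as $|x|\to\infty$, where $Q_\infty$ is a constant matrix. Put $c_{mn}=1$ if $m=n$ and $c_{mn}=2$ if $m\neq n$, and let $\nu(y)=-y$ be the unit normal on $\partial\Omega=\partial B_1(0)$ that points out of $\Omega$. Then, for every $s\in\Omega$, all $m,n$ and every such $G^{mn}$, $$c_{mn}\,(Q-Q_\infty)_{mn}(s)=\sum_{i,j=1}^3\int_{\partial B_1}(Q-Q_\infty)_{ij}\Big(-\frac{\partial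 G^{mn}_{ij}}{\partial\nu}-\frac k2\sum_{\ell=1}^3\big(\partial_\ell G^{mn}_{\ell j}\,\nu_i+\partial_\ell G^{mn}_{\ell i}\,\nu_j\big)+\frac k3\,\partial_j(\operatorname{Tr}G^{mn})\,\nu_i\Big)\,dS .$$ If moreover $Q_\infty=e_3\otimes e_3-\frac13I$ and $Q(y)=y\otimes y-\frac13 I$ for $|y|=1$, then, writing $(x,y,z)$ for the point of $\partial B_1$, $$\begin{aligned}c_{mn}(Q-Q_\infty)_{mn}(s)=-\int_{\partial B_1}\Big[&x(-x^2-\tfrac{2k}3)\partial_xG^{mn}_{11}+y(-x^2+\tfrac k3)\partial_yG^{mn}_{11}-zx^2\,\partial_zG^{mn}_{11}\\ &+x(-y^2+\tfrac k3)\partial_xG^{mn}_{22}+y(-y^2-\tfrac{2k}3)\partial_yG^{mn}_{22}-zy^2\,\partial_zG^{mn}_{22}\\ &+x(1-z^2+\tfrac k3)\partial_xG^{mn}_{33}+y(1-z^2+\tfrac k3)\partial_yG^{mn}_{33}+z(1-z^2)\partial_zG^{mn}_{33}\\ &+y(-2x^2-k)\partial_xG^{mn}_{12}+x(-2y^2-k)\partial_yG^{mn}_{12}-2xyz\,\partial_zG^{mn}_{12}\\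 &-2x^2z\,\partial_xG^{mn}_{13}-2xyz\,\partial_yG^{mn}_{13}+x(-2z^2-k)\partial_zG^{mn}_{13}\\ &-2xyz\,\partial_xG^{mn}_{23}-2y^2z\,\partial_yG^{mn}_{23}+y(-2z^2-k)\partial_zG^{mn}_{23}\Big]dS .\end{aligned}$$ -/

import Mathlib

open Filter Topology MeasureTheory Asymptotics Matrix

noncomputable section

namespace ExteriorQ

/-- Three dimensional Euclidean space. -/
abbrev E3 : Type := EuclideanSpace ℝ (Fin 3)

/-- A field of `3 × 3` real matrices on `ℝ³`. -/
abbrev MatField : Type := E3 → Matrix (Fin 3) (Fin 3) ℝ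

/-- The open exterior of the unit ball. -/
def Omega : Set E3 := {x | 1 < ‖x‖}

/-- The closed exterior of the unit ball, that is, the closure of `Omega`. -/
def OmegaBar : Set E3 := {x | 1 ≤ ‖x‖}

/-- The partial derivative `∂_ℓ f` (used at points of the open set `Omega`). -/
def pd (l : Fin 3) (f : E3 → ℝ) (x : E3) : ℝ :=
  fderiv ℝ f x (EuclideanSpace.single l 1)

/-- The partial derivative `∂_ℓ f` up to the boundary, for `f` given on the closed exterior.
At points of `Omega` it is the usual partial derivative; at boundary points it is the value
there of the continuous extension, when `f` is `C¹` up to the boundary. -/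
def bpd (l : Fin 3) (f : E3 → ℝ) (x : E3) : ℝ :=
  fderivWithin ℝ f OmegaBar x (EuclideanSpace.single l 1)

/-- `(div A)_i = ∑_ℓ ∂_ℓ A_{ℓ i}`. -/
def matDiv (A : MatField) (i : Fin 3) (x : E3) : ℝ :=
  ∑ l, pd l (fun y => A y l i) x

/-- The Euler-Lagrange operator
`(𝒟 A)_{ij} = - Δ A_{ij} - (k/2) (∂_j (div A)_i + ∂_i (div A)_j - (2/3) div div A δ_{ij})`. -/
def opD (k : ℝ) (A : MatField) (i j : Fin 3) (x : E3) : ℝ :=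
  - Laplacian.laplacian (fun y => A y i j) x
    - k / 2 * (pd j (matDiv A i) x + pd i (matDiv A j) x
        - 2 / 3 * (∑ l, pd l (matDiv A l) x) * (if i = j then 1 else 0))

/-- The formal adjoint (for the Frobenius product, on symmetric fields)
`(𝒟* A)_{ij} = - Δ A_{ij} - (k/2) (∂_i (div A)_j + ∂_j (div A)_i - (2/3) ∂_i ∂_j Tr A)`. -/
def opDstar (k : ℝ) (A : MatField) (i j : Fin 3) (x : E3) : ℝ :=
  - Laplacian.laplacian (fun y => A y i j) x
    - k / 2 * (pd i (matDiv A j) x + pd j (matDiv A i) x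
        - 2 / 3 * pd i (pd j (fun y => (A y).trace)) x)

/-- `Q` is a classical solution of the Euler-Lagrange system on the exterior of the unit ball,
with values in the symmetric matrices, continuous up to the boundary, with limit `Qlim` at
infinity. -/
structure IsSolution (k : ℝ) (Qlim : Matrix (Fin 3) (Fin 3) ℝ) (Q : MatField) : Prop where
  symm : ∀ x ∈ OmegaBar, (Q x).IsSymm
  contDiffOn : ∀ i j, ContDiffOn ℝ 2 (fun x => Q x i j) Omega
  continuousOn : ∀ i j, ContinuousOn (fun x => Q x i j) OmegaBar
  equation : ∀ x ∈ Omega, ∀ i j, opD k Q i j x = 0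
  tendsto : ∀ i j, Tendsto (fun x => Q x i j) (Bornology.cobounded E3) (𝓝 (Qlim i j))

/-- The symmetric matrix unit: `E_{mm}` if `m = n`, and `E_{mn} + E_{nm}` if `m ≠ n`. -/
def symUnit (m n : Fin 3) : Matrix (Fin 3) (Fin 3) ℝ :=
  fun i j => if (i = m ∧ j = n) ∨ (i = n ∧ j = m) then 1 else 0

/-- The `mn`-th fundamental solution of `𝒟*` on `ℝ³`, the one with right-hand side
`symUnit m n` times the Dirac mass at `0`. Written out in components, with `S = symUnit m n`,
`r = ‖y‖`, and up to the factor `1 / (32 π (2 + k) (3 + 2 k) r⁵)`, it reads for instance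
`F^{11}_{12} = r² (4 k + k²) y₁ y₂ + 3 k² y₁³ y₂` and
`F^{12}_{12} = r⁴ (48 + 44 k + 8 k²) - r² y₃² (12 k + 6 k²) + 6 k² y₁² y₂²`. -/
def fundSol (k : ℝ) (m n : Fin 3) : MatField := fun y i j =>
  let S := symUnit m n
  let Sy : Fin 3 → ℝ := S *ᵥ y.ofLp
  let q : ℝ := ∑ l, y l * Sy l
  let r : ℝ := ‖y‖
  let d : ℝ := if i = j then 1 else 0
  ((48 + 32 * k + 2 * k ^ 2) * r ^ 4 * S i j
      + (12 * k + 6 * k ^ 2) * r ^ 2 * (y i * Sy j + y j * Sy i)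
      + (8 * k + 5 * k ^ 2) * S.trace * (r ^ 4 * d - r ^ 2 * y i * y j)
      - k ^ 2 * r ^ 2 * q * d
      + 3 * k ^ 2 * q * y i * y j)
    / (32 * Real.pi * (2 + k) * (3 + 2 * k) * r ^ 5)

/-- `Φ` is the corrector of the `mn`-th Dirichlet Green's function with pole `s`: it is a
symmetric solution of `𝒟* Φ = 0` in the exterior of the unit ball, `C¹` up to the boundary, it
has the boundary values of the fundamental solution with pole `s`, and at infinity it decays
like the fundamental solution. -/
structure IsCorrector (k : ℝ) (m n : Fin 3) (s : E3) (Φ : MatField) : Prop where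
  symm : ∀ y ∈ OmegaBar, (Φ y).IsSymm
  contDiffOn : ∀ i j, ContDiffOn ℝ 2 (fun y => Φ y i j) Omega
  contDiffOn_closed : ∀ i j, ContDiffOn ℝ 1 (fun y => Φ y i j) OmegaBar
  equation : ∀ y ∈ Omega, ∀ i j, opDstar k Φ i j y = 0
  boundary : ∀ y ∈ Metric.sphere (0 : E3) 1, Φ y = fundSol k m n (y - s)
  decay : ∀ i j, (fun y => Φ y i j) =O[Bornology.cobounded E3] fun y => ‖y‖⁻¹
  decay_deriv : ∀ i j, (fun y => fderiv ℝ (fun z => Φ z i j) y)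
    =O[Bornology.cobounded E3] fun y => (‖y‖ ^ 2)⁻¹

/-- The `mn`-th Green's function with pole `s`, as a function of `y`, where `Φ` is the
corrector. -/
def green (k : ℝ) (m n : Fin 3) (s : E3) (Φ : MatField) : MatField :=
  fun y => fundSol k m n (y - s) - Φ y

/-- The unit normal on the unit sphere that points out of `Omega`, that is, `ν(y) = - y`. -/
def nu (y : E3) (i : Fin 3) : ℝ := - y i

/-- The boundary kernel
`- ∂_ν G_{ij} - (k/2) ∑_ℓ (∂_ℓ G_{ℓj} ν_i + ∂_ℓ G_{ℓi} ν_j) + (k/3) ∂_j (Tr G) ν_i`. -/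
def kernel (k : ℝ) (G : MatField) (i j : Fin 3) (y : E3) : ℝ :=
  - (∑ l, nu y l * bpd l (fun z => G z i j) y)
    - k / 2 * (∑ l, (bpd l (fun z => G z l j) y * nu y i + bpd l (fun z => G z l i) y * nu y j))
    + k / 3 * bpd j (fun z => (G z).trace) y * nu y i

/-- The surface measure of the unit sphere in `ℝ³` (total mass `4 π`). -/
def surf : Measure (Metric.sphere (0 : E3) 1) := (volume : Measure E3).toSphere

/-- `Q_∞ = e₃ ⊗ e₃ - (1/3) I`. -/
def Qinf : Matrix (Fin 3) (Fin 3) ℝ :=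
  Matrix.single 2 2 1 - (1 / 3 : ℝ) • (1 : Matrix (Fin 3) (Fin 3) ℝ)

/-- `v ⊗ v - (1/3) I` with `v = y` the radial direction at the boundary point `y`. -/
def Qbdry (y : E3) : Matrix (Fin 3) (Fin 3) ℝ :=
  Matrix.vecMulVec y.ofLp y.ofLp - (1 / 3 : ℝ) • (1 : Matrix (Fin 3) (Fin 3) ℝ)

/-- The integrand of the expanded formula, with `(x, y, z)` the coordinates of `p`. -/
def expanded (k : ℝ) (G : MatField) (p : E3) : ℝ :=
  let x := p 0
  let y := p 1
  let z := p 2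
  let dG : Fin 3 → Fin 3 → Fin 3 → ℝ := fun l i j => bpd l (fun q => G q i j) p
  x * (-x ^ 2 - 2 * k / 3) * dG 0 0 0 + y * (-x ^ 2 + k / 3) * dG 1 0 0 + z * (-x ^ 2) * dG 2 0 0
  + x * (-y ^ 2 + k / 3) * dG 0 1 1 + y * (-y ^ 2 - 2 * k / 3) * dG 1 1 1
  + z * (-y ^ 2) * dG 2 1 1
  + x * (-(z ^ 2 - 1) + k / 3) * dG 0 2 2 + y * (-(z ^ 2 - 1) + k / 3) * dG 1 2 2
  + z * (-(z ^ 2 - 1)) * dG 2 2 2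
  + y * (-2 * x ^ 2 - k) * dG 0 0 1 + x * (-2 * y ^ 2 - k) * dG 1 0 1
  + (-2 * x * y * z) * dG 2 0 1
  + z * (-2 * x ^ 2) * dG 0 0 2 + (-2 * x * y * z) * dG 1 0 2
  + x * (-2 * z ^ 2 - k) * dG 2 0 2
  + (-2 * x * y * z) * dG 0 1 2 + z * (-2 * y ^ 2) * dG 1 1 2
  + y * (-2 * z ^ 2 - k) * dG 2 1 2

end ExteriorQ

end

namespace ExteriorQ

/-! ### Calculus of partial derivatives -/

/-! Put `q = Q - Q_∞`. It solves `𝒟 q = 0` and tends to `0` at infinity, while `𝒟* G = S δ_s` and `G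
= 0` on the sphere. The formula is Green's second identity for the pair `q`, `G`: the pole
contributes `S : q(s)`, which is `c_mn q_mn(s)` by symmetry, and on the sphere only the terms with
first derivatives of `G` survive. Two difficulties shape the argument: `q` is merely continuous up
to the sphere, and `G` is singular at `s`.

The boundary is treated by a cut-off. The equation for `q` is tested against `χ G` with both
derivatives on the test field (`adjForm_integral_eq_zero`). By the product rule `∂_a ∂_b (χ G)` is
`χ ∂_a ∂_b G` plus a commutator `cutComm` that lives where `χ` varies, so no derivative of `q`
remains. The cut-off is `cut δ - cut R`. As `R → ∞` the outer commutator is `O(R⁻³)` on a shell of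
volume `O(R³)`, and it is paired with `q → 0` (`tendsto_integral_cutComm_atTop`). As `δ → 0` the
inner commutator concentrates on the sphere. Since `G` vanishes there, `δ⁻¹ G` converges to a
multiple of the normal derivative and the gradient of `G` is normal. All terms combine to `y_a ∂_b
G` times a profile of integral one, whatever the cut-off (`tendsto_integral_cutComm_zero`).

The pole is treated by regularisation. On `ℝ³` one has `Δ³ |y|³ = -96 π δ₀`, and the explicit `F` is
a linear combination of fourth derivatives of `|y|³` (`fundSol_eq_regFund`). That it inverts `𝒟*` is
thereby a polynomial identity between symbols (`fundSymbol_adjoint`). With `ρ = √(|y|² + ε²)` in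
place of `|y|` everything is smooth, and the identity turns `𝒟*` of the regularised field into `S`
times an approximate identity (`opDstar_regFund`, `tendsto_integral_rho`).

`sum_add_adjForm_boundary` collects the limits. The remaining work is algebra on the sphere:
`kernel_green` identifies the boundary integrand with the kernel, and
`sum_mul_kernel_eq_neg_expanded` expands it for `q = y ⊗ y - e₃ ⊗ e₃`. -/

theorem HasFDerivAt.pd_eq {f : E3 → ℝ} {f' : E3 →L[ℝ] ℝ} {x : E3} (h : HasFDerivAt f f' x)
    (l : Fin 3) : pd l f x = f' (EuclideanSpace.single l 1) := by
  rw [pd, h.fderiv]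

theorem pd_congr {f g : E3 → ℝ} {x : E3} (h : f =ᶠ[𝓝 x] g) (l : Fin 3) :
    pd l f x = pd l g x := by
  rw [pd, pd, h.fderiv_eq]

theorem pd_congr_of_isOpen {f g : E3 → ℝ} {U : Set E3} (hU : IsOpen U) (h : ∀ x ∈ U, f x = g x)
    {x : E3} (hx : x ∈ U) (l : Fin 3) : pd l f x = pd l g x :=
  pd_congr (Filter.eventuallyEq_of_mem (hU.mem_nhds hx) h) l

theorem pd_const (c : ℝ) (l : Fin 3) (x : E3) : pd l (fun _ => c) x = 0 := by
  simp [pd]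

theorem pd_add {f g : E3 → ℝ} {x : E3} (hf : DifferentiableAt ℝ f x)
    (hg : DifferentiableAt ℝ g x) (l : Fin 3) :
    pd l (fun y => f y + g y) x = pd l f x + pd l g x := by
  simp [pd, fderiv_fun_add hf hg]

theorem pd_sub {f g : E3 → ℝ} {x : E3} (hf : DifferentiableAt ℝ f x)
    (hg : DifferentiableAt ℝ g x) (l : Fin 3) :
    pd l (fun y => f y - g y) x = pd l f x - pd l g x := by
  simp [pd, fderiv_fun_sub hf hg]

theorem pd_sub_const {f : E3 → ℝ} {x : E3} (c : ℝ) (l : Fin 3) :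
    pd l (fun y => f y - c) x = pd l f x := by
  rw [pd, pd, fderiv_sub_const]

theorem pd_const_mul {f : E3 → ℝ} {x : E3} (hf : DifferentiableAt ℝ f x) (c : ℝ) (l : Fin 3) :
    pd l (fun y => c * f y) x = c * pd l f x := by
  simp [pd, fderiv_const_mul hf c]

theorem pd_mul {f g : E3 → ℝ} {x : E3} (hf : DifferentiableAt ℝ f x)
    (hg : DifferentiableAt ℝ g x) (l : Fin 3) :
    pd l (fun y => f y * g y) x = pd l f x * g x + f x * pd l g x := by
  simp [pd, fderiv_fun_mul hf hg]; ring

theorem pd_sum {ι : Type*} (s : Finset ι) {f : ι → E3 → ℝ} {x : E3}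
    (hf : ∀ i ∈ s, DifferentiableAt ℝ (f i) x) (l : Fin 3) :
    pd l (fun y => ∑ i ∈ s, f i y) x = ∑ i ∈ s, pd l (f i) x := by
  simp [pd, fderiv_fun_sum hf]

theorem pd_comp_sub (f : E3 → ℝ) (s : E3) (l : Fin 3) :
    pd l (fun y => f (y - s)) = fun y => pd l f (y - s) := by
  funext y
  simp [pd, fderiv_comp_sub]

theorem contDiffOn_pd {f : E3 → ℝ} {U : Set E3} (hU : IsOpen U) {n m : WithTop ℕ∞}
    (hf : ContDiffOn ℝ n f U) (hmn : m + 1 ≤ n) (l : Fin 3) : ContDiffOn ℝ m (pd l f) U :=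
  (hf.fderiv_of_isOpen hU hmn).clm_apply contDiffOn_const

theorem contDiff_pd {f : E3 → ℝ} {n m : WithTop ℕ∞}
    (hf : ContDiff ℝ n f) (hmn : m + 1 ≤ n) (l : Fin 3) : ContDiff ℝ m (pd l f) :=
  (hf.fderiv_right hmn).clm_apply contDiff_const

theorem pd_pd_eq {f : E3 → ℝ} {x : E3} (hf : ContDiffAt ℝ 2 f x) (a b : Fin 3) :
    pd a (pd b f) x
      = fderiv ℝ (fderiv ℝ f) x (EuclideanSpace.single a 1) (EuclideanSpace.single b 1) := by
  have h : DifferentiableAt ℝ (fderiv ℝ f) x :=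
    (hf.fderiv_right (m := 1) (by norm_num)).differentiableAt (by norm_num)
  have := (h.hasFDerivAt.clm_apply
    (hasFDerivAt_const (EuclideanSpace.single b (1 : ℝ)) x))
  rw [pd]
  change fderiv ℝ (fun y => fderiv ℝ f y (EuclideanSpace.single b 1)) x _ = _
  rw [this.fderiv]
  simp

theorem pd_comm {f : E3 → ℝ} {x : E3} (hf : ContDiffAt ℝ 2 f x) (a b : Fin 3) :
    pd a (pd b f) x = pd b (pd a f) x := by
  rw [pd_pd_eq hf, pd_pd_eq hf]
  exact hf.isSymmSndFDerivAt (by simp) _ _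

theorem laplacian_eq_sum_pd {f : E3 → ℝ} {x : E3} (hf : ContDiffAt ℝ 2 f x) :
    Laplacian.laplacian f x = ∑ l, pd l (pd l f) x := by
  rw [InnerProductSpace.laplacian_eq_iteratedFDeriv_orthonormalBasis f
    (EuclideanSpace.basisFun (Fin 3) ℝ)]
  refine Finset.sum_congr rfl fun l _ => ?_
  rw [pd_pd_eq hf, iteratedFDeriv_two_apply]
  simp

theorem tsupport_pd_subset (f : E3 → ℝ) (l : Fin 3) : tsupport (pd l f) ⊆ tsupport f := by
  refine closure_minimal (fun x hx => ?_) (isClosed_tsupport f)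
  by_contra h
  have h0 : f =ᶠ[𝓝 x] fun _ => 0 := notMem_tsupport_iff_eventuallyEq.1 h
  exact hx (by rw [pd_congr h0, pd_const])

theorem pd_eq_zero_of_notMem_tsupport {f : E3 → ℝ} {x : E3} (h : x ∉ tsupport f) (l : Fin 3) :
    pd l f x = 0 :=
  image_eq_zero_of_notMem_tsupport fun h' => h (tsupport_pd_subset f l h')

theorem hasCompactSupport_pd {f : E3 → ℝ} (hf : HasCompactSupport f) (l : Fin 3) :
    HasCompactSupport (pd l f) :=
  hf.of_isClosed_subset (isClosed_tsupport _) (tsupport_pd_subset f l)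

/-! ### Products with a compactly supported factor -/

theorem tsupport_mul_subset_of_left {f g : E3 → ℝ} {K : Set E3} (h : tsupport f ⊆ K) :
    tsupport (fun y => f y * g y) ⊆ K :=
  (tsupport_mul_subset_left (f := f) (g := g)).trans h

/-- Off the topological support of `χ` the product vanishes in a neighbourhood, so nothing is
required of `g` outside `U`. This is how fields known only on the exterior domain become test
functions on the whole space. -/
theorem contDiff_mul_of_tsupport_subset {χ g : E3 → ℝ} {U : Set E3} (hU : IsOpen U) {n : WithTop ℕ∞}
    (hχ : ContDiff ℝ n χ) (hg : ContDiffOn ℝ n g U) (hs : tsupport χ ⊆ U) :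
    ContDiff ℝ n fun y => χ y * g y := by
  rw [contDiff_iff_contDiffAt]
  intro x
  by_cases hx : x ∈ tsupport χ
  · exact hχ.contDiffAt.mul (hg.contDiffAt (hU.mem_nhds (hs hx)))
  · have h0 : (fun y => χ y * g y) =ᶠ[𝓝 x] fun _ => 0 :=
      (notMem_tsupport_iff_eventuallyEq.1 hx).mono fun y hy => by simp [hy]
    exact contDiffAt_const.congr_of_eventuallyEq h0

theorem continuous_mul_of_tsupport_subset {χ g : E3 → ℝ} {U : Set E3} (hU : IsOpen U)
    (hχ : Continuous χ) (hg : ContinuousOn g U) (hs : tsupport χ ⊆ U) :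
    Continuous fun y => χ y * g y := by
  rw [← contDiff_zero (𝕜 := ℝ)] at hχ ⊢
  exact contDiff_mul_of_tsupport_subset hU hχ (contDiffOn_zero.2 hg) hs

theorem integrable_mul_of_tsupport_subset {χ g : E3 → ℝ} {U : Set E3} (hU : IsOpen U)
    (hχ : Continuous χ) (hc : HasCompactSupport χ) (hg : ContinuousOn g U)
    (hs : tsupport χ ⊆ U) : Integrable fun y => χ y * g y :=
  (continuous_mul_of_tsupport_subset hU hχ hg hs).integrable_of_hasCompactSupport hc.mul_right

/-! ### Integration by parts -/

theorem integral_pd_eq_zero {f : E3 → ℝ} (hf : ContDiff ℝ 1 f) (hc : HasCompactSupport f)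
    (l : Fin 3) : ∫ y, pd l f y = 0 := by
  have h1 : Integrable (pd l f) :=
    ((contDiff_pd (m := 0) hf (by simp) l).continuous).integrable_of_hasCompactSupport
      (hasCompactSupport_pd hc l)
  -- Integration by parts against the constant `1`, whose derivative vanishes.
  have := integral_mul_fderiv_eq_neg_fderiv_mul_of_integrable (μ := (volume : Measure E3))
    (f := fun _ : E3 => (1 : ℝ)) (g := f) (v := EuclideanSpace.single l (1 : ℝ))
    (by simp) (by simp only [one_mul]; exact h1)
    (by simpa using hf.continuous.integrable_of_hasCompactSupport hc)
    (fun _ _ => differentiableAt_const _) (fun y _ => hf.differentiable (by norm_num) y)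
  simpa [pd] using this

/-- The derivative of the globally `C¹` product `u * f` has integral zero. Off `U` the values of `f`
and `pd l f` are arbitrary, but they only occur multiplied by `u` or its derivatives, which vanish
there. -/
theorem integral_mul_pd_eq_neg {f u : E3 → ℝ} {U : Set E3} (hU : IsOpen U)
    (hf : ContDiffOn ℝ 1 f U) (hu : ContDiff ℝ 1 u) (hc : HasCompactSupport u)
    (hs : tsupport u ⊆ U) (l : Fin 3) : ∫ y, f y * pd l u y = - ∫ y, pd l f y * u y := by
  have hprod := contDiff_mul_of_tsupport_subset hU hu hf hs
  have hcs : HasCompactSupport fun y => u y * f y := hc.mul_right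
  have h0 := integral_pd_eq_zero hprod hcs l
  have hi1 : Integrable fun y => pd l u y * f y :=
    integrable_mul_of_tsupport_subset hU (contDiff_pd (m := 0) hu (by simp) l).continuous
      (hasCompactSupport_pd hc l) hf.continuousOn ((tsupport_pd_subset u l).trans hs)
  have hi2 : Integrable fun y => u y * pd l f y :=
    integrable_mul_of_tsupport_subset hU hu.continuous hc
      (contDiffOn_pd (m := 0) hU hf (by simp) l).continuousOn hs
  have heq : ∀ y, pd l (fun y => u y * f y) y = pd l u y * f y + u y * pd l f y := by
    intro y
    by_cases hy : y ∈ tsupport u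
    · exact pd_mul (hu.differentiable (by norm_num) y)
        ((hf.contDiffAt (hU.mem_nhds (hs hy))).differentiableAt (by norm_num)) l
    · have e0 : (fun y => u y * f y) =ᶠ[𝓝 y] fun _ => 0 :=
        (notMem_tsupport_iff_eventuallyEq.1 hy).mono fun z hz => by simp [hz]
      rw [pd_congr e0, pd_const, pd_eq_zero_of_notMem_tsupport hy,
        image_eq_zero_of_notMem_tsupport hy]
      simp
  simp_rw [heq] at h0
  rw [integral_add hi1 hi2] at h0
  have e1 : ∫ y, f y * pd l u y = ∫ y, pd l u y * f y := by simp_rw [mul_comm]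
  have e2 : ∫ y, pd l f y * u y = ∫ y, u y * pd l f y := by simp_rw [mul_comm]
  rw [e1, e2]; linarith

theorem integral_mul_pd_pd {f u : E3 → ℝ} {U : Set E3} (hU : IsOpen U)
    (hf : ContDiffOn ℝ 2 f U) (hu : ContDiff ℝ 2 u) (hc : HasCompactSupport u)
    (hs : tsupport u ⊆ U) (a b : Fin 3) :
    ∫ y, f y * pd a (pd b u) y = ∫ y, pd b (pd a f) y * u y := by
  rw [integral_mul_pd_eq_neg hU (hf.of_le (by norm_num)) (contDiff_pd hu (by norm_num) b)
    (hasCompactSupport_pd hc b) ((tsupport_pd_subset u b).trans hs),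
    integral_mul_pd_eq_neg hU (contDiffOn_pd hU hf (by norm_num) a)
      (hu.of_le (by norm_num)) hc hs, neg_neg]

/-! ### The adjoint operator as a bilinear form -/

/-- The pairing `∑ q_{ij} (𝒟* A)_{ij}` as a function of the products
`B a b i j p q = q_{ij} ∂_a ∂_b A_{pq}`. -/
noncomputable def adjForm (k : ℝ) (B : Fin 3 → Fin 3 → Fin 3 → Fin 3 → Fin 3 → Fin 3 → ℝ) : ℝ :=
  ∑ i, ∑ j, (-(∑ l, B l l i j i j)
    - k / 2 * ((∑ l, B i l i j l j) + (∑ l, B j l i j l i) - 2 / 3 * ∑ l, B i j i j l l))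

theorem adjForm_add (k : ℝ) (B C : Fin 3 → Fin 3 → Fin 3 → Fin 3 → Fin 3 → Fin 3 → ℝ) :
    adjForm k (fun a b i j p q => B a b i j p q + C a b i j p q) = adjForm k B + adjForm k C := by
  simp only [adjForm, ← Finset.sum_add_distrib]
  refine Finset.sum_congr rfl fun i _ => Finset.sum_congr rfl fun j _ => ?_
  simp only [Finset.sum_add_distrib]
  ring

theorem adjForm_sub (k : ℝ) (B C : Fin 3 → Fin 3 → Fin 3 → Fin 3 → Fin 3 → Fin 3 → ℝ) :
    adjForm k (fun a b i j p q => B a b i j p q - C a b i j p q) = adjForm k B - adjForm k C := by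
  simp only [adjForm, ← Finset.sum_sub_distrib]
  refine Finset.sum_congr rfl fun i _ => Finset.sum_congr rfl fun j _ => ?_
  simp only [Finset.sum_sub_distrib]
  ring

theorem tendsto_adjForm (k : ℝ) {ι : Type*} {L : Filter ι}
    {B : ι → Fin 3 → Fin 3 → Fin 3 → Fin 3 → Fin 3 → Fin 3 → ℝ}
    {C : Fin 3 → Fin 3 → Fin 3 → Fin 3 → Fin 3 → Fin 3 → ℝ}
    (h : ∀ a b i j p q, Tendsto (fun t => B t a b i j p q) L (𝓝 (C a b i j p q))) :
    Tendsto (fun t => adjForm k (B t)) L (𝓝 (adjForm k C)) := by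
  unfold adjForm
  refine tendsto_finsetSum _ fun i _ => tendsto_finsetSum _ fun j _ => ?_
  refine (tendsto_finsetSum _ fun l _ => h _ _ _ _ _ _).neg.sub (Tendsto.const_mul _ ?_)
  exact ((tendsto_finsetSum _ fun l _ => h _ _ _ _ _ _).add
    (tendsto_finsetSum _ fun l _ => h _ _ _ _ _ _)).sub
    ((tendsto_finsetSum _ fun l _ => h _ _ _ _ _ _).const_mul _)

theorem integral_neg_sub_mul {α : Type*} [MeasurableSpace α] {μ : Measure α}
    {f g h e : α → ℝ} (hf : Integrable f μ) (hg : Integrable g μ) (hh : Integrable h μ)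
    (he : Integrable e μ) (c d : ℝ) :
    ∫ y, (-f y - c * (g y + h y - d * e y)) ∂μ
      = -∫ y, f y ∂μ - c * (∫ y, g y ∂μ + ∫ y, h y ∂μ - d * ∫ y, e y ∂μ) := by
  have h1 : Integrable (fun y => g y + h y) μ := hg.add hh
  have h2 : Integrable (fun y => d * e y) μ := he.const_mul d
  have h3 : Integrable (fun y => g y + h y - d * e y) μ := h1.sub h2
  have h4 : Integrable (fun y => -f y) μ := hf.neg
  rw [integral_sub h4 (h3.const_mul c), integral_neg, integral_const_mul, integral_sub h1 h2,
    integral_const_mul, integral_add hg hh]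

theorem integral_adjForm (k : ℝ) {α : Type*} [MeasurableSpace α] (μ : Measure α)
    {B : Fin 3 → Fin 3 → Fin 3 → Fin 3 → Fin 3 → Fin 3 → α → ℝ}
    (hB : ∀ a b i j p q, Integrable (B a b i j p q) μ) :
    adjForm k (fun a b i j p q => ∫ y, B a b i j p q y ∂μ)
      = ∑ i, ∑ j, ∫ y, (-(∑ l, B l l i j i j y)
        - k / 2 * ((∑ l, B i l i j l j y) + (∑ l, B j l i j l i y)
          - 2 / 3 * ∑ l, B i j i j l l y)) ∂μ := by
  unfold adjForm
  refine Finset.sum_congr rfl fun i _ => Finset.sum_congr rfl fun j _ => ?_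
  have i1 : Integrable (fun y => ∑ l, B l l i j i j y) μ :=
    integrable_finsetSum _ fun l _ => hB _ _ _ _ _ _
  have i2 : Integrable (fun y => ∑ l, B i l i j l j y) μ :=
    integrable_finsetSum _ fun l _ => hB _ _ _ _ _ _
  have i3 : Integrable (fun y => ∑ l, B j l i j l i y) μ :=
    integrable_finsetSum _ fun l _ => hB _ _ _ _ _ _
  have i4 : Integrable (fun y => ∑ l, B i j i j l l y) μ :=
    integrable_finsetSum _ fun l _ => hB _ _ _ _ _ _
  rw [integral_neg_sub_mul i1 i2 i3 i4, integral_finsetSum _ fun l _ => hB _ _ _ _ _ _,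
    integral_finsetSum _ fun l _ => hB _ _ _ _ _ _,
    integral_finsetSum _ fun l _ => hB _ _ _ _ _ _,
    integral_finsetSum _ fun l _ => hB _ _ _ _ _ _]

theorem pd_matDiv {A : MatField} {U : Set E3} (hU : IsOpen U)
    (hA : ∀ i j, ContDiffOn ℝ 2 (fun y => A y i j) U) {x : E3} (hx : x ∈ U) (i j : Fin 3) :
    pd i (matDiv A j) x = ∑ l, pd i (pd l fun y => A y l j) x := by
  rw [← pd_sum Finset.univ (f := fun l => pd l fun y => A y l j) (x := x) _ i]
  · rfl
  · exact fun l _ => ((contDiffOn_pd (m := 1) hU (hA l j) (by norm_num) l).contDiffAt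
      (hU.mem_nhds hx)).differentiableAt (by norm_num)

/-- This is the index pattern of `adjForm`, so that pairing with `q` depends only on the products of
components of `q` with second derivatives. -/
theorem opDstar_eq (k : ℝ) {A : MatField} {U : Set E3} (hU : IsOpen U)
    (hA : ∀ i j, ContDiffOn ℝ 2 (fun y => A y i j) U) {x : E3} (hx : x ∈ U) (i j : Fin 3) :
    opDstar k A i j x = -(∑ l, pd l (pd l fun y => A y i j) x)
      - k / 2 * ((∑ l, pd i (pd l fun y => A y l j) x) + (∑ l, pd j (pd l fun y => A y l i) x)
        - 2 / 3 * ∑ l, pd i (pd j fun y => A y l l) x) := by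
  have htr : pd i (pd j fun y => (A y).trace) x = ∑ l, pd i (pd j fun y => A y l l) x := by
    rw [← pd_sum Finset.univ (f := fun l => pd j fun y => A y l l) (x := x) _ i]
    · refine pd_congr_of_isOpen hU (fun z hz => ?_) hx i
      exact pd_sum Finset.univ (f := fun l y => A y l l) (x := z)
        (fun l _ => ((hA l l).contDiffAt (hU.mem_nhds hz)).differentiableAt (by norm_num)) j
    · exact fun l _ => ((contDiffOn_pd (m := 1) hU (hA l l) (by norm_num) j).contDiffAt
        (hU.mem_nhds hx)).differentiableAt (by norm_num)
  rw [opDstar, laplacian_eq_sum_pd ((hA i j).contDiffAt (hU.mem_nhds hx)), pd_matDiv hU hA hx,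
    pd_matDiv hU hA hx, htr]

theorem opD_eq (k : ℝ) {A : MatField} {U : Set E3} (hU : IsOpen U)
    (hA : ∀ i j, ContDiffOn ℝ 2 (fun y => A y i j) U) {x : E3} (hx : x ∈ U) (i j : Fin 3) :
    opD k A i j x = -(∑ l, pd l (pd l fun y => A y i j) x)
      - k / 2 * ((∑ l, pd j (pd l fun y => A y l i) x) + (∑ l, pd i (pd l fun y => A y l j) x)
        - 2 / 3 * (∑ l, ∑ p, pd l (pd p fun y => A y p l) x) * (if i = j then 1 else 0)) := by
  rw [opD, laplacian_eq_sum_pd ((hA i j).contDiffAt (hU.mem_nhds hx))]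
  simp_rw [pd_matDiv hU hA hx]

/-- The weak form of the equation `𝒟 q = 0`. -/
theorem adjForm_integral_eq_zero {k : ℝ} {q u : MatField} {U : Set E3} (hU : IsOpen U)
    (hq : ∀ i j, ContDiffOn ℝ 2 (fun y => q y i j) U) (hqs : ∀ y ∈ U, (q y).IsSymm)
    (hqe : ∀ y ∈ U, ∀ i j, opD k q i j y = 0)
    (hu : ∀ i j, ContDiff ℝ 2 fun y => u y i j) (hus : ∀ y, (u y).IsSymm)
    (hc : ∀ i j, HasCompactSupport fun y => u y i j)
    (hs : ∀ i j, tsupport (fun y => u y i j) ⊆ U) :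
    adjForm k (fun a b i j p r => ∫ y, q y i j * pd a (pd b fun z => u z p r) y) = 0 := by
  set c : Fin 3 → Fin 3 → Fin 3 → Fin 3 → Fin 3 → Fin 3 → ℝ := fun b a i j p r =>
    ∫ y, pd b (pd a fun z => q z i j) y * u y p r with hcdef
  -- Both derivatives move onto `q`, in reversed order.
  have hbc : (fun a b i j p r => ∫ y, q y i j * pd a (pd b fun z => u z p r) y)
      = fun a b i j p r => c b a i j p r := by
    funext a b i j p r
    exact integral_mul_pd_pd hU (hq i j) (hu p r) (hc p r) (hs p r) a b
  have hint : ∀ b a i j p r, Integrable fun y => pd b (pd a fun z => q z i j) y * u y p r := by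
    intro b a i j p r
    have := integrable_mul_of_tsupport_subset hU (hu p r).continuous (hc p r)
      (contDiffOn_pd (m := 0) hU (contDiffOn_pd (m := 1) hU (hq i j) (by norm_num) a)
        (by simp) b).continuousOn (hs p r)
    simpa only [mul_comm] using this
  have hu0 : ∀ {y}, y ∉ U → ∀ i j, u y i j = 0 := fun {y} hy i j =>
    image_eq_zero_of_notMem_tsupport (f := fun y => u y i j) fun h => hy (hs i j h)
  -- Symmetry of `q` and of `u` allows both index pairs to be transposed at once.
  have hcs : ∀ b a i j p r, c b a i j p r = c b a j i r p := by
    intro b a i j p r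
    refine integral_congr_ae (Eventually.of_forall fun y => ?_)
    by_cases hy : y ∈ U
    · have e : pd b (pd a fun z => q z i j) y = pd b (pd a fun z => q z j i) y :=
        pd_congr_of_isOpen hU (fun z hz =>
          pd_congr_of_isOpen hU (fun w hw => (hqs w hw).apply j i) hz a) hy b
      change _ * _ = _ * _
      rw [e, (hus y).apply r p]
    · have e1 : u y p r = 0 := hu0 hy p r
      have e2 : u y r p = 0 := hu0 hy r p
      change _ * _ = _ * _
      rw [e1, e2]; simp
  have hzero : ∀ i j, -(∑ l, c l l i j i j)
      - k / 2 * ((∑ l, c j l l i i j) + (∑ l, c i l l j i j)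
        - 2 / 3 * (∑ l, ∑ p, c l p p l i j) * (if i = j then 1 else 0)) = 0 := by
    intro i j
    have h0 : ∫ y, opD k q i j y * u y i j = 0 := by
      rw [← integral_zero E3 ℝ]
      refine integral_congr_ae (Eventually.of_forall fun y => ?_)
      by_cases hy : y ∈ U
      · simp [hqe y hy]
      · have e1 : u y i j = 0 := hu0 hy i j
        simp [e1]
    have h1 : ∀ y, opD k q i j y * u y i j
        = -(∑ l, pd l (pd l fun y => q y i j) y * u y i j)
      - k / 2 * ((∑ l, pd j (pd l fun y => q y l i) y * u y i j)
        + (∑ l, pd i (pd l fun y => q y l j) y * u y i j)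
        - 2 / 3 * (if i = j then 1 else 0)
          * (∑ l, ∑ p, pd l (pd p fun y => q y p l) y * u y i j)) := by
      intro y
      by_cases hy : y ∈ U
      · rw [opD_eq k hU hq hy]
        simp only [← Finset.sum_mul]
        ring
      · have e1 : u y i j = 0 := hu0 hy i j
        simp [e1]
    simp_rw [h1] at h0
    have i1 : Integrable fun y => ∑ l, pd l (pd l fun y => q y i j) y * u y i j :=
      integrable_finsetSum _ fun l _ => hint _ _ _ _ _ _
    have i2 : Integrable fun y => ∑ l, pd j (pd l fun y => q y l i) y * u y i j :=
      integrable_finsetSum _ fun l _ => hint _ _ _ _ _ _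
    have i3 : Integrable fun y => ∑ l, pd i (pd l fun y => q y l j) y * u y i j :=
      integrable_finsetSum _ fun l _ => hint _ _ _ _ _ _
    have i4 : Integrable fun y => ∑ l, ∑ p, pd l (pd p fun y => q y p l) y * u y i j :=
      integrable_finsetSum _ fun l _ => integrable_finsetSum _ fun p _ => hint _ _ _ _ _ _
    rw [integral_neg_sub_mul i1 i2 i3 i4, integral_finsetSum _ fun l _ => hint _ _ _ _ _ _,
      integral_finsetSum _ fun l _ => hint _ _ _ _ _ _,
      integral_finsetSum _ fun l _ => hint _ _ _ _ _ _,
      integral_finsetSum _ fun l _ => integrable_finsetSum _ fun p _ => hint _ _ _ _ _ _] at h0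
    simp_rw [fun l => integral_finsetSum (μ := volume) Finset.univ
      (f := fun p y => pd l (pd p fun y => q y p l) y * u y i j)
      fun p _ => hint l p p l i j] at h0
    refine Eq.trans ?_ h0
    simp only [hcdef]
    ring
  -- After this transposition every term of `adjForm` agrees with a term of the summed equation
  -- `hzero` up to renaming of summation indices. The other terms match by renaming alone.
  have h2 : ∀ i j, (∑ l, c l j i j l i) = ∑ l, c l j j i i l := fun i j =>
    Finset.sum_congr rfl fun l _ => hcs _ _ _ _ _ _
  rw [hbc]
  unfold adjForm
  simp_rw [h2]
  have hsum : ∑ i, ∑ j, (-(∑ l, c l l i j i j)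
      - k / 2 * ((∑ l, c j l l i i j) + (∑ l, c i l l j i j)
        - 2 / 3 * (∑ l, ∑ p, c l p p l i j) * (if i = j then 1 else 0))) = 0 :=
    Finset.sum_eq_zero fun i _ => Finset.sum_eq_zero fun j _ => hzero i j
  rw [← hsum]
  simp only [Fin.sum_univ_three, Fin.isValue]
  simp
  ring

/-! ### Regularised distance and its derivatives -/

/-- `f` is differentiable at `x` with `∂_l f (x) = v`. -/
def HasPd (l : Fin 3) (f : E3 → ℝ) (v : ℝ) (x : E3) : Prop :=
  DifferentiableAt ℝ f x ∧ pd l f x = v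

namespace HasPd

variable {l : Fin 3} {f g : E3 → ℝ} {v w : ℝ} {x : E3}

theorem add (hf : HasPd l f v x) (hg : HasPd l g w x) :
    HasPd l (fun y => f y + g y) (v + w) x :=
  ⟨hf.1.add hg.1, by rw [pd_add hf.1 hg.1, hf.2, hg.2]⟩

theorem sub (hf : HasPd l f v x) (hg : HasPd l g w x) :
    HasPd l (fun y => f y - g y) (v - w) x :=
  ⟨hf.1.sub hg.1, by rw [pd_sub hf.1 hg.1, hf.2, hg.2]⟩

theorem mul (hf : HasPd l f v x) (hg : HasPd l g w x) :
    HasPd l (fun y => f y * g y) (v * g x + f x * w) x :=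
  ⟨hf.1.mul hg.1, by rw [pd_mul hf.1 hg.1, hf.2, hg.2]⟩

theorem const (c : ℝ) : HasPd l (fun _ => c) 0 x :=
  ⟨differentiableAt_const c, pd_const c l x⟩

theorem const_mul (c : ℝ) (hf : HasPd l f v x) : HasPd l (fun y => c * f y) (c * v) x :=
  ⟨hf.1.const_mul c, by rw [pd_const_mul hf.1, hf.2]⟩

end HasPd

/-- The Kronecker symbol. -/
def kron (i j : Fin 3) : ℝ := if i = j then 1 else 0

theorem kron_comm (i j : Fin 3) : kron i j = kron j i := by
  simp [kron, eq_comm]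

theorem abs_kron_le (i j : Fin 3) : |kron i j| ≤ 1 := by
  unfold kron; split_ifs <;> simp

theorem hasPd_coord (l i : Fin 3) (x : E3) : HasPd l (fun y => y i) (kron l i) x := by
  have h : HasFDerivAt (fun y : E3 => y i) (EuclideanSpace.proj i : E3 →L[ℝ] ℝ) x :=
    (EuclideanSpace.proj i : E3 →L[ℝ] ℝ).hasFDerivAt
  refine ⟨h.differentiableAt, ?_⟩
  rw [HasFDerivAt.pd_eq h]
  simp [kron, eq_comm]

/-- `√(|y|² + ε²)`. -/
noncomputable def rho (ε : ℝ) (y : E3) : ℝ := Real.sqrt (‖y‖ ^ 2 + ε ^ 2)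

theorem rho_sq (ε : ℝ) (y : E3) : rho ε y ^ 2 = ‖y‖ ^ 2 + ε ^ 2 :=
  Real.sq_sqrt (by positivity)

theorem norm_sq_eq_sum (y : E3) : ‖y‖ ^ 2 = ∑ i, y i ^ 2 := by
  rw [EuclideanSpace.norm_sq_eq]
  simp

theorem rho_zero (y : E3) : rho 0 y = ‖y‖ := by
  simp [rho]

theorem norm_le_rho (ε : ℝ) (y : E3) : ‖y‖ ≤ rho ε y :=
  Real.le_sqrt_of_sq_le (by nlinarith [sq_nonneg ε])

theorem abs_coord_le_norm (y : E3) (i : Fin 3) : |y i| ≤ ‖y‖ := by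
  simpa using PiLp.norm_apply_le y i

theorem rho_pos {ε : ℝ} {y : E3} (h : 0 < ‖y‖ ^ 2 + ε ^ 2) : 0 < rho ε y := Real.sqrt_pos.2 h

theorem continuous_rho_left (y : E3) : Continuous fun ε => rho ε y := by
  unfold rho; fun_prop

theorem contDiffAt_rho {ε : ℝ} {y : E3} (h : 0 < ‖y‖ ^ 2 + ε ^ 2) {n : WithTop ℕ∞} :
    ContDiffAt ℝ n (rho ε) y :=
  ((contDiff_norm_sq ℝ).contDiffAt.add contDiffAt_const).sqrt h.ne'

theorem contDiffAt_rho_zpow {ε : ℝ} {y : E3} (h : 0 < ‖y‖ ^ 2 + ε ^ 2) {n : WithTop ℕ∞} (m : ℤ) :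
    ContDiffAt ℝ n (fun y => rho ε y ^ m) y := by
  have hr := contDiffAt_rho h (n := n)
  have hne := (rho_pos h).ne'
  obtain ⟨j, rfl | rfl⟩ := m.eq_nat_or_neg
  · simpa using hr.pow j
  · simp only [_root_.zpow_neg, zpow_natCast]
    exact (hr.pow j).inv (pow_ne_zero _ hne)

theorem hasPd_rho {ε : ℝ} {y : E3} (h : 0 < ‖y‖ ^ 2 + ε ^ 2) (l : Fin 3) :
    HasPd l (rho ε) (y l / rho ε y) y := by
  have h1 : HasFDerivAt (fun y : E3 => ‖y‖ ^ 2 + ε ^ 2) (2 • innerSL ℝ y) y :=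
    (hasStrictFDerivAt_norm_sq y).hasFDerivAt.add_const _
  have h2 := h1.sqrt h.ne'
  refine ⟨h2.differentiableAt, ?_⟩
  have := HasFDerivAt.pd_eq h2 l
  refine this.trans ?_
  have hp := rho_pos h
  unfold rho at hp ⊢
  simp [EuclideanSpace.inner_single_right]
  field_simp

theorem hasPd_rho_zpow {ε : ℝ} {y : E3} (h : 0 < ‖y‖ ^ 2 + ε ^ 2) (l : Fin 3) (m : ℤ) :
    HasPd l (fun y => rho ε y ^ m) (m * y l * rho ε y ^ (m - 2)) y := by
  obtain ⟨h1, h2⟩ := hasPd_rho h l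
  have hp := rho_pos h
  have h3 := (hasDerivAt_zpow m (rho ε y) (Or.inl hp.ne')).comp_hasFDerivAt y h1.hasFDerivAt
  refine ⟨h3.differentiableAt, ?_⟩
  refine (HasFDerivAt.pd_eq h3 l).trans ?_
  change (m * rho ε y ^ (m - 1)) * pd l (rho ε) y = _
  rw [h2, show m - 1 = (m - 2) + 1 by ring, _root_.zpow_add_one₀ hp.ne']
  field_simp

/-- The fourth derivatives of `ρ³`. -/
noncomputable def quartic (ε : ℝ) (y : E3) (a b c d : Fin 3) : ℝ :=
  3 * (kron c d * kron a b + kron b c * kron a d + kron b d * kron a c) * rho ε y ^ (-1 : ℤ)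
  + (-3) * (kron c d * (y a * y b) + kron b c * (y a * y d) + kron b d * (y a * y c)
    + kron a b * (y c * y d) + kron a c * (y b * y d) + kron a d * (y b * y c))
      * rho ε y ^ (-3 : ℤ)
  + 9 * (y a * y b * (y c * y d)) * rho ε y ^ (-5 : ℤ)

/-- The fifth derivatives of `ρ³`. -/
noncomputable def quintic (e : Fin 3) (ε : ℝ) (y : E3) (a b c d : Fin 3) : ℝ :=
  (-3) * ((kron c d * kron a b + kron b c * kron a d + kron b d * kron a c) * y e
    + kron c d * (kron e a * y b + y a * kron e b) + kron b c * (kron e a * y d + y a * kron e d)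
    + kron b d * (kron e a * y c + y a * kron e c) + kron a b * (kron e c * y d + y c * kron e d)
    + kron a c * (kron e b * y d + y b * kron e d)
    + kron a d * (kron e b * y c + y b * kron e c)) * rho ε y ^ (-3 : ℤ)
  + 9 * ((kron c d * (y a * y b) + kron b c * (y a * y d) + kron b d * (y a * y c)
    + kron a b * (y c * y d) + kron a c * (y b * y d) + kron a d * (y b * y c)) * y e
    + ((kron e a * y b + y a * kron e b) * (y c * y d)
      + y a * y b * (kron e c * y d + y c * kron e d))) * rho ε y ^ (-5 : ℤ)
  + (-45) * (y a * y b * (y c * y d) * y e) * rho ε y ^ (-7 : ℤ)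

theorem hasPd_quartic {ε : ℝ} {y : E3} (h : 0 < ‖y‖ ^ 2 + ε ^ 2) (e a b c d : Fin 3) :
    HasPd e (fun y => quartic ε y a b c d) (quintic e ε y a b c d) y := by
  have hy := fun i => hasPd_coord e i y
  have h2 := fun i j => (hy i).mul (hy j)
  have := (((hasPd_rho_zpow h e (-1)).const_mul
    (3 * (kron c d * kron a b + kron b c * kron a d + kron b d * kron a c))).add
    ((((((((h2 a b).const_mul (kron c d)).add ((h2 a d).const_mul (kron b c))).add
      ((h2 a c).const_mul (kron b d))).add ((h2 c d).const_mul (kron a b))).add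
      ((h2 b d).const_mul (kron a c))).add
      ((h2 b c).const_mul (kron a d))).const_mul (-3) |>.mul (hasPd_rho_zpow h e (-3)))).add
    ((((h2 a b).mul (h2 c d)).const_mul 9).mul (hasPd_rho_zpow h e (-5)))
  refine ⟨this.1, this.2.trans ?_⟩
  norm_num [quintic]
  ring

/-- The cube matters because `|y|³` is a multiple of the fundamental solution of `Δ³` in dimension
three, so that its fourth derivatives have degree `-1`, like a fundamental solution of a second
order system. -/
theorem pd_pd_pd_pd_rho_cube {ε : ℝ} (hε : ε ≠ 0) (a b c d : Fin 3) :
    pd a (pd b (pd c (pd d fun y => rho ε y ^ (3 : ℤ)))) = fun y => quartic ε y a b c d := by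
  have h : ∀ y : E3, 0 < ‖y‖ ^ 2 + ε ^ 2 := fun y => by positivity
  have e1 : (pd d fun y => rho ε y ^ (3 : ℤ)) = fun y => 3 * (y d * rho ε y ^ (1 : ℤ)) := by
    funext y
    rw [(hasPd_rho_zpow (h y) d 3).2]
    norm_num; ring
  have e2 : (pd c fun y => 3 * (y d * rho ε y ^ (1 : ℤ)))
      = fun y => 3 * (kron c d * rho ε y ^ (1 : ℤ) + y c * y d * rho ε y ^ (-1 : ℤ)) := by
    funext y
    refine (((hasPd_coord c d y).mul (hasPd_rho_zpow (h y) c 1)).const_mul 3).2.trans ?_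
    norm_num; ring
  have e3 : (pd b fun y => 3 * (kron c d * rho ε y ^ (1 : ℤ) + y c * y d * rho ε y ^ (-1 : ℤ)))
      = fun y => 3 * ((kron c d * y b + kron b c * y d + kron b d * y c) * rho ε y ^ (-1 : ℤ)
        + (-1) * (y b * (y c * y d) * rho ε y ^ (-3 : ℤ))) := by
    funext y
    refine ((((hasPd_rho_zpow (h y) b 1).const_mul _).add
      (((hasPd_coord b c y).mul (hasPd_coord b d y)).mul
        (hasPd_rho_zpow (h y) b (-1)))).const_mul 3).2.trans ?_
    norm_num; ring
  rw [e1, e2, e3]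
  funext y
  refine (((((((hasPd_coord a b y).const_mul (kron c d)).add
    ((hasPd_coord a d y).const_mul (kron b c))).add
    ((hasPd_coord a c y).const_mul (kron b d))).mul (hasPd_rho_zpow (h y) a (-1))).add
    ((((hasPd_coord a b y).mul ((hasPd_coord a c y).mul (hasPd_coord a d y))).mul
        (hasPd_rho_zpow (h y) a (-3))).const_mul (-1))).const_mul 3).2.trans ?_
  norm_num [quartic]
  ring

theorem contDiffAt_quartic {ε : ℝ} {y : E3} (h : 0 < ‖y‖ ^ 2 + ε ^ 2) {n : WithTop ℕ∞}
    (a b c d : Fin 3) : ContDiffAt ℝ n (fun y => quartic ε y a b c d) y := by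
  have h1 := contDiffAt_rho_zpow h (n := n) (-1)
  have h3 := contDiffAt_rho_zpow h (n := n) (-3)
  have h5 := contDiffAt_rho_zpow h (n := n) (-5)
  have hy : ∀ i, ContDiffAt ℝ n (fun y : E3 => y i) y := fun i =>
    (EuclideanSpace.proj i : E3 →L[ℝ] ℝ).contDiff.contDiffAt
  have h2 := fun i j => (hy i).mul (hy j)
  exact ((contDiffAt_const.mul h1).add ((contDiffAt_const.mul ((((((contDiffAt_const.mul
    (h2 _ _)).add (contDiffAt_const.mul (h2 _ _))).add (contDiffAt_const.mul (h2 _ _))).add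
    (contDiffAt_const.mul (h2 _ _))).add (contDiffAt_const.mul (h2 _ _))).add
    (contDiffAt_const.mul (h2 _ _)))).mul h3)).add
    ((contDiffAt_const.mul ((h2 _ _).mul (h2 _ _))).mul h5)

theorem continuousAt_quartic_left {y : E3} (hy : y ≠ 0) (ε : ℝ) (a b c d : Fin 3) :
    ContinuousAt (fun ε => quartic ε y a b c d) ε := by
  have hp : rho ε y ≠ 0 := (rho_pos (by positivity)).ne'
  have hz := fun m : ℤ => ((continuous_rho_left y).continuousAt (x := ε)).zpow₀ m (Or.inl hp)
  unfold quartic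
  exact ((continuousAt_const.mul (hz _)).add (continuousAt_const.mul (hz _))).add
    (continuousAt_const.mul (hz _))

theorem continuousAt_quintic_left {y : E3} (hy : y ≠ 0) (ε : ℝ) (e a b c d : Fin 3) :
    ContinuousAt (fun ε => quintic e ε y a b c d) ε := by
  have hp : rho ε y ≠ 0 := (rho_pos (by positivity)).ne'
  have hz := fun m : ℤ => ((continuous_rho_left y).continuousAt (x := ε)).zpow₀ m (Or.inl hp)
  unfold quintic
  exact ((continuousAt_const.mul (hz _)).add (continuousAt_const.mul (hz _))).add
    (continuousAt_const.mul (hz _))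

theorem abs_add_le_of_le {a b A B : ℝ} (ha : |a| ≤ A) (hb : |b| ≤ B) : |a + b| ≤ A + B :=
  (abs_add_le a b).trans (add_le_add ha hb)

theorem abs_mul_le_of_le {a b A B : ℝ} (ha : |a| ≤ A) (hb : |b| ≤ B) : |a * b| ≤ A * B := by
  rw [abs_mul]
  exact mul_le_mul ha hb (abs_nonneg _) ((abs_nonneg _).trans ha)

theorem abs_coord_div_rho_le (ε : ℝ) (y : E3) (i : Fin 3) : |y i / rho ε y| ≤ 1 := by
  have h0 : 0 ≤ rho ε y := Real.sqrt_nonneg _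
  rw [abs_div, abs_of_nonneg h0]
  exact div_le_one_of_le₀ ((abs_coord_le_norm y i).trans (norm_le_rho ε y)) h0

/-- Divided by `ρ⁻¹`, the expression is a polynomial in Kronecker symbols and quotients `y_i / ρ`,
all bounded by `1`, and `ρ ≥ |y|`. The constant is `3·3 + 3·6 + 9`. The bound is uniform in `ε`, as
dominated convergence requires. -/
theorem abs_quartic_le {ε : ℝ} {y : E3} (hy : y ≠ 0) (a b c d : Fin 3) :
    |quartic ε y a b c d| ≤ 36 * ‖y‖⁻¹ := by
  have hn : 0 < ‖y‖ := norm_pos_iff.2 hy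
  have hp : 0 < rho ε y := hn.trans_le (norm_le_rho ε y)
  have hw := abs_coord_div_rho_le ε y
  have hk := abs_kron_le
  have hkk := fun i j p q => abs_mul_le_of_le (hk i j) (hk p q)
  have hww := fun i j => abs_mul_le_of_le (hw i) (hw j)
  have hkw := fun i j p q => abs_mul_le_of_le (hk i j) (hww p q)
  have h3 : |(3 : ℝ)| ≤ 3 := by norm_num
  have h3' : |(-3 : ℝ)| ≤ 3 := by norm_num
  have h9 : |(9 : ℝ)| ≤ 9 := by norm_num
  have hr : |(rho ε y)⁻¹| ≤ ‖y‖⁻¹ := by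
    rw [abs_of_pos (inv_pos.2 hp)]
    exact inv_anti₀ hn (norm_le_rho ε y)
  have key := abs_mul_le_of_le (abs_add_le_of_le (abs_add_le_of_le
    (abs_mul_le_of_le h3 (abs_add_le_of_le (abs_add_le_of_le (hkk c d a b) (hkk b c a d))
      (hkk b d a c)))
    (abs_mul_le_of_le h3' (abs_add_le_of_le (abs_add_le_of_le (abs_add_le_of_le
      (abs_add_le_of_le (abs_add_le_of_le (hkw c d a b) (hkw b c a d)) (hkw b d a c))
      (hkw a b c d)) (hkw a c b d)) (hkw a d b c))))
    (abs_mul_le_of_le h9 (abs_mul_le_of_le (hww a b) (hww c d)))) hr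
  refine (congrArg abs ?_).le.trans (key.trans_eq (by norm_num))
  rw [quartic, _root_.zpow_neg_one, show (-3 : ℤ) = -((3 : ℕ) : ℤ) by rfl,
    show (-5 : ℤ) = -((5 : ℕ) : ℤ) by rfl, _root_.zpow_neg, _root_.zpow_neg, zpow_natCast, zpow_natCast]
  field_simp

/-- The same scaling argument with one more factor `ρ⁻¹`. The constant is `3·15 + 9·10 + 45`. -/
theorem abs_quintic_le {ε : ℝ} {y : E3} (hy : y ≠ 0) (e a b c d : Fin 3) :
    |quintic e ε y a b c d| ≤ 180 * (‖y‖ ^ 2)⁻¹ := by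
  have hn : 0 < ‖y‖ := norm_pos_iff.2 hy
  have hp : 0 < rho ε y := hn.trans_le (norm_le_rho ε y)
  have hw := abs_coord_div_rho_le ε y
  have hk := abs_kron_le
  have hkk := fun i j p q => abs_mul_le_of_le (hk i j) (hk p q)
  have hww := fun i j => abs_mul_le_of_le (hw i) (hw j)
  have hkw := fun i j p q => abs_mul_le_of_le (hk i j) (hww p q)
  have hd := fun i j => abs_add_le_of_le (abs_mul_le_of_le (hk e i) (hw j))
    (abs_mul_le_of_le (hw i) (hk e j))
  have hkd := fun i j p q => abs_mul_le_of_le (hk i j) (hd p q)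
  have h3' : |(-3 : ℝ)| ≤ 3 := by norm_num
  have h9 : |(9 : ℝ)| ≤ 9 := by norm_num
  have h45 : |(-45 : ℝ)| ≤ 45 := by norm_num
  have hr : |(rho ε y ^ 2)⁻¹| ≤ (‖y‖ ^ 2)⁻¹ := by
    rw [abs_of_pos (by positivity)]
    exact inv_anti₀ (by positivity) (by gcongr; exact norm_le_rho ε y)
  have key := abs_mul_le_of_le (abs_add_le_of_le (abs_add_le_of_le
    (abs_mul_le_of_le h3' (abs_add_le_of_le (abs_add_le_of_le (abs_add_le_of_le
      (abs_add_le_of_le (abs_add_le_of_le (abs_add_le_of_le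
      (abs_mul_le_of_le (abs_add_le_of_le (abs_add_le_of_le (hkk c d a b) (hkk b c a d))
      (hkk b d a c)) (hw e)) (hkd c d a b)) (hkd b c a d)) (hkd b d a c))
      (hkd a b c d)) (hkd a c b d)) (hkd a d b c)))
    (abs_mul_le_of_le h9 (abs_add_le_of_le (abs_mul_le_of_le (abs_add_le_of_le (abs_add_le_of_le
      (abs_add_le_of_le (abs_add_le_of_le (abs_add_le_of_le (hkw c d a b) (hkw b c a d))
      (hkw b d a c)) (hkw a b c d)) (hkw a c b d)) (hkw a d b c)) (hw e))
      (abs_add_le_of_le (abs_mul_le_of_le (hd a b) (hww c d))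
        (abs_mul_le_of_le (hww a b) (hd c d))))))
    (abs_mul_le_of_le h45 (abs_mul_le_of_le (abs_mul_le_of_le (hww a b) (hww c d)) (hw e)))) hr
  refine (congrArg abs ?_).le.trans (key.trans_eq (by norm_num))
  rw [quintic, show (-3 : ℤ) = -((3 : ℕ) : ℤ) by rfl, show (-7 : ℤ) = -((7 : ℕ) : ℤ) by rfl,
    show (-5 : ℤ) = -((5 : ℕ) : ℤ) by rfl, _root_.zpow_neg, _root_.zpow_neg, _root_.zpow_neg, zpow_natCast,
    zpow_natCast, zpow_natCast]
  field_simp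

/-! ### The regularised fundamental solution -/

/-- Fourth order tensors. -/
abbrev Tensor4 : Type := Fin 3 → Fin 3 → Fin 3 → Fin 3 → ℝ

/-- The linear form that sends the fourth derivatives of `|y|³` to the component `p q` of the
fundamental solution with right-hand side `S δ₀`. -/
noncomputable def fundForm (k : ℝ) (S : Matrix (Fin 3) (Fin 3) ℝ) (p q : Fin 3) :
    Tensor4 →ₗ[ℝ] ℝ where
  toFun T := (96 * Real.pi)⁻¹ * S p q * (∑ c, ∑ d, T c c d d)
    + (-k / (96 * Real.pi * (2 + k))) * (∑ c, ∑ d, (S q c * T p c d d + S p c * T q c d d))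
    + k ^ 2 / (96 * Real.pi * (2 + k) * (3 + 2 * k)) * (∑ c, ∑ d, S c d * T p q c d)
    + k / (96 * Real.pi * (3 + 2 * k)) * S.trace * (∑ c, T p q c c)
  map_add' T T' := by
    simp only [Pi.add_apply, mul_add, Finset.sum_add_distrib]
    ring
  map_smul' r T := by
    simp only [Pi.smul_apply, smul_eq_mul, mul_left_comm _ r, ← mul_add, ← Finset.mul_sum,
      RingHom.id_apply]

theorem exists_abs_fundForm_le (k : ℝ) (S : Matrix (Fin 3) (Fin 3) ℝ) (p q : Fin 3) :
    ∃ C : ℝ, 0 ≤ C ∧ ∀ (T : Tensor4) (M : ℝ), (∀ a b c d, |T a b c d| ≤ M) →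
      |fundForm k S p q T| ≤ C * M := by
  refine ⟨‖LinearMap.toContinuousLinearMap (fundForm k S p q)‖, norm_nonneg _, fun T M h => ?_⟩
  have hM : 0 ≤ M := (abs_nonneg _).trans (h 0 0 0 0)
  have h1 := (LinearMap.toContinuousLinearMap (fundForm k S p q)).le_opNorm T
  refine (h1 : |fundForm k S p q T| ≤ _).trans ?_
  gcongr
  simp only [pi_norm_le_iff_of_nonneg hM]
  exact h

theorem hasPd_fundForm (k : ℝ) (S : Matrix (Fin 3) (Fin 3) ℝ) (p q : Fin 3)
    {T : E3 → Tensor4} {T' : Tensor4} {x : E3} {l : Fin 3}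
    (h : ∀ a b c d, HasPd l (fun y => T y a b c d) (T' a b c d) x) :
    HasPd l (fun y => fundForm k S p q (T y)) (fundForm k S p q T') x := by
  have hT : DifferentiableAt ℝ T x := by
    simp only [differentiableAt_pi]
    exact fun a b c d => (h a b c d).1
  have h1 := (LinearMap.toContinuousLinearMap (fundForm k S p q)).hasFDerivAt.comp x hT.hasFDerivAt
  refine ⟨h1.differentiableAt, (HasFDerivAt.pd_eq h1 l).trans ?_⟩
  change fundForm k S p q (fderiv ℝ T x (EuclideanSpace.single l 1)) = _
  congr 1
  funext a b c d
  have h2 : HasFDerivAt (fun y => T y a b c d)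
      ((ContinuousLinearMap.proj d).comp ((ContinuousLinearMap.proj c).comp
        ((ContinuousLinearMap.proj b).comp ((ContinuousLinearMap.proj a).comp (fderiv ℝ T x))))) x :=
    hasFDerivAt_pi'.1 (hasFDerivAt_pi'.1 (hasFDerivAt_pi'.1 (hasFDerivAt_pi'.1
      hT.hasFDerivAt a) b) c) d
  rw [← (h a b c d).2, HasFDerivAt.pd_eq h2 l]
  rfl

theorem contDiffAt_fundForm (k : ℝ) (S : Matrix (Fin 3) (Fin 3) ℝ) (p q : Fin 3)
    {T : E3 → Tensor4} {x : E3} {n : WithTop ℕ∞}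
    (h : ∀ a b c d, ContDiffAt ℝ n (fun y => T y a b c d) x) :
    ContDiffAt ℝ n (fun y => fundForm k S p q (T y)) x := by
  refine (LinearMap.toContinuousLinearMap (fundForm k S p q)).contDiff.contDiffAt.comp x ?_
  simp only [contDiffAt_pi]
  exact h

/-- The fundamental solution with `|y|` replaced by `√(|y|² + ε²)`. -/
noncomputable def regFund (k : ℝ) (S : Matrix (Fin 3) (Fin 3) ℝ) (ε : ℝ) : MatField :=
  fun y p q => fundForm k S p q (quartic ε y)

theorem regFund_isSymm (k : ℝ) {S : Matrix (Fin 3) (Fin 3) ℝ} (hS : S.IsSymm) (ε : ℝ) (y : E3) :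
    (regFund k S ε y).IsSymm := by
  ext p q
  have h1 : ∀ a b c d, quartic ε y a b c d = quartic ε y b a c d := by
    intro a b c d
    simp only [quartic, kron_comm b a]
    ring
  simp only [Matrix.transpose_apply, regFund, fundForm, LinearMap.coe_mk, AddHom.coe_mk]
  rw [hS.apply p q]
  simp_rw [h1 q p]
  have h2 : ∑ c, ∑ d, (S p c * quartic ε y q c d d + S q c * quartic ε y p c d d)
      = ∑ c, ∑ d, (S q c * quartic ε y p c d d + S p c * quartic ε y q c d d) :=
    Finset.sum_congr rfl fun c _ => Finset.sum_congr rfl fun d _ => add_comm _ _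
  rw [h2]

theorem symUnit_isSymm (m n : Fin 3) : (symUnit m n).IsSymm := by
  ext i j
  simp only [Matrix.transpose_apply, symUnit]
  congr 1
  simp only [eq_iff_iff]
  tauto

/-- With the common factors `r⁻⁵` and `(96π(2+k)(3+2k))⁻¹` taken out, both sides are polynomials in
the coordinates, the entries of the symmetric matrix `S`, and `k`. -/
theorem fundSol_eq_regFund {k : ℝ} (hk2 : 2 + k ≠ 0) (hk3 : 3 + 2 * k ≠ 0) (m n : Fin 3)
    {y : E3} (hy : y ≠ 0) : fundSol k m n y = regFund k (symUnit m n) 0 y := by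
  ext i j
  have hS := symUnit_isSymm m n
  have hpi := Real.pi_ne_zero
  have hk3' : 3 + k * 2 ≠ 0 := by rwa [mul_comm k 2]
  set S := symUnit m n with hSdef
  have hr : ‖y‖ ≠ 0 := norm_ne_zero_iff.2 hy
  have hr2 : ‖y‖ ^ 2 = y 0 ^ 2 + y 1 ^ 2 + y 2 ^ 2 := by
    rw [norm_sq_eq_sum, Fin.sum_univ_three]
  have h10 : S 1 0 = S 0 1 := hS.apply 0 1
  have h20 : S 2 0 = S 0 2 := hS.apply 0 2
  have h21 : S 2 1 = S 1 2 := hS.apply 1 2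
  have e3 : ‖y‖ ^ (-3 : ℤ) = (‖y‖ ^ 3)⁻¹ := by rw [_root_.zpow_neg]; rfl
  have e5 : ‖y‖ ^ (-5 : ℤ) = (‖y‖ ^ 5)⁻¹ := by rw [_root_.zpow_neg]; rfl
  have h4 : ‖y‖ ^ 4 = ‖y‖ ^ 2 * ‖y‖ ^ 2 := by ring
  have hz1 : ‖y‖ ^ (-1 : ℤ) = ‖y‖ ^ 2 * ‖y‖ ^ 2 * (‖y‖ ^ 5)⁻¹ := by
    rw [_root_.zpow_neg_one]; field_simp
  have hz3 : ‖y‖ ^ (-3 : ℤ) = ‖y‖ ^ 2 * (‖y‖ ^ 5)⁻¹ := by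
    rw [e3]; field_simp
  simp only [fundSol, ← hSdef, regFund, fundForm, LinearMap.coe_mk, AddHom.coe_mk, quartic,
    rho_zero, hz1, hz3, e5, h4]
  have hc : (32 * Real.pi * (2 + k) * (3 + 2 * k) * ‖y‖ ^ 5)⁻¹
      = 3 * ((96 * Real.pi * (2 + k) * (3 + 2 * k))⁻¹ * (‖y‖ ^ 5)⁻¹) := by
    field_simp; norm_num
  have c1 : (96 * Real.pi)⁻¹ = (2 + k) * (3 + 2 * k) * (96 * Real.pi * (2 + k) * (3 + 2 * k))⁻¹ := by
    field_simp
  have c2 : -k / (96 * Real.pi * (2 + k))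
      = -k * (3 + 2 * k) * (96 * Real.pi * (2 + k) * (3 + 2 * k))⁻¹ := by
    field_simp
  have c3 : k ^ 2 / (96 * Real.pi * (2 + k) * (3 + 2 * k))
      = k ^ 2 * (96 * Real.pi * (2 + k) * (3 + 2 * k))⁻¹ := by
    field_simp
  have c4 : k / (96 * Real.pi * (3 + 2 * k))
      = k * (2 + k) * (96 * Real.pi * (2 + k) * (3 + 2 * k))⁻¹ := by
    field_simp
  rw [div_eq_mul_inv, hc, c1, c2, c3, c4]
  -- With the inverses turned into free variables and `r²` written in coordinates, each of the nine
  -- components is a polynomial identity.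
  generalize (96 * Real.pi * (2 + k) * (3 + 2 * k))⁻¹ = e
  generalize (‖y‖ ^ 5)⁻¹ = g
  rw [hr2]
  fin_cases i <;> fin_cases j <;>
  · simp [Fin.sum_univ_three, kron, Matrix.mulVec, dotProduct, Matrix.trace, h10, h20, h21]
    ring

/-! ### Constant coefficient operators on smooth functions -/

/-- The space of smooth functions. -/
def SmoothFn : Submodule ℝ (E3 → ℝ) where
  carrier := {f | ∀ n : ℕ, ContDiff ℝ n f}
  add_mem' hf hg n := (hf n).add (hg n)
  zero_mem' _ := contDiff_const
  smul_mem' _ _ hf n := contDiff_const.smul (hf n)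

theorem differentiable_smoothFn (f : SmoothFn) : Differentiable ℝ f.1 :=
  (f.2 1).differentiable (by norm_num)

/-- The partial derivative as an endomorphism. -/
noncomputable def pdEnd (l : Fin 3) : Module.End ℝ SmoothFn where
  toFun f := ⟨pd l f.1, fun n => contDiff_pd (f.2 (n + 1)) (by norm_cast) l⟩
  map_add' f g := by
    ext x
    exact pd_add (differentiable_smoothFn f x) (differentiable_smoothFn g x) l
  map_smul' c f := by
    ext x
    exact pd_const_mul (differentiable_smoothFn f x) c l

theorem pdEnd_mul_comm (a b : Fin 3) : pdEnd a * pdEnd b = pdEnd b * pdEnd a := by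
  ext f x
  exact pd_comm (f.2 2).contDiffAt a b

/-- The algebra of constant coefficient differential operators. -/
noncomputable def diffOps : Subalgebra ℝ (Module.End ℝ SmoothFn) :=
  Algebra.adjoin ℝ (Set.range pdEnd)

/-- `MvPolynomial.aeval` needs a commutative target. Endomorphisms do not commute in general, but
the algebra generated by the partial derivatives does, since mixed derivatives of smooth functions
agree. -/
instance : IsMulCommutative diffOps :=
  Algebra.isMulCommutative_adjoin ℝ (by
    rintro _ ⟨a, rfl⟩ _ ⟨b, rfl⟩
    exact pdEnd_mul_comm a b)

open scoped IsMulCommutative in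
/-- The operator with symbol `P`. -/
noncomputable def symbolHom : MvPolynomial (Fin 3) ℝ →ₐ[ℝ] diffOps :=
  MvPolynomial.aeval fun l => (⟨pdEnd l, Algebra.subset_adjoin ⟨l, rfl⟩⟩ : diffOps)

/-- The action of the operator with symbol `P`. -/
noncomputable def act (P : MvPolynomial (Fin 3) ℝ) (f : SmoothFn) : SmoothFn :=
  (symbolHom P).1 f

theorem act_add (P R : MvPolynomial (Fin 3) ℝ) (f : SmoothFn) :
    act (P + R) f = act P f + act R f := by
  simp only [act, map_add]; rfl

theorem act_mul (P R : MvPolynomial (Fin 3) ℝ) (f : SmoothFn) :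
    act (P * R) f = act P (act R f) := by
  simp only [act, map_mul]; rfl

theorem act_C_mul (r : ℝ) (P : MvPolynomial (Fin 3) ℝ) (f : SmoothFn) :
    act (MvPolynomial.C r * P) f = r • act P f := by
  rw [← MvPolynomial.smul_eq_C_mul]
  simp only [act, map_smul]; rfl

theorem act_neg (P : MvPolynomial (Fin 3) ℝ) (f : SmoothFn) :
    act (-P) f = -act P f := by
  have h := act_C_mul (-1) P f
  rw [map_neg, map_one, neg_one_mul] at h
  refine h.trans ?_
  ext x
  exact neg_one_mul ((act P f).1 x)

theorem act_sub (P R : MvPolynomial (Fin 3) ℝ) (f : SmoothFn) :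
    act (P - R) f = act P f - act R f := by
  rw [sub_eq_add_neg, act_add, act_neg, sub_eq_add_neg]

theorem act_X (l : Fin 3) (f : SmoothFn) : act (MvPolynomial.X l) f = pdEnd l f := by
  simp [act, symbolHom]

theorem act_sum {ι : Type*} (s : Finset ι) (P : ι → MvPolynomial (Fin 3) ℝ) (f : SmoothFn) :
    act (∑ i ∈ s, P i) f = ∑ i ∈ s, act (P i) f := by
  classical
  induction s using Finset.induction_on with
  | empty => simp only [Finset.sum_empty, act, map_zero]; rfl
  | insert a s ha ih => rw [Finset.sum_insert ha, Finset.sum_insert ha, act_add, ih]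

theorem act_X_mul_apply (l : Fin 3) (P : MvPolynomial (Fin 3) ℝ) (f : SmoothFn) (x : E3) :
    (act (MvPolynomial.X l * P) f).1 x = pd l (act P f).1 x := by
  rw [act_mul, act_X]; rfl

theorem coe_sum_apply {ι : Type*} (s : Finset ι) (g : ι → SmoothFn) (x : E3) :
    (∑ i ∈ s, g i).1 x = ∑ i ∈ s, (g i).1 x := by
  rw [← Submodule.subtype_apply, map_sum, Finset.sum_apply]; rfl

open MvPolynomial in
/-- The symbol of the fundamental solution relative to `|y|³`. -/
noncomputable def fundSymbol (k : ℝ) (S : Matrix (Fin 3) (Fin 3) ℝ) (p q : Fin 3) :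
    MvPolynomial (Fin 3) ℝ :=
  C ((96 * Real.pi)⁻¹ * S p q) * (∑ c, ∑ d, X c * (X c * (X d * X d)))
    + C (-k / (96 * Real.pi * (2 + k))) * (∑ c, ∑ d, (C (S q c) * (X p * (X c * (X d * X d)))
      + C (S p c) * (X q * (X c * (X d * X d)))))
    + C (k ^ 2 / (96 * Real.pi * (2 + k) * (3 + 2 * k)))
      * (∑ c, ∑ d, C (S c d) * (X p * (X q * (X c * X d))))
    + C (k / (96 * Real.pi * (3 + 2 * k)) * S.trace) * (∑ c, X p * (X q * (X c * X c)))

-- The coefficients of `fundSymbol` come from solving `𝒟* F = S δ₀` algebraically. The double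
-- divergence and the Laplacian of the trace satisfy a 2×2 system of determinant `1 + 2k/3`, and the
-- divergence then carries the factor `1 + k/2`; hence the two conditions on `k`. Given the
-- coefficients, verification is pure ring arithmetic.
open MvPolynomial in
theorem fundSymbol_adjoint {k : ℝ} (hk2 : 2 + k ≠ 0) (hk3 : 3 + 2 * k ≠ 0)
    {S : Matrix (Fin 3) (Fin 3) ℝ} (hS : S.IsSymm) (i j : Fin 3) :
    -(∑ l, X l * (X l * fundSymbol k S i j))
      - C (k / 2) * ((∑ l, X i * (X l * fundSymbol k S l j))
        + (∑ l, X j * (X l * fundSymbol k S l i))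
        - C (2 / 3) * ∑ l, X i * (X j * fundSymbol k S l l))
      = C (-(96 * Real.pi)⁻¹ * S i j)
        * ((∑ l, X l * X l) * ((∑ l, X l * X l) * (∑ l, X l * X l))) := by
  have h10 : S 1 0 = S 0 1 := hS.apply 0 1
  have h20 : S 2 0 = S 0 2 := hS.apply 0 2
  have h21 : S 2 1 = S 1 2 := hS.apply 1 2
  have hpi := Real.pi_ne_zero
  have hk3' : 3 + k * 2 ≠ 0 := by rwa [mul_comm k 2]
  have c1 : (96 * Real.pi)⁻¹ = (2 + k) * (3 + 2 * k) * (96 * Real.pi * (2 + k) * (3 + 2 * k))⁻¹ := by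
    field_simp
  have c2 : -k / (96 * Real.pi * (2 + k))
      = -k * (3 + 2 * k) * (96 * Real.pi * (2 + k) * (3 + 2 * k))⁻¹ := by
    field_simp
  have c3 : k ^ 2 / (96 * Real.pi * (2 + k) * (3 + 2 * k))
      = k ^ 2 * (96 * Real.pi * (2 + k) * (3 + 2 * k))⁻¹ := by
    field_simp
  have c4 : k / (96 * Real.pi * (3 + 2 * k))
      = k * (2 + k) * (96 * Real.pi * (2 + k) * (3 + 2 * k))⁻¹ := by
    field_simp
  -- `ring` treats each `C _` as an atom, so all constants built from `k` are first expressed as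
  -- integer multiples of the single atom `C (k / 6)`.
  have d1 : (C (k / 2) : MvPolynomial (Fin 3) ℝ) = 3 * C (k / 6) := by
    rw [show (3 : MvPolynomial (Fin 3) ℝ) = C 3 from (map_ofNat C 3).symm, ← C_mul]
    congr 1; ring
  have d2 : (C k : MvPolynomial (Fin 3) ℝ) = 6 * C (k / 6) := by
    rw [show (6 : MvPolynomial (Fin 3) ℝ) = C 6 from (map_ofNat C 6).symm, ← C_mul]
    congr 1; ring
  have d3 : (3 : MvPolynomial (Fin 3) ℝ) * C (2 / 3) = 2 := by
    rw [show (3 : MvPolynomial (Fin 3) ℝ) = C 3 from (map_ofNat C 3).symm, ← C_mul,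
      show (2 : MvPolynomial (Fin 3) ℝ) = C 2 from (map_ofNat C 2).symm]
    norm_num
  have d4 : ∀ t : MvPolynomial (Fin 3) ℝ, C (k / 2) * (C (2 / 3) * t) = 2 * C (k / 6) * t := by
    intro t
    rw [d1]
    linear_combination C (k / 6) * t * d3
  simp only [fundSymbol, c1, c2, c3, c4]
  rw [mul_sub (C (k / 2)), d4, d1]
  generalize (96 * Real.pi * (2 + k) * (3 + 2 * k))⁻¹ = e
  simp only [C_mul, C_add, C_neg, C_pow, map_ofNat, d2, Matrix.trace, Fin.sum_univ_three,
    Matrix.diag_apply]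
  generalize C (k / 6) = K
  generalize C e = E
  generalize (X 0 : MvPolynomial (Fin 3) ℝ) = x
  generalize (X 1 : MvPolynomial (Fin 3) ℝ) = y
  generalize (X 2 : MvPolynomial (Fin 3) ℝ) = z
  fin_cases i <;> fin_cases j <;>
  · simp only [h10, h20, h21, Fin.zero_eta, Fin.mk_one, Fin.reduceFinMk]
    ring

/-- The powers of `√(|y|² + ε²)` as smooth functions. -/
noncomputable def rhoPow {ε : ℝ} (hε : ε ≠ 0) (m : ℤ) : SmoothFn :=
  ⟨fun y => rho ε y ^ m, fun _ => contDiff_iff_contDiffAt.2 fun _ =>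
    contDiffAt_rho_zpow (by positivity) m⟩

-- The trace of the Hessian of `ρ^m` contains `|y|²`, which is replaced by `ρ² - ε²`; the dimension
-- three enters through `3m + m(m-2) = m(m+1)`.
open MvPolynomial in
theorem act_laplace_rhoPow {ε : ℝ} (hε : ε ≠ 0) (m : ℤ) :
    act (∑ l, X l * X l) (rhoPow hε m)
      = (m * (m + 1) : ℝ) • rhoPow hε (m - 2)
        + (-(m * (m - 2) * ε ^ 2) : ℝ) • rhoPow hε (m - 4) := by
  have hpos : ∀ y : E3, 0 < ‖y‖ ^ 2 + ε ^ 2 := fun y => by positivity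
  ext x
  rw [act_sum, coe_sum_apply]
  have h1 : ∀ l : Fin 3, (act (X l * X l) (rhoPow hε m)).1 x
      = m * rho ε x ^ (m - 2) + m * (m - 2) * (x l ^ 2 * rho ε x ^ (m - 4)) := by
    intro l
    rw [act_X_mul_apply, act_X]
    have e1 : (pdEnd l (rhoPow hε m)).1 = fun y => m * (y l * rho ε y ^ (m - 2)) := by
      funext y
      change pd l (fun y => rho ε y ^ m) y = _
      rw [(hasPd_rho_zpow (hpos y) l m).2]
      ring
    rw [e1, (((hasPd_coord l l x).mul (hasPd_rho_zpow (hpos x) l (m - 2))).const_mul (m : ℝ)).2]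
    rw [show m - 2 - 2 = m - 4 by ring]
    simp only [kron, if_true]
    push_cast
    ring
  simp_rw [h1]
  have hp := rho_pos (hpos x)
  have hs : rho ε x ^ (m - 2) = rho ε x ^ (m - 4) * rho ε x ^ 2 := by
    rw [← zpow_natCast, ← zpow_add₀ hp.ne']
    congr 1; push_cast; ring
  change _ = (m * (m + 1) : ℝ) * rho ε x ^ (m - 2)
        + (-(m * (m - 2) * ε ^ 2) : ℝ) * rho ε x ^ (m - 4)
  rw [Fin.sum_univ_three, hs, rho_sq, norm_sq_eq_sum, Fin.sum_univ_three]
  ring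

theorem act_smul (P : MvPolynomial (Fin 3) ℝ) (r : ℝ) (f : SmoothFn) :
    act P (r • f) = r • act P f :=
  map_smul (symbolHom P).1 r f

theorem act_add_right (P : MvPolynomial (Fin 3) ℝ) (f g : SmoothFn) :
    act P (f + g) = act P f + act P g :=
  map_add (symbolHom P).1 f g

-- Iterating `act_laplace_rhoPow`, all lower powers of `ε` cancel at the third Laplacian. The
-- surviving bump has total mass `-96 π` for every `ε`: it is the smoothed form of `Δ³ |y|³ = -96 π
-- δ₀`.
open MvPolynomial in
theorem act_laplace_cube {ε : ℝ} (hε : ε ≠ 0) (x : E3) :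
    (act ((∑ l, X l * X l) * ((∑ l, X l * X l) * (∑ l, X l * X l))) (rhoPow hε 3)).1 x
      = -(315 * ε ^ 6) * rho ε x ^ (-9 : ℤ) := by
  have h := act_laplace_rhoPow hε
  rw [act_mul, act_mul, h 3]
  simp only [act_add_right, act_smul, h]
  have hadd : ∀ f g : SmoothFn, (f + g).1 x = f.1 x + g.1 x := fun _ _ => rfl
  have hsmul : ∀ (r : ℝ) (f : SmoothFn), (r • f).1 x = r * f.1 x := fun _ _ => rfl
  simp only [hadd, hsmul, rhoPow]
  norm_num
  ring

theorem act_fundSymbol (k : ℝ) (S : Matrix (Fin 3) (Fin 3) ℝ) {ε : ℝ} (hε : ε ≠ 0)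
    (p q : Fin 3) :
    (act (fundSymbol k S p q) (rhoPow hε 3)).1 = fun y => regFund k S ε y p q := by
  have hq : ∀ (a b c d : Fin 3) (y : E3), (act (MvPolynomial.X a * (MvPolynomial.X b *
      (MvPolynomial.X c * MvPolynomial.X d))) (rhoPow hε 3)).1 y = quartic ε y a b c d := by
    intro a b c d y
    rw [← congrFun (pd_pd_pd_pd_rho_cube hε a b c d) y]
    rw [act_mul, act_mul, act_mul, act_X, act_X, act_X, act_X]
    rfl
  funext y
  have hadd : ∀ f g : SmoothFn, (f + g).1 y = f.1 y + g.1 y := fun _ _ => rfl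
  have hsmul : ∀ (r : ℝ) (f : SmoothFn), (r • f).1 y = r * f.1 y := fun _ _ => rfl
  simp only [fundSymbol, act_add, act_C_mul, act_sum, hadd, hsmul, coe_sum_apply, hq, regFund,
    fundForm, LinearMap.coe_mk, AddHom.coe_mk]

theorem contDiffAt_regFund (k : ℝ) (S : Matrix (Fin 3) (Fin 3) ℝ) {ε : ℝ} {y : E3}
    (h : 0 < ‖y‖ ^ 2 + ε ^ 2) {n : WithTop ℕ∞} (p q : Fin 3) :
    ContDiffAt ℝ n (fun y => regFund k S ε y p q) y :=
  contDiffAt_fundForm k S p q fun a b c d => contDiffAt_quartic h a b c d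

/-- `fundSymbol_adjoint`, read as an identity of operators acting on `ρ³`, replaces `𝒟*` by
`-(96π)⁻¹ S Δ³`, and `act_laplace_cube` evaluates the result. -/
theorem opDstar_regFund {k : ℝ} (hk2 : 2 + k ≠ 0) (hk3 : 3 + 2 * k ≠ 0)
    {S : Matrix (Fin 3) (Fin 3) ℝ} (hS : S.IsSymm) {ε : ℝ} (hε : ε ≠ 0) (i j : Fin 3) (y : E3) :
    opDstar k (regFund k S ε) i j y
      = S i j * (315 / (96 * Real.pi) * (ε ^ 6 * rho ε y ^ (-9 : ℤ))) := by
  have hadd : ∀ f g : SmoothFn, (f + g).1 y = f.1 y + g.1 y := fun _ _ => rfl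
  have hsub : ∀ f g : SmoothFn, (f - g).1 y = f.1 y - g.1 y := fun _ _ => rfl
  have hneg : ∀ f : SmoothFn, (-f).1 y = -f.1 y := fun _ => rfl
  have hsmul : ∀ (r : ℝ) (f : SmoothFn), (r • f).1 y = r * f.1 y := fun _ _ => rfl
  have hX : ∀ (a b p q : Fin 3), (act (MvPolynomial.X a * (MvPolynomial.X b *
      fundSymbol k S p q)) (rhoPow hε 3)).1 y = pd a (pd b fun y => regFund k S ε y p q) y := by
    intro a b p q
    rw [act_X_mul_apply, act_mul, act_X, ← act_fundSymbol k S hε p q]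
    rfl
  have key := congrArg (fun P => (act P (rhoPow hε 3)).1 y) (fundSymbol_adjoint hk2 hk3 hS i j)
  simp only [act_sub, act_neg, act_add, act_C_mul, act_sum, hadd, hsub, hneg, hsmul,
    coe_sum_apply, hX, act_laplace_cube] at key
  rw [opDstar_eq k isOpen_univ (fun i j => contDiff_iff_contDiffAt.2 (fun y =>
    contDiffAt_regFund k S (by positivity) i j) |>.contDiffOn) (Set.mem_univ y), key]
  have hpi := Real.pi_ne_zero
  field_simp

/-- The first partial derivatives of the regularised fundamental solution. -/
noncomputable def regFundPd (k : ℝ) (S : Matrix (Fin 3) (Fin 3) ℝ) (ε : ℝ) (l p q : Fin 3)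
    (y : E3) : ℝ :=
  fundForm k S p q (quintic l ε y)

theorem pd_regFund (k : ℝ) (S : Matrix (Fin 3) (Fin 3) ℝ) {ε : ℝ} {y : E3}
    (h : 0 < ‖y‖ ^ 2 + ε ^ 2) (l p q : Fin 3) :
    pd l (fun y => regFund k S ε y p q) y = regFundPd k S ε l p q y :=
  (hasPd_fundForm k S p q fun a b c d => hasPd_quartic h l a b c d).2

/-- One constant serves every `ε`, including `0`: positive `ε` is used to dominate the removal of
the regularisation, and `ε = 0` gives the decay of the singular part at infinity. -/
theorem exists_abs_regFund_le (k : ℝ) (S : Matrix (Fin 3) (Fin 3) ℝ) (p q : Fin 3) :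
    ∃ C : ℝ, 0 ≤ C ∧ ∀ (ε : ℝ) (y : E3), y ≠ 0 → |regFund k S ε y p q| ≤ C * ‖y‖⁻¹ ∧
      ∀ l, |regFundPd k S ε l p q y| ≤ C * (‖y‖ ^ 2)⁻¹ := by
  obtain ⟨C, hC, h⟩ := exists_abs_fundForm_le k S p q
  refine ⟨C * 180, by positivity, fun ε y hy => ⟨?_, fun l => ?_⟩⟩
  · refine (h _ _ fun a b c d => abs_quartic_le hy a b c d).trans ?_
    rw [mul_assoc]
    gcongr
    norm_num
  · refine (h _ _ fun a b c d => abs_quintic_le hy l a b c d).trans ?_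
    rw [mul_assoc]

theorem continuousAt_regFund_left (k : ℝ) (S : Matrix (Fin 3) (Fin 3) ℝ) {y : E3} (hy : y ≠ 0)
    (ε : ℝ) (p q : Fin 3) : ContinuousAt (fun ε => regFund k S ε y p q) ε := by
  refine (LinearMap.toContinuousLinearMap (fundForm k S p q)).continuous.continuousAt.comp ?_
  simp only [continuousAt_pi]
  exact continuousAt_quartic_left hy ε

theorem continuousAt_regFundPd_left (k : ℝ) (S : Matrix (Fin 3) (Fin 3) ℝ) {y : E3} (hy : y ≠ 0)
    (ε : ℝ) (l p q : Fin 3) : ContinuousAt (fun ε => regFundPd k S ε l p q y) ε := by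
  refine (LinearMap.toContinuousLinearMap (fundForm k S p q)).continuous.continuousAt.comp ?_
  simp only [continuousAt_pi]
  exact continuousAt_quintic_left hy ε l

/-! ### The approximate identity -/

/-- The substitution `w = r / √(r² + 1)` has `w' = (r² + 1)^(-3/2)` and `1 - w² = 1 / (r² + 1)`, so
the integrand is `w² (1 - w²)² w'`. As `w` runs from `0` to `1` the value is `1/3 - 2/5 + 1/7`. -/
theorem integral_Ioi_sq_mul_zpow :
    IntegrableOn (fun r : ℝ => r ^ 2 * (√(r ^ 2 + 1 ^ 2)) ^ (-9 : ℤ)) (Set.Ioi 0) ∧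
    ∫ r in Set.Ioi (0 : ℝ), r ^ 2 * (√(r ^ 2 + 1 ^ 2)) ^ (-9 : ℤ) = 8 / 105 := by
  set w : ℝ → ℝ := fun r => r / √(r ^ 2 + 1 ^ 2) with hw
  set H : ℝ → ℝ := fun r => w r ^ 3 / 3 - 2 * w r ^ 5 / 5 + w r ^ 7 / 7 with hH
  have hpos : ∀ r : ℝ, 0 < r ^ 2 + 1 ^ 2 := fun r => by positivity
  have hwd : ∀ r, HasDerivAt w ((√(r ^ 2 + 1 ^ 2)) ^ (-3 : ℤ)) r := by
    intro r
    have h1 : HasDerivAt (fun r : ℝ => r ^ 2 + 1 ^ 2) (2 * r) r := by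
      simpa using (hasDerivAt_pow 2 r).add_const (1 ^ 2)
    have hs : 0 < √(r ^ 2 + 1 ^ 2) := Real.sqrt_pos.2 (hpos r)
    have h2 := (hasDerivAt_id r).div (h1.sqrt (hpos r).ne') hs.ne'
    refine h2.congr_deriv ?_
    have hsq : √(r ^ 2 + 1 ^ 2) ^ 2 = r ^ 2 + 1 ^ 2 := Real.sq_sqrt (hpos r).le
    rw [show (-3 : ℤ) = -((3 : ℕ) : ℤ) by rfl, _root_.zpow_neg, zpow_natCast]
    simp only [id]
    generalize √(r ^ 2 + 1 ^ 2) = t at hs hsq ⊢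
    field_simp
    linarith
  have hd : ∀ r, HasDerivAt H (r ^ 2 * (√(r ^ 2 + 1 ^ 2)) ^ (-9 : ℤ)) r := by
    intro r
    have hs : 0 < √(r ^ 2 + 1 ^ 2) := Real.sqrt_pos.2 (hpos r)
    have hsq : √(r ^ 2 + 1 ^ 2) ^ 2 = r ^ 2 + 1 ^ 2 := Real.sq_sqrt (hpos r).le
    have h := ((((hwd r).pow 3).div_const 3).sub ((((hwd r).pow 5).const_mul 2).div_const 5)).add
      (((hwd r).pow 7).div_const 7)
    refine h.congr_deriv ?_
    rw [show (-3 : ℤ) = -((3 : ℕ) : ℤ) by rfl, show (-9 : ℤ) = -((9 : ℕ) : ℤ) by rfl,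
      _root_.zpow_neg, _root_.zpow_neg, zpow_natCast, zpow_natCast]
    simp only [hw]
    generalize √(r ^ 2 + 1 ^ 2) = t at hs hsq ⊢
    have e : (t ^ 2)⁻¹ = 1 - (r / t) ^ 2 := by
      field_simp
      linarith
    calc _ = (r / t) ^ 2 * (1 - (r / t) ^ 2) ^ 2 * (t ^ 3)⁻¹ := by norm_num; ring
      _ = r ^ 2 * (t ^ 9)⁻¹ := by rw [← e]; field_simp
  have hw1 : Tendsto w atTop (𝓝 1) := by
    have h1 : ∀ᶠ r : ℝ in atTop, √(1 - (r ^ 2 + 1 ^ 2)⁻¹) = w r := by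
      filter_upwards [eventually_gt_atTop 0] with r hr
      rw [hw, ← Real.sqrt_sq hr.le]
      simp only []
      rw [← Real.sqrt_div (by positivity), Real.sq_sqrt (by positivity)]
      congr 1
      field_simp
      ring
    refine Tendsto.congr' h1 ?_
    have h2 : Tendsto (fun r : ℝ => (r ^ 2 + 1 ^ 2)⁻¹) atTop (𝓝 0) :=
      (tendsto_atTop_add_const_right _ _ (tendsto_pow_atTop two_ne_zero)).inv_tendsto_atTop
    simpa using (h2.const_sub 1).sqrt
  have hlim : Tendsto H atTop (𝓝 (8 / 105)) := by
    have := (((hw1.pow 3).div_const 3).sub (((hw1.pow 5).const_mul 2).div_const 5)).add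
      ((hw1.pow 7).div_const 7)
    convert this using 2
    norm_num
  have h0 : H 0 = 0 := by simp [hH, hw]
  have hnn : ∀ r ∈ Set.Ioi (0 : ℝ), 0 ≤ r ^ 2 * (√(r ^ 2 + 1 ^ 2)) ^ (-9 : ℤ) :=
    fun r _ => by positivity
  refine ⟨integrableOn_Ioi_deriv_of_nonneg' (fun r _ => hd r) hnn hlim, ?_⟩
  rw [integral_Ioi_of_hasDerivAt_of_nonneg' (fun r _ => hd r) hnn hlim, h0, sub_zero]

theorem integral_rho_one : ∫ z : E3, rho 1 z ^ (-9 : ℤ) = 96 * Real.pi / 315 := by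
  have h := integral_fun_norm_addHaar (volume : Measure E3)
    (fun r => (√(r ^ 2 + 1 ^ 2)) ^ (-9 : ℤ))
  refine h.trans ?_
  have hv : (volume : Measure E3).real (Metric.ball 0 1) = Real.pi * 4 / 3 := by
    rw [Measure.real, EuclideanSpace.volume_ball_fin_three]
    simp
    positivity
  have e : ∫ y in Set.Ioi (0 : ℝ), y ^ (Module.finrank ℝ E3 - 1) • (√(y ^ 2 + 1 ^ 2)) ^ (-9 : ℤ)
      = 8 / 105 := by
    rw [← integral_Ioi_sq_mul_zpow.2]
    simp [finrank_euclideanSpace]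
  rw [e, hv]
  simp [finrank_euclideanSpace]
  ring

/-- The kernel is the rescaling `ε⁻³ φ((y - s)/ε)` of a probability density `φ`, a multiple of
`ρ₁⁻⁹`, which decays faster than `|z|⁻³`. -/
theorem tendsto_integral_rho (f : E3 → ℝ) (hf : Continuous f) (hfi : Integrable f) (s : E3) :
    Tendsto (fun ε : ℝ => ∫ y, f y * (315 / (96 * Real.pi) * (ε ^ 6 * rho ε (y - s) ^ (-9 : ℤ))))
      (𝓝[>] 0) (𝓝 (f s)) := by
  have hpi := Real.pi_pos
  have h1 := tendsto_integral_comp_smul_smul_of_integrable' (μ := (volume : Measure E3))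
    (φ := fun z : E3 => 315 / (96 * Real.pi) * rho 1 z ^ (-9 : ℤ)) (g := f) (x₀ := s)
    (fun z => by have : 0 ≤ rho 1 z := Real.sqrt_nonneg _; positivity)
    (by rw [integral_const_mul, integral_rho_one]; field_simp)
    (by
      have h2 : Tendsto (fun z : E3 => 315 / (96 * Real.pi) * ‖z‖⁻¹) (Bornology.cobounded E3)
          (𝓝 0) := by
        simpa using (tendsto_norm_cobounded_atTop (E := E3)).inv_tendsto_atTop.const_mul
          (315 / (96 * Real.pi))
      refine squeeze_zero' (Eventually.of_forall fun z => ?_) ?_ h2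
      · have : 0 ≤ rho 1 z := Real.sqrt_nonneg _
        positivity
      · have h3 : ∀ᶠ z : E3 in Bornology.cobounded E3, 1 ≤ ‖z‖ :=
          (tendsto_norm_cobounded_atTop (E := E3)).eventually_ge_atTop 1
        filter_upwards [h3] with z hz
        rw [mul_left_comm]
        gcongr
        have hr := norm_le_rho 1 z
        have hz0 : 0 < ‖z‖ := by linarith
        rw [show (-9 : ℤ) = -((9 : ℕ) : ℤ) by rfl, _root_.zpow_neg, zpow_natCast]
        have h4 : (rho 1 z ^ 9)⁻¹ ≤ (‖z‖ ^ 9)⁻¹ := by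
          gcongr
        calc ‖z‖ ^ Module.finrank ℝ E3 * (rho 1 z ^ 9)⁻¹ ≤ ‖z‖ ^ 3 * (‖z‖ ^ 9)⁻¹ := by
              rw [finrank_euclideanSpace, Fintype.card_fin]; gcongr
          _ = (‖z‖ ^ 6)⁻¹ := by field_simp
          _ ≤ ‖z‖⁻¹ := by
              gcongr
              exact le_self_pow₀ hz (by norm_num))
    hfi hf.continuousAt
  -- The concentration parameter of the approximate identity tends to infinity; it is taken to be
  -- `ε⁻¹`.
  have h2 := h1.comp (tendsto_inv_nhdsGT_zero (𝕜 := ℝ))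
  refine h2.congr' ?_
  filter_upwards [self_mem_nhdsWithin] with ε (hε : 0 < ε)
  refine integral_congr_ae (Eventually.of_forall fun y => ?_)
  have hr : rho 1 (ε⁻¹ • (s - y)) = rho ε (y - s) / ε := by
    rw [rho, rho, norm_smul, norm_sub_rev s y, mul_pow, Real.norm_eq_abs, sq_abs,
      eq_div_iff hε.ne', ← Real.sqrt_sq hε.le, ← Real.sqrt_mul (by positivity), Real.sq_sqrt (sq_nonneg ε)]
    congr 1
    field_simp
    rw [Real.sqrt_sq hε.le]
  simp only [smul_eq_mul, hr, finrank_euclideanSpace, Fintype.card_fin]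
  rw [show (-9 : ℤ) = -((9 : ℕ) : ℤ) by rfl, _root_.zpow_neg, _root_.zpow_neg, zpow_natCast,
    zpow_natCast, div_pow]
  field_simp

/-! ### Radial cut-off functions -/

/-- A smooth step from `0` on `(-∞, 1]` to `1` on `[2, ∞)`. -/
noncomputable def step (t : ℝ) : ℝ := Real.smoothTransition (t - 1)

theorem contDiff_step {n : ℕ∞} : ContDiff ℝ n step :=
  Real.smoothTransition.contDiff.comp (contDiff_id.sub contDiff_const)

theorem step_of_le {t : ℝ} (h : t ≤ 1) : step t = 0 :=
  Real.smoothTransition.zero_of_nonpos (by linarith)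

theorem step_of_ge {t : ℝ} (h : 2 ≤ t) : step t = 1 :=
  Real.smoothTransition.one_of_one_le (by linarith)

/-- The derivative of `step`. -/
noncomputable def stepDeriv : ℝ → ℝ := deriv step

/-- The second derivative of `step`. -/
noncomputable def stepDerivTwo : ℝ → ℝ := deriv stepDeriv

theorem hasDerivAt_step (t : ℝ) : HasDerivAt step (stepDeriv t) t :=
  ((contDiff_step (n := 1)).differentiable (by norm_num) t).hasDerivAt

theorem contDiff_stepDeriv {n : ℕ} : ContDiff ℝ n stepDeriv := by
  have h : ContDiff ℝ ((n : WithTop ℕ∞) + 1) step := by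
    exact_mod_cast contDiff_step (n := ((n + 1 : ℕ) : ℕ∞))
  exact (contDiff_succ_iff_deriv.1 h).2.2

theorem hasDerivAt_stepDeriv (t : ℝ) : HasDerivAt stepDeriv (stepDerivTwo t) t :=
  ((contDiff_stepDeriv (n := 1)).differentiable (by norm_num) t).hasDerivAt

theorem continuous_stepDeriv : Continuous stepDeriv := (contDiff_stepDeriv (n := 0)).continuous

theorem continuous_stepDerivTwo : Continuous stepDerivTwo :=
  (contDiff_stepDeriv (n := 1)).continuous_deriv (by norm_num)

/-- Continuity carries the vanishing to the endpoints `1` and `2`, where the boundary values in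
`integral_step` are evaluated. -/
theorem eq_zero_of_eqOn_compl_Icc {f : ℝ → ℝ} (hf : Continuous f)
    (h : ∀ t, t < 1 ∨ 2 < t → f t = 0) {t : ℝ} (ht : t ≤ 1 ∨ 2 ≤ t) : f t = 0 := by
  have hc : IsClosed {t | f t = 0} := isClosed_eq hf continuous_const
  have h1 : Set.Iio (1 : ℝ) ⊆ {t | f t = 0} := fun t ht => h t (Or.inl ht)
  have h2 : Set.Ioi (2 : ℝ) ⊆ {t | f t = 0} := fun t ht => h t (Or.inr ht)
  have h1' := closure_minimal h1 hc
  have h2' := closure_minimal h2 hc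
  rw [closure_Iio] at h1'
  rw [closure_Ioi] at h2'
  exact ht.elim (fun h => h1' h) fun h => h2' h

theorem stepDeriv_eq_zero {t : ℝ} (ht : t ≤ 1 ∨ 2 ≤ t) : stepDeriv t = 0 := by
  refine eq_zero_of_eqOn_compl_Icc continuous_stepDeriv (fun t ht => ?_) ht
  rcases ht with ht | ht
  · have : step =ᶠ[𝓝 t] fun _ => 0 :=
      mem_of_superset (Iio_mem_nhds ht) fun s hs => step_of_le (le_of_lt hs)
    rw [stepDeriv, this.deriv_eq, deriv_const]
  · have : step =ᶠ[𝓝 t] fun _ => 1 :=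
      mem_of_superset (Ioi_mem_nhds ht) fun s hs => step_of_ge (le_of_lt hs)
    rw [stepDeriv, this.deriv_eq, deriv_const]

theorem stepDerivTwo_eq_zero {t : ℝ} (ht : t ≤ 1 ∨ 2 ≤ t) : stepDerivTwo t = 0 := by
  refine eq_zero_of_eqOn_compl_Icc continuous_stepDerivTwo (fun t ht => ?_) ht
  rcases ht with ht | ht
  · have : stepDeriv =ᶠ[𝓝 t] fun _ => 0 :=
      mem_of_superset (Iio_mem_nhds ht) fun s hs => stepDeriv_eq_zero (Or.inl (le_of_lt hs))
    rw [stepDerivTwo, this.deriv_eq, deriv_const]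
  · have : stepDeriv =ᶠ[𝓝 t] fun _ => 0 :=
      mem_of_superset (Ioi_mem_nhds ht) fun s hs => stepDeriv_eq_zero (Or.inr (le_of_lt hs))
    rw [stepDerivTwo, this.deriv_eq, deriv_const]

theorem exists_step_bound : ∃ M : ℝ, 0 ≤ M ∧ ∀ t, |stepDeriv t| ≤ M ∧ |stepDerivTwo t| ≤ M := by
  have hb : ∀ f : ℝ → ℝ, Continuous f → (∀ t, t ≤ 1 ∨ 2 ≤ t → f t = 0) →
      ∃ M : ℝ, 0 ≤ M ∧ ∀ t, |f t| ≤ M := by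
    intro f hf h
    obtain ⟨C, hC⟩ := isCompact_Icc.exists_bound_of_continuousOn (s := Set.Icc (1 : ℝ) 2)
      hf.continuousOn
    refine ⟨max C 0, le_max_right _ _, fun t => ?_⟩
    by_cases ht : t ∈ Set.Icc (1 : ℝ) 2
    · exact (hC t ht).trans (le_max_left _ _)
    · rw [h t (by
        by_contra hh
        push Not at hh
        exact ht ⟨hh.1.le, hh.2.le⟩)]
      simp
  obtain ⟨M1, h1, h1'⟩ := hb _ continuous_stepDeriv fun t => stepDeriv_eq_zero
  obtain ⟨M2, h2, h2'⟩ := hb _ continuous_stepDerivTwo fun t => stepDerivTwo_eq_zero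
  exact ⟨max M1 M2, h1.trans (le_max_left _ _), fun t =>
    ⟨(h1' t).trans (le_max_left _ _), (h2' t).trans (le_max_right _ _)⟩⟩

/-- `∫ (2 a' + t a'') = 1` for the step `a`. -/
theorem integral_step : ∫ t in Set.Icc (1 : ℝ) 2, (2 * stepDeriv t + t * stepDerivTwo t) = 1 := by
  have hd : ∀ t : ℝ, HasDerivAt (fun t => step t + t * stepDeriv t) (2 * stepDeriv t + t * stepDerivTwo t) t := by
    intro t
    refine ((hasDerivAt_step t).add ((hasDerivAt_id t).mul (hasDerivAt_stepDeriv t))).congr_deriv ?_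
    simp only [id]
    ring
  rw [integral_Icc_eq_integral_Ioc, ← intervalIntegral.integral_of_le (by norm_num),
    intervalIntegral.integral_eq_sub_of_hasDerivAt (fun t _ => hd t)
      (((continuous_const.mul continuous_stepDeriv).add
        (continuous_id.mul continuous_stepDerivTwo)).intervalIntegrable 1 2)]
  rw [step_of_ge le_rfl, step_of_le le_rfl, stepDeriv_eq_zero (Or.inr le_rfl),
    stepDeriv_eq_zero (Or.inl le_rfl)]
  norm_num

/-- The radial cut-off function `a ((|y| - 1) / δ)`. -/
noncomputable def cut (δ : ℝ) (y : E3) : ℝ := step ((‖y‖ - 1) / δ)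

theorem cut_of_le {δ : ℝ} (hδ : 0 < δ) {y : E3} (h : ‖y‖ ≤ 1 + δ) : cut δ y = 0 :=
  step_of_le (by rw [div_le_one hδ]; linarith)

theorem cut_of_ge {δ : ℝ} (hδ : 0 < δ) {y : E3} (h : 1 + 2 * δ ≤ ‖y‖) : cut δ y = 1 :=
  step_of_ge (by rw [le_div_iff₀ hδ]; linarith)

theorem contDiff_cut {δ : ℝ} (hδ : 0 < δ) : ContDiff ℝ 2 (cut δ) := by
  rw [contDiff_iff_contDiffAt]
  intro y
  by_cases hy : ‖y‖ < 1 + δ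
  · have : cut δ =ᶠ[𝓝 y] fun _ => 0 :=
      mem_of_superset ((isOpen_lt continuous_norm continuous_const).mem_nhds hy) fun z hz =>
        cut_of_le hδ (le_of_lt hz)
    exact contDiffAt_const.congr_of_eventuallyEq this
  · have hy0 : y ≠ 0 := by
      rintro rfl
      exact hy (by simpa using by linarith)
    exact (contDiff_step (n := 2)).contDiffAt.comp y
      (((contDiffAt_norm ℝ hy0).sub contDiffAt_const).div_const δ)

theorem HasPd.comp {l : Fin 3} {f : E3 → ℝ} {v : ℝ} {x : E3} (hf : HasPd l f v x) {g : ℝ → ℝ}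
    {g' : ℝ} (hg : HasDerivAt g g' (f x)) : HasPd l (fun y => g (f y)) (g' * v) x := by
  have h := hg.comp_hasFDerivAt x hf.1.hasFDerivAt
  refine ⟨h.differentiableAt, (HasFDerivAt.pd_eq h l).trans ?_⟩
  rw [← hf.2]
  rfl

theorem hasPd_norm {y : E3} (hy : y ≠ 0) (l : Fin 3) : HasPd l (fun y => ‖y‖) (y l / ‖y‖) y := by
  have h := hasPd_rho (ε := 0) (y := y) (by positivity) l
  simpa only [funext rho_zero, rho_zero] using h

theorem hasPd_radius (δ : ℝ) {y : E3} (hy : y ≠ 0) (l : Fin 3) :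
    HasPd l (fun y => (‖y‖ - 1) / δ) (y l / ‖y‖ / δ) y := by
  have h := ((hasPd_norm hy l).sub (HasPd.const (l := l) (x := y) 1)).const_mul δ⁻¹
  convert h using 1
  · funext y; ring
  · ring

theorem pd_cut (δ : ℝ) {y : E3} (hy : y ≠ 0) (l : Fin 3) :
    pd l (cut δ) y = stepDeriv ((‖y‖ - 1) / δ) * (y l / ‖y‖ / δ) :=
  ((hasPd_radius δ hy l).comp (hasDerivAt_step _)).2

theorem pd_pd_cut (δ : ℝ) {y : E3} (hy : y ≠ 0) (a b : Fin 3) :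
    pd a (pd b (cut δ)) y
      = stepDerivTwo ((‖y‖ - 1) / δ) * (y a / ‖y‖ / δ) * (y b / ‖y‖ / δ)
        + stepDeriv ((‖y‖ - 1) / δ)
          * ((kron a b - (y a / ‖y‖) * (y b / ‖y‖)) / ‖y‖ / δ) := by
  have hU : IsOpen {y : E3 | y ≠ 0} := isOpen_ne
  rw [pd_congr_of_isOpen hU (fun z hz => pd_cut δ hz b) hy a]
  have hn : 0 < ‖y‖ := norm_pos_iff.2 hy
  have hinv : HasPd a (fun y : E3 => ‖y‖⁻¹) (-(‖y‖ ^ 2)⁻¹ * (y a / ‖y‖)) y :=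
    (hasPd_norm hy a).comp (hasDerivAt_inv hn.ne')
  have h := ((hasPd_radius δ hy a).comp (hasDerivAt_stepDeriv _)).mul
    (((hasPd_coord a b y).mul hinv).const_mul δ⁻¹)
  have e : (fun y : E3 => stepDeriv ((‖y‖ - 1) / δ) * (y b / ‖y‖ / δ))
      = fun y => stepDeriv ((‖y‖ - 1) / δ) * (δ⁻¹ * (y b * ‖y‖⁻¹)) := by
    funext y; ring
  rw [e, h.2]
  field_simp
  ring

theorem pd_eq_zero_of_eventually_const {f : E3 → ℝ} {c : ℝ} {y : E3}
    (h : f =ᶠ[𝓝 y] fun _ => c) (l : Fin 3) : pd l f y = 0 := by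
  rw [pd_congr h, pd_const]

/-- The shell that contains the supports of the derivatives of `cut δ`. -/
def shell (δ : ℝ) : Set E3 := {y | 1 + δ ≤ ‖y‖ ∧ ‖y‖ ≤ 1 + 2 * δ}

theorem isCompact_shell (δ : ℝ) : IsCompact (shell δ) := by
  refine (isCompact_closedBall (0 : E3) (1 + 2 * δ)).of_isClosed_subset ?_ ?_
  · exact (isClosed_le continuous_const continuous_norm).inter
      (isClosed_le continuous_norm continuous_const)
  · intro y hy
    simpa using hy.2

theorem tsupport_pd_cut_subset {δ : ℝ} (hδ : 0 < δ) (l : Fin 3) :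
    tsupport (pd l (cut δ)) ⊆ shell δ := by
  refine closure_minimal (fun y hy => ?_) (isCompact_shell δ).isClosed
  by_contra h
  refine hy ?_
  rw [shell, Set.mem_ofPred_eq, not_and_or, not_le, not_le] at h
  rcases h with h | h
  · exact pd_eq_zero_of_eventually_const (c := 0)
      (mem_of_superset ((isOpen_lt continuous_norm continuous_const).mem_nhds h) fun z hz =>
        cut_of_le hδ (le_of_lt hz)) l
  · exact pd_eq_zero_of_eventually_const (c := 1)
      (mem_of_superset ((isOpen_lt continuous_const continuous_norm).mem_nhds h) fun z hz =>
        cut_of_ge hδ (le_of_lt hz)) l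

/-! ### The commutator of a second derivative with a cut-off -/

/-- The commutator `∂_a ∂_b (χ g) - χ ∂_a ∂_b g`. -/
noncomputable def cutComm (χ g : E3 → ℝ) (a b : Fin 3) (y : E3) : ℝ :=
  pd a χ y * pd b g y + pd b χ y * pd a g y + pd a (pd b χ) y * g y

theorem pd_pd_mul {χ g : E3 → ℝ} {U : Set E3} (hU : IsOpen U) (hχ : ContDiffOn ℝ 2 χ U)
    (hg : ContDiffOn ℝ 2 g U) {y : E3} (hy : y ∈ U) (a b : Fin 3) :
    pd a (pd b fun z => χ z * g z) y = χ y * pd a (pd b g) y + cutComm χ g a b y := by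
  have hd : ∀ {f : E3 → ℝ}, ContDiffOn ℝ 2 f U → ∀ z ∈ U, DifferentiableAt ℝ f z :=
    fun hf z hz => (hf.contDiffAt (hU.mem_nhds hz)).differentiableAt (by norm_num)
  have hd' : ∀ {f : E3 → ℝ}, ContDiffOn ℝ 2 f U → DifferentiableAt ℝ (pd b f) y :=
    fun hf => ((contDiffOn_pd (m := 1) hU hf (by norm_num) b).contDiffAt
      (hU.mem_nhds hy)).differentiableAt (by norm_num)
  rw [pd_congr_of_isOpen hU (fun z hz => pd_mul (hd hχ z hz) (hd hg z hz) b) hy a,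
    pd_add (f := fun z => pd b χ z * g z) (g := fun z => χ z * pd b g z)
      ((hd' hχ).mul (hd hg y hy)) ((hd hχ y hy).mul (hd' hg)),
    pd_mul (hd' hχ) (hd hg y hy), pd_mul (hd hχ y hy) (hd' hg), cutComm]
  ring

/-! ### The cut-off at infinity -/

theorem abs_coord_div_norm_le (y : E3) (i : Fin 3) : |y i / ‖y‖| ≤ 1 := by
  simpa only [rho_zero] using abs_coord_div_rho_le 0 y i

theorem abs_pd_cut_le {M : ℝ} (hM : 0 ≤ M) (h1 : ∀ t, |stepDeriv t| ≤ M) {δ : ℝ} (hδ : 0 < δ) {y : E3}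
    (hy : y ≠ 0) (l : Fin 3) : |pd l (cut δ) y| ≤ M / δ := by
  rw [pd_cut δ hy, abs_mul, abs_div, abs_of_pos hδ]
  calc |stepDeriv ((‖y‖ - 1) / δ)| * (|y l / ‖y‖| / δ) ≤ M * (1 / δ) := by
        gcongr
        exacts [h1 _, abs_coord_div_norm_le y l]
    _ = M / δ := by ring

theorem abs_pd_pd_cut_le {M : ℝ} (h1 : ∀ t, |stepDeriv t| ≤ M) (h2 : ∀ t, |stepDerivTwo t| ≤ M)
    {δ : ℝ} (hδ : 0 < δ) {y : E3} (hy : δ ≤ ‖y‖) (a b : Fin 3) :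
    |pd a (pd b (cut δ)) y| ≤ 3 * M / δ ^ 2 := by
  have hn : 0 < ‖y‖ := hδ.trans_le hy
  have hw := abs_coord_div_norm_le y
  have hd : |δ⁻¹| ≤ δ⁻¹ := (abs_of_pos (inv_pos.2 hδ)).le
  have hn' : |‖y‖⁻¹| ≤ δ⁻¹ := by
    rw [abs_of_pos (inv_pos.2 hn)]
    exact inv_anti₀ hδ hy
  have hk : |kron a b - y a / ‖y‖ * (y b / ‖y‖)| ≤ 1 + 1 * 1 := by
    rw [sub_eq_add_neg]
    refine abs_add_le_of_le (abs_kron_le a b) ?_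
    rw [abs_neg]
    exact abs_mul_le_of_le (hw a) (hw b)
  have key := abs_add_le_of_le
    (abs_mul_le_of_le (abs_mul_le_of_le (h2 ((‖y‖ - 1) / δ)) (abs_mul_le_of_le (hw a) hd))
      (abs_mul_le_of_le (hw b) hd))
    (abs_mul_le_of_le (h1 ((‖y‖ - 1) / δ)) (abs_mul_le_of_le (abs_mul_le_of_le hk hn') hd))
  rw [pd_pd_cut δ (norm_pos_iff.1 hn)]
  refine key.trans_eq ?_
  field_simp
  ring

theorem cutComm_cut_eq_zero {δ : ℝ} (hδ : 0 < δ) (g : E3 → ℝ) {y : E3} (hy : y ∉ shell δ)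
    (a b : Fin 3) : cutComm (cut δ) g a b y = 0 := by
  have h : ∀ l, y ∉ tsupport (pd l (cut δ)) := fun l hl => hy (tsupport_pd_cut_subset hδ l hl)
  rw [cutComm, image_eq_zero_of_notMem_tsupport (h a), image_eq_zero_of_notMem_tsupport (h b),
    pd_eq_zero_of_notMem_tsupport (h b)]
  simp

theorem volume_real_shell_le {R : ℝ} (hR : 1 ≤ R) :
    (volume : Measure E3).real (shell R) ≤ 36 * Real.pi * R ^ 3 := by
  have hsub : shell R ⊆ Metric.closedBall (0 : E3) (1 + 2 * R) := fun y hy => by simpa using hy.2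
  have hfin : (volume : Measure E3) (Metric.closedBall 0 (1 + 2 * R)) ≠ ⊤ :=
    measure_closedBall_lt_top.ne
  refine (measureReal_mono hsub hfin).trans ?_
  rw [Measure.real, EuclideanSpace.volume_closedBall_fin_three, ENNReal.toReal_mul,
    ENNReal.toReal_pow, ENNReal.toReal_ofReal (by linarith),
    ENNReal.toReal_ofReal (by positivity)]
  have h3 : (1 + 2 * R) ^ 3 ≤ (3 * R) ^ 3 := by gcongr; linarith
  calc (1 + 2 * R) ^ 3 * (Real.pi * 4 / 3) ≤ (3 * R) ^ 3 * (Real.pi * 4 / 3) := by gcongr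
    _ = 36 * Real.pi * R ^ 3 := by ring

/-- On the shell each derivative of the cut-off gains `R⁻¹`, so the decay of `g` and of its gradient
makes the commutator `O(R⁻³)`. The shell has volume `O(R³)`, and the smallness comes from `q → 0`
alone. -/
theorem tendsto_integral_cutComm_atTop {q g : E3 → ℝ}
    (hq : Tendsto q (Bornology.cobounded E3) (𝓝 0))
    (hg : g =O[Bornology.cobounded E3] fun y => ‖y‖⁻¹)
    (hg' : ∀ l, pd l g =O[Bornology.cobounded E3] fun y => (‖y‖ ^ 2)⁻¹) (a b : Fin 3) :
    Tendsto (fun R => ∫ y, q y * cutComm (cut R) g a b y) atTop (𝓝 0) := by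
  obtain ⟨M, hM, hst⟩ := exists_step_bound
  obtain ⟨C0, hC0, h0⟩ := hg.exists_pos
  obtain ⟨Ca, hCa, ha⟩ := (hg' a).exists_pos
  obtain ⟨Cb, hCb, hb⟩ := (hg' b).exists_pos
  rw [Metric.tendsto_nhds]
  intro η hη
  set K := M * Cb + M * Ca + 3 * M * C0 with hK
  have hK0 : 0 ≤ K := by positivity
  -- The extra `1` keeps the quotient defined and the final inequality strict even when `K = 0`.
  set θ := η / (36 * Real.pi * K + 1) with hθ
  have hpi := Real.pi_pos
  have hθ0 : 0 < θ := by positivity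
  have hev := (((Metric.tendsto_nhds.1 hq θ hθ0).and h0.bound).and (ha.bound.and hb.bound))
  rw [← comap_norm_atTop, eventually_comap] at hev
  obtain ⟨R0, hR0⟩ := eventually_atTop.1 hev
  filter_upwards [eventually_ge_atTop (max R0 1)] with R hR
  have hR1 : 1 ≤ R := (le_max_right _ _).trans hR
  have hRpos : 0 < R := by linarith
  have hpt : ∀ y ∈ shell R, ‖q y * cutComm (cut R) g a b y‖ ≤ θ * (K / R ^ 3) := by
    intro y hy
    have hyR : R ≤ ‖y‖ := by linarith [hy.1]
    have hy0 : y ≠ 0 := norm_pos_iff.1 (hRpos.trans_le hyR)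
    obtain ⟨⟨e1, e2⟩, e3, e4⟩ := hR0 ‖y‖ ((le_max_left _ _).trans (hR.trans hyR)) y rfl
    rw [dist_zero_right] at e1
    have i1 : ‖y‖⁻¹ ≤ R⁻¹ := inv_anti₀ hRpos hyR
    have i2 : (‖y‖ ^ 2)⁻¹ ≤ (R ^ 2)⁻¹ := inv_anti₀ (by positivity) (by gcongr)
    rw [norm_inv, norm_norm] at e2
    rw [norm_inv, norm_pow, norm_norm] at e3 e4
    have f2 : |g y| ≤ C0 * R⁻¹ := e2.trans (by gcongr)
    have f3 : |pd a g y| ≤ Ca * (R ^ 2)⁻¹ := e3.trans (by gcongr)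
    have f4 : |pd b g y| ≤ Cb * (R ^ 2)⁻¹ := e4.trans (by gcongr)
    have hc := fun l => abs_pd_cut_le hM (fun t => (hst t).1) hRpos hy0 l
    have hcc := abs_pd_pd_cut_le (fun t => (hst t).1) (fun t => (hst t).2) hRpos hyR a b
    have key := abs_mul_le_of_le e1.le (abs_add_le_of_le (abs_add_le_of_le
      (abs_mul_le_of_le (hc a) f4) (abs_mul_le_of_le (hc b) f3)) (abs_mul_le_of_le hcc f2))
    refine key.trans_eq ?_
    rw [hK]
    field_simp
  have hset : ∫ y, q y * cutComm (cut R) g a b y = ∫ y in shell R, q y * cutComm (cut R) g a b y := by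
    refine (setIntegral_eq_integral_of_forall_compl_eq_zero fun y hy => ?_).symm
    rw [cutComm_cut_eq_zero hRpos g hy, mul_zero]
  rw [dist_zero_right, hset]
  calc ‖∫ y in shell R, q y * cutComm (cut R) g a b y‖
      ≤ θ * (K / R ^ 3) * (volume : Measure E3).real (shell R) :=
        norm_setIntegral_le_of_norm_le_const (isCompact_shell R).measure_lt_top hpt
    _ ≤ θ * (K / R ^ 3) * (36 * Real.pi * R ^ 3) := by
        gcongr
        exact volume_real_shell_le hR1
    _ = η * ((36 * Real.pi * K) / (36 * Real.pi * K + 1)) := by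
        rw [hθ]; field_simp
    _ < η * 1 := by
        gcongr
        rw [div_lt_one (by positivity)]
        linarith
    _ = η := mul_one η

/-! ### Integrals over thin shells -/

instance : IsFiniteMeasure surf := inferInstanceAs (IsFiniteMeasure (volume : Measure E3).toSphere)

theorem integral_polar {f : E3 → ℝ} (hf : Integrable f) :
    ∫ y, f y = ∫ w : Metric.sphere (0 : E3) 1,
      (∫ r in Set.Ioi (0 : ℝ), r ^ 2 * f (r • (w : E3))) ∂surf := by
  have hmp := (volume : Measure E3).measurePreserving_homeomorphUnitSphereProd
  have hme := (homeomorphUnitSphereProd E3).measurableEmbedding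
  set F : Metric.sphere (0 : E3) 1 × Set.Ioi (0 : ℝ) → ℝ := fun p => f (p.2.1 • (p.1 : E3)) with hF
  have hcomp : ∀ x : ({0}ᶜ : Set E3), F (homeomorphUnitSphereProd E3 x) = f x := by
    intro x
    have hx : ‖(x : E3)‖ ≠ 0 := norm_ne_zero_iff.2 x.2
    simp [hF, smul_smul, mul_inv_cancel₀ hx]
  have h1 : ∫ y, f y = ∫ p, F p ∂(surf.prod (Measure.volumeIoiPow (Module.finrank ℝ E3 - 1))) := by
    rw [surf, ← hmp.integral_comp hme F]
    simp_rw [hcomp]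
    rw [integral_subtype_comap (measurableSet_singleton _).compl f,
      restrict_compl_singleton]
  have hint : Integrable F (surf.prod (Measure.volumeIoiPow (Module.finrank ℝ E3 - 1))) := by
    rw [surf, ← hmp.integrable_comp_emb hme]
    have : (F ∘ homeomorphUnitSphereProd E3) = fun x : ({0}ᶜ : Set E3) => f x := funext hcomp
    rw [this]
    have h2 := (integrableOn_iff_comap_subtypeVal (μ := (volume : Measure E3)) (f := f)
      (measurableSet_singleton (0 : E3)).compl).1 hf.integrableOn
    exact h2
  rw [h1, integral_prod _ hint]
  refine integral_congr_ae (Eventually.of_forall fun w => ?_)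
  simp only [Measure.volumeIoiPow, ENNReal.ofReal, hF]
  rw [integral_withDensity_eq_integral_smul]
  · rw [integral_subtype_comap measurableSet_Ioi
      fun a : ℝ => Real.toNNReal (a ^ (Module.finrank ℝ E3 - 1)) • f (a • (w : E3))]
    refine setIntegral_congr_fun measurableSet_Ioi fun x hx => ?_
    simp only [NNReal.smul_def, finrank_euclideanSpace, Fintype.card_fin]
    rw [Real.coe_toNNReal _ (pow_nonneg (le_of_lt hx) _)]
    simp
  · exact (measurable_subtype_coe.pow_const _).real_toNNReal

theorem norm_coe_sphere (w : Metric.sphere (0 : E3) 1) : ‖(w : E3)‖ = 1 := by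
  simp

/-- Polar coordinates and `r = 1 + δ t` move the thin shell to the fixed domain sphere × `[1, 2]`,
on which limits in `δ` can be taken. The factor `δ` is the Jacobian of this substitution. -/
theorem integral_eq_of_support_shell {f : E3 → ℝ} (hf : Integrable f) {δ : ℝ} (hδ : 0 < δ)
    (h0 : ∀ y, y ∉ shell δ → f y = 0) :
    ∫ y, f y = ∫ w : Metric.sphere (0 : E3) 1,
      (∫ t in Set.Icc (1 : ℝ) 2, δ * ((1 + δ * t) ^ 2 * f ((1 + δ * t) • (w : E3)))) ∂surf := by
  rw [integral_polar hf]
  refine integral_congr_ae (Eventually.of_forall fun w => ?_)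
  simp only []
  rw [integral_Icc_eq_integral_Ioc, ← intervalIntegral.integral_of_le (by norm_num),
    intervalIntegral.integral_const_mul]
  have h1 := intervalIntegral.integral_comp_mul_add (a := 1) (b := 2)
    (fun r : ℝ => r ^ 2 * f (r • (w : E3))) hδ.ne' 1
  simp only [add_comm _ (1 : ℝ)] at h1
  rw [h1, smul_eq_mul, mul_inv_cancel_left₀ hδ.ne',
    intervalIntegral.integral_of_le (by linarith), ← integral_Icc_eq_integral_Ioc]
  refine (setIntegral_eq_of_subset_of_forall_sdiff_eq_zero measurableSet_Ioi (fun r hr => ?_)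
    fun r hr => ?_)
  · have := hr.1
    simp only [Set.mem_Ioi]
    linarith
  · have hr0 : 0 < r := hr.1
    have hn : ‖r • (w : E3)‖ = r := by
      rw [norm_smul, norm_coe_sphere, Real.norm_of_nonneg hr0.le, mul_one]
    rw [h0, mul_zero]
    rintro ⟨h2, h3⟩
    rw [hn] at h2 h3
    exact hr.2 ⟨by linarith, by linarith⟩

theorem mul_cutComm_eq (q χ g : E3 → ℝ) (a b : Fin 3) :
    (fun y => q y * cutComm χ g a b y) = fun y => pd a χ y * (q y * pd b g y)
      + pd b χ y * (q y * pd a g y) + pd a (pd b χ) y * (q y * g y) := by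
  funext y
  rw [cutComm]
  ring

section commutator

variable {q χ g : E3 → ℝ} {U : Set E3} (hU : IsOpen U) (hχ : ContDiff ℝ 2 χ)
  (hs : ∀ l, tsupport (pd l χ) ⊆ U) (hq : ContinuousOn q U) (hg : ContinuousOn g U)
  (hg' : ∀ l, ContinuousOn (pd l g) U)

include hU hχ hs hq hg hg'

theorem continuous_mul_cutComm (a b : Fin 3) : Continuous fun y => q y * cutComm χ g a b y := by
  have h1 : ∀ l, ContDiff ℝ 1 (pd l χ) := fun l => contDiff_pd hχ (by norm_num) l
  rw [mul_cutComm_eq]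
  exact ((continuous_mul_of_tsupport_subset hU (h1 a).continuous (hq.mul (hg' b)) (hs a)).add
    (continuous_mul_of_tsupport_subset hU (h1 b).continuous (hq.mul (hg' a)) (hs b))).add
    (continuous_mul_of_tsupport_subset hU (contDiff_pd (m := 0) (h1 b) (by simp) a).continuous
      (hq.mul hg) ((tsupport_pd_subset _ a).trans (hs b)))

theorem integrable_mul_cutComm (hc : ∀ l, HasCompactSupport (pd l χ)) (a b : Fin 3) :
    Integrable fun y => q y * cutComm χ g a b y := by
  refine (continuous_mul_cutComm hU hχ hs hq hg hg' a b).integrable_of_hasCompactSupport ?_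
  rw [mul_cutComm_eq]
  exact ((hc a).mul_right.add (hc b).mul_right).add (hasCompactSupport_pd (hc b) a).mul_right

end commutator

/-! ### The cut-off at the boundary -/

/-- The closed collar of width `η` of the unit sphere in its exterior. -/
def collar (η : ℝ) : Set E3 := {y | 1 ≤ ‖y‖ ∧ ‖y‖ ≤ 1 + η}

theorem isCompact_collar (η : ℝ) : IsCompact (collar η) := by
  refine (isCompact_closedBall (0 : E3) (1 + η)).of_isClosed_subset ?_ ?_
  · exact (isClosed_le continuous_const continuous_norm).inter
      (isClosed_le continuous_norm continuous_const)
  · intro y hy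
    simpa using hy.2

theorem norm_ray {w : E3} (hw : ‖w‖ = 1) {τ : ℝ} (hτ : 0 ≤ τ) : ‖(1 + τ) • w‖ = 1 + τ := by
  rw [norm_smul, hw, mul_one, Real.norm_of_nonneg (by linarith)]

theorem hasDerivWithinAt_ray {g : E3 → ℝ} {g' : E3 →L[ℝ] ℝ} {w : E3} (hw : ‖w‖ = 1) {τ t : ℝ}
    (ht : 0 ≤ t) (h : HasFDerivWithinAt g g' OmegaBar ((1 + τ * t) • w)) :
    HasDerivWithinAt (fun τ => g ((1 + τ * t) • w)) (t * g' w) (Set.Ici 0) τ := by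
  have h1 : HasDerivWithinAt (fun τ : ℝ => (1 + τ * t) • w) (t • w) (Set.Ici 0) τ := by
    have h2 := (((hasDerivAt_id τ).mul_const t).const_add 1).smul_const w
    simpa using h2.hasDerivWithinAt
  have h3 := h.comp_hasDerivWithinAt τ h1 (fun σ hσ => by
    rw [OmegaBar, Set.mem_ofPred_eq, norm_ray hw (mul_nonneg hσ ht)]
    linarith [mul_nonneg (show (0 : ℝ) ≤ σ from hσ) ht])
  rw [map_smul, smul_eq_mul] at h3
  exact h3

section boundary

variable {g : E3 → ℝ} {g' : E3 → E3 →L[ℝ] ℝ} {η : ℝ} (hη : 0 < η)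
  (hg : ∀ y ∈ collar η, HasFDerivWithinAt g (g' y) OmegaBar y)
  (hg0 : ∀ y, ‖y‖ = 1 → g y = 0)

include hη hg hg0

/-- Along any great circle through `w` the function `g` is zero, and great circles stay inside
`OmegaBar`, so the chain rule shows that the derivative kills tangent vectors. Only the normal part
of the basis vector contributes. -/
theorem fderivWithin_tangential {w : E3} (hw : ‖w‖ = 1) (b : Fin 3) :
    g' w (EuclideanSpace.single b 1) = w b * g' w w := by
  have hwc : w ∈ collar η := ⟨hw.ge, by rw [hw]; linarith⟩
  have hunit : ∀ v : E3, ‖v‖ = 1 → inner ℝ w v = 0 → g' w v = 0 := by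
    intro v hv hwv
    have hc : HasDerivAt (fun θ : ℝ => Real.cos θ • w + Real.sin θ • v) v 0 := by
      have := ((Real.hasDerivAt_cos 0).smul_const w).add ((Real.hasDerivAt_sin 0).smul_const v)
      exact this.congr_deriv (by simp)
    have hn : ∀ θ : ℝ, ‖Real.cos θ • w + Real.sin θ • v‖ = 1 := by
      intro θ
      have h2 : ‖Real.cos θ • w + Real.sin θ • v‖ ^ 2 = 1 := by
        rw [norm_add_sq_real, norm_smul, norm_smul, inner_smul_left, inner_smul_right, hwv, hw, hv]
        simp
      nlinarith [norm_nonneg (Real.cos θ • w + Real.sin θ • v)]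
    have h1 := (hg w hwc).comp_hasDerivWithinAt_of_eq (0 : ℝ) (hc.hasDerivWithinAt (s := Set.univ))
      (fun θ _ => (hn θ).ge) (by simp)
    have h2 : (g ∘ fun θ : ℝ => Real.cos θ • w + Real.sin θ • v) = fun _ => 0 := by
      funext θ
      exact hg0 _ (hn θ)
    rw [h2, hasDerivWithinAt_univ] at h1
    exact h1.unique (hasDerivAt_const 0 0)
  have hperp : ∀ v : E3, inner ℝ w v = 0 → g' w v = 0 := by
    intro v hwv
    by_cases hv : v = 0
    · simp [hv]
    · have hv' : ‖v‖ ≠ 0 := norm_ne_zero_iff.2 hv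
      have := hunit (‖v‖⁻¹ • v) (by rw [norm_smul, norm_inv, norm_norm, inv_mul_cancel₀ hv'])
        (by rw [inner_smul_right, hwv, mul_zero])
      rw [map_smul, smul_eq_mul] at this
      exact (mul_eq_zero.1 this).resolve_left (inv_ne_zero hv')
  have h := hperp (EuclideanSpace.single b 1 - w b • w) (by
    rw [inner_sub_right, inner_smul_right, real_inner_self_eq_norm_sq, hw,
      EuclideanSpace.inner_single_right]
    simp)
  rw [map_sub, map_smul, smul_eq_mul] at h
  linarith

omit hη in
theorem abs_ray_le {L : ℝ} (hL : ∀ y ∈ collar η, ‖g' y‖ ≤ L) {w : E3} (hw : ‖w‖ = 1) {τ : ℝ}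
    (hτ : 0 ≤ τ) (hτη : τ ≤ η) : |g ((1 + τ) • w)| ≤ L * τ := by
  have hmem : ∀ σ ∈ Set.Icc (0 : ℝ) η, (1 + σ * 1) • w ∈ collar η := by
    intro σ hσ
    rw [mul_one, collar, Set.mem_ofPred_eq, norm_ray hw hσ.1]
    exact ⟨by linarith [hσ.1], by linarith [hσ.2]⟩
  have h := norm_image_sub_le_of_norm_deriv_le_segment' (a := 0) (b := η) (C := L)
    (f := fun σ => g ((1 + σ * 1) • w)) (f' := fun σ => 1 * g' ((1 + σ * 1) • w) w)
    (fun σ hσ => (hasDerivWithinAt_ray hw zero_le_one (hg _ (hmem σ hσ))).mono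
      Set.Icc_subset_Ici_self)
    (fun σ hσ => by
      rw [one_mul]
      refine ((g' _).le_opNorm w).trans ?_
      rw [hw, mul_one]
      exact hL _ (hmem σ ⟨hσ.1, hσ.2.le⟩)) τ ⟨hτ, hτη⟩
  simpa [hg0 w hw] using h

theorem tendsto_ray_div {w : E3} (hw : ‖w‖ = 1) {t : ℝ} (ht : 0 ≤ t) :
    Tendsto (fun δ : ℝ => δ⁻¹ * g ((1 + δ * t) • w)) (𝓝[>] 0) (𝓝 (t * g' w w)) := by
  have hwc : w ∈ collar η := ⟨hw.ge, by rw [hw]; linarith⟩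
  have h := hasDerivWithinAt_ray (g := g) (g' := g' w) (τ := 0) hw ht (by simpa using hg w hwc)
  rw [hasDerivWithinAt_iff_tendsto_slope] at h
  have e : Set.Ici (0 : ℝ) \ {0} = Set.Ioi 0 := Set.Ici_sdiff_left
  rw [e] at h
  refine h.congr fun δ => ?_
  simp [slope, hg0 w hw]

omit hη hg0 in
theorem pd_eq_of_mem_collar {y : E3} (h1 : 1 < ‖y‖) (h2 : ‖y‖ ≤ 1 + η) (l : Fin 3) :
    HasPd l g (g' y (EuclideanSpace.single l 1)) y := by
  have hO : OmegaBar ∈ 𝓝 y :=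
    mem_of_superset ((isOpen_lt continuous_const continuous_norm).mem_nhds h1)
      fun z hz => show (1 : ℝ) ≤ ‖z‖ from le_of_lt hz
  have h := (hg y ⟨h1.le, h2⟩).hasFDerivAt hO
  exact ⟨h.differentiableAt, HasFDerivAt.pd_eq h l⟩

end boundary

/-- The powers of `δ` are arranged so that every factor has a limit: the Jacobian absorbs one `δ⁻¹`,
and the second one, present only with second derivatives of the cut-off, is attached to `g`, which
is `O(δ)` when it vanishes on the sphere. -/
theorem cutComm_cut_ray {δ t : ℝ} (hδ : 0 < δ) (ht : 0 ≤ t) {w : E3} (hw : ‖w‖ = 1) (q g : E3 → ℝ)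
    (a b : Fin 3) :
    δ * ((1 + δ * t) ^ 2 * (q ((1 + δ * t) • w) * cutComm (cut δ) g a b ((1 + δ * t) • w)))
      = (1 + δ * t) ^ 2 * (q ((1 + δ * t) • w) *
        (stepDeriv t * (w a * pd b g ((1 + δ * t) • w) + w b * pd a g ((1 + δ * t) • w))
          + (stepDerivTwo t * (w a * w b) + δ * stepDeriv t * ((kron a b - w a * w b) / (1 + δ * t)))
            * (δ⁻¹ * g ((1 + δ * t) • w)))) := by
  have hδt : 0 ≤ δ * t := mul_nonneg hδ.le ht
  have hn := norm_ray hw hδt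
  have hp : 0 < 1 + δ * t := by linarith
  have hy : (1 + δ * t) • w ≠ 0 := by
    rw [← norm_pos_iff, hn]
    exact hp
  have hc : ∀ i, ((1 + δ * t) • w) i / ‖(1 + δ * t) • w‖ = w i := by
    intro i
    rw [hn, PiLp.smul_apply, smul_eq_mul]
    field_simp
  have hr : (‖(1 + δ * t) • w‖ - 1) / δ = t := by
    rw [hn]
    field_simp
    ring
  rw [cutComm, pd_cut δ hy, pd_cut δ hy, pd_pd_cut δ hy, hc, hc, hr, hn]
  field_simp

theorem ae_mem_Icc_prod : ∀ᵐ p ∂(surf.prod (volume.restrict (Set.Icc (1 : ℝ) 2))),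
    p.2 ∈ Set.Icc (1 : ℝ) 2 :=
  Measure.quasiMeasurePreserving_snd.ae (ae_restrict_mem measurableSet_Icc)

section boundary

variable {q g : E3 → ℝ} {g' : E3 → E3 →L[ℝ] ℝ} {η : ℝ} (hη : 0 < η)
  (hq : ContinuousOn q (collar η))
  (hg : ∀ y ∈ collar η, HasFDerivWithinAt g (g' y) OmegaBar y)
  (hg' : ContinuousOn g' (collar η))
  (hg0 : ∀ y, ‖y‖ = 1 → g y = 0)

include hη hq hg hg' hg0

/-- The two first order terms have equal limits because the gradient of `g` is normal on the sphere,
which gives `2 a'`. The second order term gives `t a''` through `δ⁻¹ g → t ∂_r g`. The curvature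
term carries an extra `δ` and disappears. -/
theorem tendsto_cutComm_ray {w : E3} (hw : ‖w‖ = 1) {t : ℝ} (ht : 0 < t) (a b : Fin 3) :
    Tendsto (fun δ : ℝ => δ * ((1 + δ * t) ^ 2 *
        (q ((1 + δ * t) • w) * cutComm (cut δ) g a b ((1 + δ * t) • w)))) (𝓝[>] 0)
      (𝓝 ((q w * (w a * g' w (EuclideanSpace.single b 1))) * (2 * stepDeriv t + t * stepDerivTwo t))) := by
  have hwc : w ∈ collar η := ⟨hw.ge, by rw [hw]; linarith⟩
  have hδ0 : Tendsto (fun δ : ℝ => δ) (𝓝[>] 0) (𝓝 0) := tendsto_id.mono_left nhdsWithin_le_nhds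
  have hr : Tendsto (fun δ : ℝ => 1 + δ * t) (𝓝[>] 0) (𝓝 1) := by
    simpa using (hδ0.mul_const t).const_add 1
  have hray : Tendsto (fun δ : ℝ => (1 + δ * t) • w) (𝓝[>] 0) (𝓝 w) := by
    simpa using hr.smul_const w
  have hsmall : ∀ᶠ δ : ℝ in 𝓝[>] 0, 0 < δ ∧ δ * t ≤ η := by
    have h1 : ∀ᶠ δ : ℝ in 𝓝[>] 0, δ * t < η := by
      have := hδ0.mul_const t
      rw [zero_mul] at this
      exact this.eventually (gt_mem_nhds hη)
    filter_upwards [self_mem_nhdsWithin, h1] with δ h2 h3 using ⟨h2, h3.le⟩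
  have hcol : ∀ᶠ δ : ℝ in 𝓝[>] 0, (1 + δ * t) • w ∈ collar η := by
    filter_upwards [hsmall] with δ hδ
    have h1 : 0 ≤ δ * t := mul_nonneg hδ.1.le ht.le
    rw [collar, Set.mem_ofPred_eq, norm_ray hw h1]
    exact ⟨by linarith, by linarith [hδ.2]⟩
  have hrayW : Tendsto (fun δ : ℝ => (1 + δ * t) • w) (𝓝[>] 0) (𝓝[collar η] w) :=
    tendsto_nhdsWithin_iff.2 ⟨hray, hcol⟩
  have hqt : Tendsto (fun δ : ℝ => q ((1 + δ * t) • w)) (𝓝[>] 0) (𝓝 (q w)) :=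
    (hq w hwc).tendsto.comp hrayW
  have hgt : Tendsto (fun δ : ℝ => g' ((1 + δ * t) • w)) (𝓝[>] 0) (𝓝 (g' w)) :=
    (hg' w hwc).tendsto.comp hrayW
  have hpd : ∀ l, Tendsto (fun δ : ℝ => pd l g ((1 + δ * t) • w)) (𝓝[>] 0)
      (𝓝 (g' w (EuclideanSpace.single l 1))) := by
    intro l
    refine (((ContinuousLinearMap.apply ℝ ℝ (EuclideanSpace.single l (1 : ℝ))).continuous.tendsto
      (g' w)).comp hgt).congr' ?_
    filter_upwards [hsmall] with δ hδ
    have h1 : 0 < δ * t := mul_pos hδ.1 ht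
    have hn := norm_ray hw h1.le
    exact (pd_eq_of_mem_collar hg (by rw [hn]; linarith) (by rw [hn]; linarith [hδ.2]) l).2.symm
  have hdiv := tendsto_ray_div hη hg hg0 hw ht.le
  have hmain := (hr.pow 2).mul (hqt.mul
    ((((hpd b).const_mul (w a)).add ((hpd a).const_mul (w b))).const_mul (stepDeriv t) |>.add
      (((hδ0.mul_const (stepDeriv t)).mul ((tendsto_const_nhds (x := kron a b - w a * w b)).div hr
        one_ne_zero)).const_add (stepDerivTwo t * (w a * w b)) |>.mul hdiv)))
  have hlim : (1 : ℝ) ^ 2 * (q w * (stepDeriv t * (w a * g' w (EuclideanSpace.single b 1)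
      + w b * g' w (EuclideanSpace.single a 1))
      + (stepDerivTwo t * (w a * w b) + 0 * stepDeriv t * ((kron a b - w a * w b) / 1)) * (t * g' w w)))
      = (q w * (w a * g' w (EuclideanSpace.single b 1))) * (2 * stepDeriv t + t * stepDerivTwo t) := by
    rw [fderivWithin_tangential hη hg hg0 hw a, fderivWithin_tangential hη hg hg0 hw b]
    ring
  rw [hlim] at hmain
  refine hmain.congr' ?_
  filter_upwards [hsmall] with δ hδ
  exact (cutComm_cut_ray hδ.1 ht.le hw q g a b).symm

omit hη hg0 in
theorem continuousOn_annulus : ContinuousOn q {y | 1 < ‖y‖ ∧ ‖y‖ < 1 + η} ∧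
    ContinuousOn g {y | 1 < ‖y‖ ∧ ‖y‖ < 1 + η} ∧
    ∀ l, ContinuousOn (pd l g) {y | 1 < ‖y‖ ∧ ‖y‖ < 1 + η} := by
  have hsub : {y : E3 | 1 < ‖y‖ ∧ ‖y‖ < 1 + η} ⊆ collar η := fun y hy => ⟨hy.1.le, hy.2.le⟩
  refine ⟨hq.mono hsub, fun y hy => ?_, fun l => ?_⟩
  · exact (pd_eq_of_mem_collar hg hy.1 hy.2.le 0).1.continuousAt.continuousWithinAt
  · exact ((hg'.mono hsub).clm_apply continuousOn_const).congr
      fun y hy => (pd_eq_of_mem_collar hg hy.1 hy.2.le l).2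

/-- Dominated convergence on sphere × `[1, 2]`. The limit is a product of a function of `w` and the
profile `2 a' + t a''`, whose integral is `1` by `integral_step`. -/
theorem tendsto_integral_cutComm_zero (a b : Fin 3) :
    Tendsto (fun δ => ∫ y, q y * cutComm (cut δ) g a b y) (𝓝[>] 0)
      (𝓝 (∫ w : Metric.sphere (0 : E3) 1,
        q (w : E3) * ((w : E3) a * g' (w : E3) (EuclideanSpace.single b 1)) ∂surf)) := by
  obtain ⟨M, hM, hst⟩ := exists_step_bound
  obtain ⟨Cq, hCq⟩ := (isCompact_collar η).exists_bound_of_continuousOn hq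
  obtain ⟨L, hL⟩ := (isCompact_collar η).exists_bound_of_continuousOn hg'
  obtain ⟨hqU, hgU, hgU'⟩ := continuousOn_annulus hq hg hg'
  set U : Set E3 := {y | 1 < ‖y‖ ∧ ‖y‖ < 1 + η} with hUdef
  have hUo : IsOpen U :=
    (isOpen_lt continuous_const continuous_norm).inter (isOpen_lt continuous_norm continuous_const)
  set ν := surf.prod (volume.restrict (Set.Icc (1 : ℝ) 2)) with hν
  set F : ℝ → Metric.sphere (0 : E3) 1 × ℝ → ℝ := fun δ p => δ * ((1 + δ * p.2) ^ 2 *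
    (q ((1 + δ * p.2) • (p.1 : E3)) * cutComm (cut δ) g a b ((1 + δ * p.2) • (p.1 : E3)))) with hF
  have hsmall : ∀ᶠ δ : ℝ in 𝓝[>] 0, 0 < δ ∧ δ ≤ 1 ∧ 2 * δ < η := by
    have h1 : ∀ᶠ δ : ℝ in 𝓝[>] 0, δ < min 1 (η / 2) :=
      nhdsWithin_le_nhds (gt_mem_nhds (by positivity))
    filter_upwards [self_mem_nhdsWithin, h1] with δ h2 h3
    have h4 := h3.trans_le (min_le_left _ _)
    have h5 := h3.trans_le (min_le_right _ _)
    exact ⟨h2, h4.le, by linarith⟩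
  have hcont : ∀ δ : ℝ, 0 < δ → 2 * δ < η → (∀ l, tsupport (pd l (cut δ)) ⊆ U) := by
    intro δ hδ hδη l
    refine (tsupport_pd_cut_subset hδ l).trans fun y hy => ⟨?_, ?_⟩
    · linarith [hy.1]
    · linarith [hy.2]
  have hFc : ∀ δ : ℝ, 0 < δ → 2 * δ < η → Continuous (F δ) := by
    intro δ hδ hδη
    have h := continuous_mul_cutComm hUo (contDiff_cut hδ) (hcont δ hδ hδη) hqU hgU hgU' a b
    have h2 : Continuous fun p : Metric.sphere (0 : E3) 1 × ℝ => (1 + δ * p.2) • (p.1 : E3) := by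
      fun_prop
    exact continuous_const.mul (((continuous_const.add
      (continuous_const.mul continuous_snd)).pow 2).mul (h.comp h2))
  -- The `9` bounds `(1 + δ t)²` for `δ ≤ 1`, `t ≤ 2`; the last factor `2 * L` bounds `δ⁻¹ g`, by
  -- the mean value inequality along the ray.
  set K := 9 * (Cq * (M * (L + L) + (M + M * 2) * (2 * L))) with hK
  have hL0 : 0 ≤ L := by
    have h1 : ‖(EuclideanSpace.single 0 1 : E3)‖ = 1 := by simp
    exact (norm_nonneg _).trans (hL (EuclideanSpace.single 0 1) ⟨h1.ge, by rw [h1]; linarith⟩)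
  have hbound : ∀ δ : ℝ, 0 < δ → δ ≤ 1 → 2 * δ < η → ∀ᵐ p ∂ν, ‖F δ p‖ ≤ K := by
    intro δ hδ hδ1 hδη
    filter_upwards [ae_mem_Icc_prod] with p hp
    obtain ⟨w, t⟩ := p
    obtain ⟨ht1, ht2⟩ : 1 ≤ t ∧ t ≤ 2 := hp
    have hw : ‖(w : E3)‖ = 1 := norm_coe_sphere w
    have ht0 : 0 ≤ t := by linarith
    have hδt : 0 < δ * t := by positivity
    have hδt2 : δ * t ≤ 2 * δ := by nlinarith
    have hn := norm_ray hw hδt.le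
    have hmem : (1 + δ * t) • (w : E3) ∈ collar η := by
      rw [collar, Set.mem_ofPred_eq, hn]
      exact ⟨by linarith, by linarith⟩
    have hwi : ∀ i, |(w : E3) i| ≤ 1 := fun i => (abs_coord_le_norm (w : E3) i).trans hw.le
    have hpd : ∀ l, |pd l g ((1 + δ * t) • (w : E3))| ≤ L := by
      intro l
      rw [(pd_eq_of_mem_collar hg (by rw [hn]; linarith) hmem.2 l).2]
      refine ((g' _).le_opNorm _).trans ?_
      simpa using hL _ hmem
    have hgd : |δ⁻¹ * g ((1 + δ * t) • (w : E3))| ≤ 2 * L := by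
      have h1 := abs_ray_le hg hg0 hL hw hδt.le (by linarith)
      rw [abs_mul, abs_of_pos (inv_pos.2 hδ)]
      calc δ⁻¹ * |g ((1 + δ * t) • (w : E3))| ≤ δ⁻¹ * (L * (δ * t)) := by gcongr
        _ = L * t := by field_simp
        _ ≤ 2 * L := by nlinarith
    have hp0 : 0 < 1 + δ * t := by linarith
    have hsq : |(1 + δ * t) ^ 2| ≤ 9 := by
      rw [abs_of_pos (by positivity)]
      nlinarith
    have hkr : |(kron a b - (w : E3) a * (w : E3) b) / (1 + δ * t)| ≤ 2 := by
      rw [abs_div, abs_of_pos hp0, div_le_iff₀ hp0]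
      have h1 : |kron a b - (w : E3) a * (w : E3) b| ≤ 1 + 1 * 1 := by
        rw [sub_eq_add_neg]
        refine abs_add_le_of_le (abs_kron_le a b) ?_
        rw [abs_neg]
        exact abs_mul_le_of_le (hwi a) (hwi b)
      linarith
    have hδs : |δ * stepDeriv t| ≤ 1 * M :=
      abs_mul_le_of_le (by rw [abs_of_pos hδ]; exact hδ1) (hst t).1
    have key := abs_mul_le_of_le hsq (abs_mul_le_of_le (hCq _ hmem) (abs_add_le_of_le
      (abs_mul_le_of_le (hst t).1 (abs_add_le_of_le (abs_mul_le_of_le (hwi a) (hpd b))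
        (abs_mul_le_of_le (hwi b) (hpd a))))
      (abs_mul_le_of_le (abs_add_le_of_le
        (abs_mul_le_of_le (hst t).2 (abs_mul_le_of_le (hwi a) (hwi b)))
        (abs_mul_le_of_le hδs hkr)) hgd)))
    rw [hF, Real.norm_eq_abs]
    simp only []
    rw [cutComm_cut_ray hδ ht0 hw]
    refine key.trans_eq ?_
    rw [hK]
    ring
  have hlim : Tendsto (fun δ => ∫ p, F δ p ∂ν) (𝓝[>] 0)
      (𝓝 (∫ p : Metric.sphere (0 : E3) 1 × ℝ, (q (p.1 : E3) * ((p.1 : E3) a *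
        g' (p.1 : E3) (EuclideanSpace.single b 1))) * (2 * stepDeriv p.2 + p.2 * stepDerivTwo p.2) ∂ν)) := by
    refine tendsto_integral_filter_of_dominated_convergence (fun _ => K) ?_ ?_
      (integrable_const K) ?_
    · filter_upwards [hsmall] with δ hδ
      exact (hFc δ hδ.1 hδ.2.2).aestronglyMeasurable
    · filter_upwards [hsmall] with δ hδ
      exact hbound δ hδ.1 hδ.2.1 hδ.2.2
    · filter_upwards [ae_mem_Icc_prod] with p hp
      exact tendsto_cutComm_ray hη hq hg hg' hg0 (norm_coe_sphere p.1)
        (by linarith [hp.1]) a b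
  have hval : (∫ p : Metric.sphere (0 : E3) 1 × ℝ, (q (p.1 : E3) * ((p.1 : E3) a *
        g' (p.1 : E3) (EuclideanSpace.single b 1))) * (2 * stepDeriv p.2 + p.2 * stepDerivTwo p.2) ∂ν)
      = ∫ w : Metric.sphere (0 : E3) 1,
        q (w : E3) * ((w : E3) a * g' (w : E3) (EuclideanSpace.single b 1)) ∂surf := by
    rw [hν, integral_prod_mul (fun w : Metric.sphere (0 : E3) 1 => q (w : E3) * ((w : E3) a *
        g' (w : E3) (EuclideanSpace.single b 1))) fun t => 2 * stepDeriv t + t * stepDerivTwo t,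
      integral_step, mul_one]
  rw [hval] at hlim
  refine hlim.congr' ?_
  filter_upwards [hsmall] with δ hδ
  have hi := integrable_mul_cutComm hUo (contDiff_cut hδ.1) (hcont δ hδ.1 hδ.2.2) hqU hgU hgU'
    (fun l => (isCompact_shell δ).of_isClosed_subset (isClosed_tsupport _)
      (tsupport_pd_cut_subset hδ.1 l)) a b
  rw [integral_eq_of_support_shell hi hδ.1 fun y hy => by
    rw [cutComm_cut_eq_zero hδ.1 g hy, mul_zero]]
  exact integral_prod _ ((integrable_const K).mono' (hFc δ hδ.1 hδ.2.2).aestronglyMeasurable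
    (hbound δ hδ.1 hδ.2.1 hδ.2.2))

end boundary

/-! ### The regularised Green's function -/

theorem isOpen_Omega : IsOpen Omega := isOpen_lt continuous_const continuous_norm

theorem Omega_subset_OmegaBar : Omega ⊆ OmegaBar := fun x hx => le_of_lt (show 1 < ‖x‖ from hx)

theorem opDstar_sub (k : ℝ) {A B : MatField} {U : Set E3} (hU : IsOpen U)
    (hA : ∀ i j, ContDiffOn ℝ 2 (fun y => A y i j) U)
    (hB : ∀ i j, ContDiffOn ℝ 2 (fun y => B y i j) U) {x : E3} (hx : x ∈ U) (i j : Fin 3) :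
    opDstar k (fun y => A y - B y) i j x = opDstar k A i j x - opDstar k B i j x := by
  have hAB : ∀ i j, ContDiffOn ℝ 2 (fun y => (A y - B y) i j) U := fun i j => (hA i j).sub (hB i j)
  have hd : ∀ {f : E3 → ℝ}, ContDiffOn ℝ 2 f U → ∀ z ∈ U, DifferentiableAt ℝ f z :=
    fun hf z hz => (hf.contDiffAt (hU.mem_nhds hz)).differentiableAt (by norm_num)
  have hd' : ∀ {f : E3 → ℝ}, ContDiffOn ℝ 2 f U → ∀ l, DifferentiableAt ℝ (pd l f) x :=
    fun hf l => ((contDiffOn_pd (m := 1) hU hf (by norm_num) l).contDiffAt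
      (hU.mem_nhds hx)).differentiableAt (by norm_num)
  have h2 : ∀ a b p q, pd a (pd b fun y => (A y - B y) p q) x
      = pd a (pd b fun y => A y p q) x - pd a (pd b fun y => B y p q) x := by
    intro a b p q
    exact (pd_congr_of_isOpen (f := pd b fun y => A y p q - B y p q) hU
      (fun z hz => pd_sub (hd (hA p q) z hz) (hd (hB p q) z hz) b) hx a).trans
      (pd_sub (hd' (hA p q) b) (hd' (hB p q) b) a)
  rw [opDstar_eq k hU hAB hx, opDstar_eq k hU hA hx, opDstar_eq k hU hB hx]
  simp only [h2, Finset.sum_sub_distrib]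
  ring

theorem opDstar_comp_sub (k : ℝ) {A : MatField} (hA : ∀ i j, ContDiff ℝ 2 (fun y => A y i j))
    (s x : E3) (i j : Fin 3) : opDstar k (fun y => A (y - s)) i j x = opDstar k A i j (x - s) := by
  have hA' : ∀ i j, ContDiffOn ℝ 2 (fun y => A (y - s) i j) Set.univ := fun i j =>
    ((hA i j).comp (contDiff_id.sub contDiff_const)).contDiffOn
  have h2 : ∀ a b p q, pd a (pd b fun y => A (y - s) p q) x
      = pd a (pd b fun y => A y p q) (x - s) := by
    intro a b p q
    rw [pd_comp_sub (fun y => A y p q) s b, pd_comp_sub]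
  rw [opDstar_eq k isOpen_univ hA' (Set.mem_univ x),
    opDstar_eq k isOpen_univ (fun i j => (hA i j).contDiffOn) (Set.mem_univ (x - s))]
  simp only [h2]

/-- The Green's function with regularised singular part. -/
noncomputable def greenReg (k : ℝ) (S : Matrix (Fin 3) (Fin 3) ℝ) (s : E3) (Φ : MatField) (ε : ℝ) :
    MatField :=
  fun y => regFund k S ε (y - s) - Φ y

theorem greenReg_apply (k : ℝ) (S : Matrix (Fin 3) (Fin 3) ℝ) (s : E3) (Φ : MatField) (ε : ℝ)
    (y : E3) (p r : Fin 3) :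
    greenReg k S s Φ ε y p r = regFund k S ε (y - s) p r - Φ y p r := rfl

theorem contDiff_regFund (k : ℝ) (S : Matrix (Fin 3) (Fin 3) ℝ) {ε : ℝ} (hε : ε ≠ 0)
    {n : WithTop ℕ∞} (p q : Fin 3) : ContDiff ℝ n fun y => regFund k S ε y p q :=
  contDiff_iff_contDiffAt.2 fun _ => contDiffAt_regFund k S (by positivity) p q

theorem contDiffAt_regFund_sub (k : ℝ) (S : Matrix (Fin 3) (Fin 3) ℝ) {ε : ℝ} {y s : E3}
    (h : 0 < ‖y - s‖ ^ 2 + ε ^ 2) {n : WithTop ℕ∞} (p q : Fin 3) :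
    ContDiffAt ℝ n (fun y => regFund k S ε (y - s) p q) y :=
  ContDiffAt.comp (g := fun y => regFund k S ε y p q) y (contDiffAt_regFund k S h p q)
    (contDiffAt_id.sub contDiffAt_const)

section

variable {k : ℝ} {S : Matrix (Fin 3) (Fin 3) ℝ} {s : E3} {Φ : MatField}
  (hΦ2 : ∀ i j, ContDiffOn ℝ 2 (fun y => Φ y i j) Omega)

include hΦ2

theorem contDiffAt_corrector {y : E3} (hy : y ∈ Omega) (p r : Fin 3) :
    ContDiffAt ℝ 2 (fun y => Φ y p r) y :=
  (hΦ2 p r).contDiffAt (isOpen_Omega.mem_nhds hy)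

theorem contDiffOn_greenReg {ε : ℝ} (hε : ε ≠ 0) (p r : Fin 3) :
    ContDiffOn ℝ 2 (fun y => greenReg k S s Φ ε y p r) Omega := fun y hy =>
  ((contDiffAt_regFund_sub k S (by positivity) p r).sub
    (contDiffAt_corrector hΦ2 hy p r)).contDiffWithinAt

theorem hasPd_greenReg {ε : ℝ} {y : E3} (hy : y ∈ Omega) (h : 0 < ‖y - s‖ ^ 2 + ε ^ 2)
    (l p r : Fin 3) : HasPd l (fun y => greenReg k S s Φ ε y p r)
      (regFundPd k S ε l p r (y - s) - pd l (fun y => Φ y p r) y) y := by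
  have h1 : HasPd l (fun y => regFund k S ε (y - s) p r) (regFundPd k S ε l p r (y - s)) y :=
    ⟨(contDiffAt_regFund_sub (n := 1) k S h p r).differentiableAt (by norm_num),
      (congrFun (pd_comp_sub (fun y => regFund k S ε y p r) s l) y).trans
        (pd_regFund k S h l p r)⟩
  exact h1.sub ⟨(contDiffAt_corrector hΦ2 hy p r).differentiableAt (by norm_num), rfl⟩

theorem opDstar_greenReg (hk2 : 2 + k ≠ 0) (hk3 : 3 + 2 * k ≠ 0) (hS : S.IsSymm)
    (hΦe : ∀ y ∈ Omega, ∀ i j, opDstar k Φ i j y = 0) {ε : ℝ} (hε : ε ≠ 0) {y : E3}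
    (hy : y ∈ Omega) (i j : Fin 3) :
    opDstar k (greenReg k S s Φ ε) i j y
      = S i j * (315 / (96 * Real.pi) * (ε ^ 6 * rho ε (y - s) ^ (-9 : ℤ))) := by
  have hc := fun i j => contDiff_regFund k S hε (n := 2) i j
  have h := opDstar_sub k isOpen_Omega (A := fun y => regFund k S ε (y - s)) (B := Φ)
    (fun i j => ((hc i j).comp (contDiff_id.sub contDiff_const)).contDiffOn) hΦ2 hy i j
  rw [hΦe y hy, sub_zero, opDstar_comp_sub k hc, opDstar_regFund hk2 hk3 hS hε] at h
  exact h

/-- Removing the regularisation away from the pole. -/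
theorem tendsto_integral_cutComm_greenReg {q χ : E3 → ℝ} (hχ : ContDiff ℝ 2 χ)
    (hs : ∀ l, tsupport (pd l χ) ⊆ Omega \ {s}) (hc : ∀ l, HasCompactSupport (pd l χ))
    (hq : ContinuousOn q Omega) (a b p r : Fin 3) :
    Tendsto (fun ε => ∫ y, q y * cutComm χ (fun z => greenReg k S s Φ ε z p r) a b y) (𝓝[>] 0)
      (𝓝 (∫ y, q y * cutComm χ (fun z => greenReg k S s Φ 0 z p r) a b y)) := by
  obtain ⟨C, hC, hF⟩ := exists_abs_regFund_le k S p r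
  have hU : IsOpen (Omega \ {s}) := isOpen_Omega.sdiff isClosed_singleton
  have hsub : ∀ y ∈ Omega \ {s}, y - s ≠ 0 := fun y hy => sub_ne_zero.2 hy.2
  have hΦc : ∀ l, ContinuousOn (pd l fun y => Φ y p r) (Omega \ {s}) := fun l =>
    (contDiffOn_pd (m := 1) isOpen_Omega (hΦ2 p r) (by norm_num) l).continuousOn.mono
      Set.sdiff_subset
  have hqU : ContinuousOn q (Omega \ {s}) := hq.mono Set.sdiff_subset
  have hn : ContinuousOn (fun y => ‖y - s‖) (Omega \ {s}) := by fun_prop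
  have hn1 : ContinuousOn (fun y => ‖y - s‖⁻¹) (Omega \ {s}) :=
    hn.inv₀ fun y hy => norm_ne_zero_iff.2 (hsub y hy)
  have hn2 : ContinuousOn (fun y => (‖y - s‖ ^ 2)⁻¹) (Omega \ {s}) :=
    (hn.pow 2).inv₀ fun y hy => pow_ne_zero 2 (norm_ne_zero_iff.2 (hsub y hy))
  have hχ1 : ∀ l, ContDiff ℝ 1 (pd l χ) := fun l => contDiff_pd hχ (by norm_num) l
  -- The `ε`-uniform bounds are singular only at the pole. Multiplied by derivatives of `χ`, whose
  -- compact supports avoid the pole and the boundary, they become integrable majorants.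
  set B1 : Fin 3 → E3 → ℝ := fun l y => q y * (C * (‖y - s‖ ^ 2)⁻¹ + |pd l (fun y => Φ y p r) y|)
  set B0 : E3 → ℝ := fun y => q y * (C * ‖y - s‖⁻¹ + |Φ y p r|)
  have hB1 : ∀ l, ContinuousOn (B1 l) (Omega \ {s}) := fun l =>
    hqU.mul ((continuousOn_const.mul hn2).add (hΦc l).abs)
  have hB0 : ContinuousOn B0 (Omega \ {s}) :=
    hqU.mul ((continuousOn_const.mul hn1).add
      (((hΦ2 p r).continuousOn.mono Set.sdiff_subset).abs))
  have hBi : Integrable fun y => |pd a χ y * B1 b y| + |pd b χ y * B1 a y|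
      + |pd a (pd b χ) y * B0 y| :=
    ((integrable_mul_of_tsupport_subset hU (hχ1 a).continuous (hc a) (hB1 b) (hs a)).abs.add
      (integrable_mul_of_tsupport_subset hU (hχ1 b).continuous (hc b) (hB1 a) (hs b)).abs).add
      (integrable_mul_of_tsupport_subset hU (contDiff_pd (m := 0) (hχ1 b) (by simp) a).continuous
        (hasCompactSupport_pd (hc b) a) hB0 ((tsupport_pd_subset _ a).trans (hs b))).abs
  have hpos : ∀ (ε : ℝ), ∀ y ∈ Omega \ {s}, 0 < ‖y - s‖ ^ 2 + ε ^ 2 := fun ε y hy => by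
    have := norm_pos_iff.2 (hsub y hy)
    positivity
  have hoff : ∀ y, y ∉ Omega \ {s} → ∀ ε,
      cutComm χ (fun z => greenReg k S s Φ ε z p r) a b y = 0 := by
    intro y hy ε
    have h : ∀ l, y ∉ tsupport (pd l χ) := fun l hl => hy (hs l hl)
    rw [cutComm, image_eq_zero_of_notMem_tsupport (h a), image_eq_zero_of_notMem_tsupport (h b),
      pd_eq_zero_of_notMem_tsupport (h b)]
    simp
  have hpd : ∀ ε l, ContinuousOn (pd l fun z => greenReg k S s Φ ε z p r) (Omega \ {s}) := by
    intro ε l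
    have h1 : ContDiffOn ℝ 2 (fun z => greenReg k S s Φ ε z p r) (Omega \ {s}) := fun y hy =>
      ((contDiffAt_regFund_sub k S (hpos ε y hy) p r).sub
        (contDiffAt_corrector hΦ2 hy.1 p r)).contDiffWithinAt
    exact (contDiffOn_pd (m := 1) hU h1 (by norm_num) l).continuousOn
  have hg0 : ∀ ε, ContinuousOn (fun z => greenReg k S s Φ ε z p r) (Omega \ {s}) := fun ε y hy =>
    (hasPd_greenReg hΦ2 hy.1 (hpos ε y hy) 0 p r).1.continuousAt.continuousWithinAt
  refine tendsto_integral_filter_of_dominated_convergence _ (Eventually.of_forall fun ε => ?_)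
    (Eventually.of_forall fun ε => Eventually.of_forall fun y => ?_) hBi
    (Eventually.of_forall fun y => ?_)
  · exact (continuous_mul_cutComm hU hχ hs hqU (hg0 ε) (hpd ε) a b).aestronglyMeasurable
  · by_cases hy : y ∈ Omega \ {s}
    · rw [cutComm, (hasPd_greenReg hΦ2 hy.1 (hpos ε y hy) a p r).2,
        (hasPd_greenReg hΦ2 hy.1 (hpos ε y hy) b p r).2, greenReg_apply, Real.norm_eq_abs]
      obtain ⟨f0, f1⟩ := hF ε (y - s) (hsub y hy)
      have e1 : ∀ l c, |q y * (c * (regFundPd k S ε l p r (y - s) - pd l (fun y => Φ y p r) y))|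
          ≤ |c * B1 l y| := by
        intro l c
        rw [mul_left_comm, abs_mul, abs_mul, abs_mul, abs_mul]
        refine mul_le_mul_of_nonneg_left (mul_le_mul_of_nonneg_left ?_ (abs_nonneg _))
          (abs_nonneg _)
        exact (abs_sub _ _).trans ((add_le_add_left (f1 l) _).trans (le_abs_self _))
      have e0 : ∀ c, |q y * (c * (regFund k S ε (y - s) p r - Φ y p r))| ≤ |c * B0 y| := by
        intro c
        rw [mul_left_comm, abs_mul, abs_mul, abs_mul, abs_mul]
        refine mul_le_mul_of_nonneg_left (mul_le_mul_of_nonneg_left ?_ (abs_nonneg _))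
          (abs_nonneg _)
        exact (abs_sub _ _).trans ((add_le_add_left f0 _).trans (le_abs_self _))
      rw [mul_add, mul_add]
      exact abs_add_le_of_le (abs_add_le_of_le (e1 b _) (e1 a _)) (e0 _)
    · rw [hoff y hy, mul_zero, norm_zero]
      positivity
  · by_cases hy : y ∈ Omega \ {s}
    · have e : ∀ ε, cutComm χ (fun z => greenReg k S s Φ ε z p r) a b y
          = pd a χ y * (regFundPd k S ε b p r (y - s) - pd b (fun y => Φ y p r) y)
            + pd b χ y * (regFundPd k S ε a p r (y - s) - pd a (fun y => Φ y p r) y)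
            + pd a (pd b χ) y * (regFund k S ε (y - s) p r - Φ y p r) := by
        intro ε
        rw [cutComm, (hasPd_greenReg hΦ2 hy.1 (hpos ε y hy) a p r).2,
          (hasPd_greenReg hΦ2 hy.1 (hpos ε y hy) b p r).2, greenReg_apply]
      simp_rw [e]
      have t1 := fun l => (continuousAt_regFundPd_left k S (hsub y hy) 0 l p r).tendsto.mono_left
        (nhdsWithin_le_nhds (s := Set.Ioi 0))
      have t0 := (continuousAt_regFund_left k S (hsub y hy) 0 p r).tendsto.mono_left
        (nhdsWithin_le_nhds (s := Set.Ioi 0))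
      exact ((((t1 b).sub_const _).const_mul _).add (((t1 a).sub_const _).const_mul _) |>.add
        ((t0.sub_const _).const_mul _)).const_mul _
    · simp_rw [hoff y hy]
      exact tendsto_const_nhds

end

/-! ### The representation formula with a cut-off -/

section

variable {k : ℝ} {S : Matrix (Fin 3) (Fin 3) ℝ} {s : E3} {q Φ : MatField} {χ : E3 → ℝ}

/-- The weak equation is tested with `χ G_ε`, which is globally `C²`. Where both derivatives fall on
`G_ε`, the pairing is `χ q : 𝒟* G_ε`, that is, `S` times the bump; everything else is commutator. -/
theorem integral_add_adjForm_cutComm_greenReg (hk2 : 2 + k ≠ 0) (hk3 : 3 + 2 * k ≠ 0)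
    (hS : S.IsSymm)
    (hq : ∀ i j, ContDiffOn ℝ 2 (fun y => q y i j) Omega) (hqs : ∀ y ∈ Omega, (q y).IsSymm)
    (hqe : ∀ y ∈ Omega, ∀ i j, opD k q i j y = 0)
    (hΦ : ∀ i j, ContDiffOn ℝ 2 (fun y => Φ y i j) Omega) (hΦs : ∀ y ∈ Omega, (Φ y).IsSymm)
    (hΦe : ∀ y ∈ Omega, ∀ i j, opDstar k Φ i j y = 0)
    (hχ : ContDiff ℝ 2 χ) (hc : HasCompactSupport χ) (hs : tsupport χ ⊆ Omega)
    {ε : ℝ} (hε : ε ≠ 0) :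
    (∑ i, ∑ j, S i j * ∫ y, (χ y * q y i j)
        * (315 / (96 * Real.pi) * (ε ^ 6 * rho ε (y - s) ^ (-9 : ℤ))))
      + adjForm k (fun a b i j p r =>
        ∫ y, q y i j * cutComm χ (fun z => greenReg k S s Φ ε z p r) a b y) = 0 := by
  set G := greenReg k S s Φ ε with hGdef
  have hG : ∀ p r, ContDiffOn ℝ 2 (fun y => G y p r) Omega := contDiffOn_greenReg hΦ hε
  have hGs : ∀ y ∈ Omega, (G y).IsSymm := fun y hy =>
    (regFund_isSymm k hS ε (y - s)).sub (hΦs y hy)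
  have hχ0 : ∀ y, y ∉ Omega → χ y = 0 := fun y hy =>
    image_eq_zero_of_notMem_tsupport fun h => hy (hs h)
  have h0 := adjForm_integral_eq_zero (u := fun y => χ y • G y) isOpen_Omega hq hqs hqe
    (fun i j => contDiff_mul_of_tsupport_subset isOpen_Omega hχ (hG i j) hs)
    (fun y => by
      by_cases hy : y ∈ Omega
      · exact (hGs y hy).smul _
      · simp only [hχ0 y hy, zero_smul]
        exact Matrix.isSymm_zero)
    (fun i j => hc.mul_right) (fun i j => tsupport_mul_subset_of_left hs)
  have hi1 : ∀ a b i j p r,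
      Integrable fun y => χ y * (q y i j * pd a (pd b fun z => G z p r) y) :=
    fun a b i j p r => integrable_mul_of_tsupport_subset isOpen_Omega hχ.continuous hc
      ((hq i j).continuousOn.mul (contDiffOn_pd (m := 0) isOpen_Omega
        (contDiffOn_pd (m := 1) isOpen_Omega (hG p r) (by norm_num) b) (by simp) a).continuousOn) hs
  have hi2 : ∀ a b i j p r, Integrable fun y => q y i j * cutComm χ (fun z => G z p r) a b y :=
    fun a b i j p r => integrable_mul_cutComm isOpen_Omega hχ
      (fun l => (tsupport_pd_subset _ l).trans hs) (hq i j).continuousOn (hG p r).continuousOn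
      (fun l => (contDiffOn_pd (m := 1) isOpen_Omega (hG p r) (by norm_num) l).continuousOn)
      (fun l => hasCompactSupport_pd hc l) a b
  have hsplit : ∀ a b i j p r,
      ∫ y, q y i j * pd a (pd b fun z => (χ z • G z) p r) y
        = (∫ y, χ y * (q y i j * pd a (pd b fun z => G z p r) y))
          + ∫ y, q y i j * cutComm χ (fun z => G z p r) a b y := by
    intro a b i j p r
    rw [← integral_add (hi1 a b i j p r) (hi2 a b i j p r)]
    refine integral_congr_ae (Eventually.of_forall fun y => ?_)
    change q y i j * pd a (pd b fun z => χ z * G z p r) y = _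
    by_cases hy : y ∈ Omega
    · rw [pd_pd_mul isOpen_Omega hχ.contDiffOn (hG p r) hy]
      ring
    · have hy' : y ∉ tsupport χ := fun h => hy (hs h)
      have h1 : y ∉ tsupport fun z => χ z * G z p r := fun h =>
        hy (tsupport_mul_subset_of_left hs h)
      simp only [cutComm]
      rw [hχ0 y hy, pd_eq_zero_of_notMem_tsupport hy', pd_eq_zero_of_notMem_tsupport hy',
        pd_eq_zero_of_notMem_tsupport fun h => hy' (tsupport_pd_subset _ _ h),
        pd_eq_zero_of_notMem_tsupport fun h => h1 (tsupport_pd_subset _ _ h)]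
      ring
  simp_rw [hsplit] at h0
  rw [adjForm_add, integral_adjForm k volume hi1] at h0
  rw [← h0]
  refine congrArg₂ _ ?_ rfl
  refine Finset.sum_congr rfl fun i _ => Finset.sum_congr rfl fun j _ => ?_
  rw [← integral_const_mul]
  refine integral_congr_ae (Eventually.of_forall fun y => ?_)
  by_cases hy : y ∈ Omega
  · have h := opDstar_greenReg (s := s) hΦ hk2 hk3 hS hΦe hε hy i j
    rw [← hGdef, opDstar_eq k isOpen_Omega hG hy] at h
    simp only [← Finset.mul_sum]
    linear_combination (-χ y * q y i j) * h
  · simp [hχ0 y hy]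

/-- This is the limit `ε → 0⁺`: the bump evaluates `χ q` at `s`, while the commutators see `G_ε`
only away from the pole because `χ` is constant near `s`. -/
theorem sum_add_adjForm_cutComm_greenReg (hk2 : 2 + k ≠ 0) (hk3 : 3 + 2 * k ≠ 0)
    (hS : S.IsSymm)
    (hq : ∀ i j, ContDiffOn ℝ 2 (fun y => q y i j) Omega) (hqs : ∀ y ∈ Omega, (q y).IsSymm)
    (hqe : ∀ y ∈ Omega, ∀ i j, opD k q i j y = 0)
    (hΦ : ∀ i j, ContDiffOn ℝ 2 (fun y => Φ y i j) Omega) (hΦs : ∀ y ∈ Omega, (Φ y).IsSymm)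
    (hΦe : ∀ y ∈ Omega, ∀ i j, opDstar k Φ i j y = 0)
    (hχ : ContDiff ℝ 2 χ) (hc : HasCompactSupport χ) (hs : tsupport χ ⊆ Omega)
    (hs' : ∀ l, tsupport (pd l χ) ⊆ Omega \ {s}) :
    (∑ i, ∑ j, S i j * (χ s * q s i j))
      + adjForm k (fun a b i j p r =>
        ∫ y, q y i j * cutComm χ (fun z => greenReg k S s Φ 0 z p r) a b y) = 0 := by
  have hcont : ∀ i j, Continuous fun y => χ y * q y i j := fun i j =>
    continuous_mul_of_tsupport_subset isOpen_Omega hχ.continuous (hq i j).continuousOn hs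
  have hint : ∀ i j, Integrable fun y => χ y * q y i j := fun i j =>
    integrable_mul_of_tsupport_subset isOpen_Omega hχ.continuous hc (hq i j).continuousOn hs
  have h1 := tendsto_finsetSum Finset.univ fun i _ => tendsto_finsetSum Finset.univ fun j _ =>
    (tendsto_integral_rho _ (hcont i j) (hint i j) s).const_mul (S i j)
  have h2 := tendsto_adjForm k fun a b i j p r => tendsto_integral_cutComm_greenReg (k := k) (S := S)
    hΦ hχ hs' (fun l => hasCompactSupport_pd hc l) (hq i j).continuousOn a b p r
  refine tendsto_nhds_unique (h1.add h2) (tendsto_const_nhds.congr' ?_)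
  filter_upwards [self_mem_nhdsWithin] with ε hε
  exact (integral_add_adjForm_cutComm_greenReg hk2 hk3 hS hq hqs hqe hΦ hΦs hΦe hχ hc hs
    (ne_of_gt hε)).symm

end

/-! ### Removing the cut-offs -/

/-- The set is not convex, but through each of its points `y` it contains the half-space `⟨y/|y|, x⟩
≥ 1`, which is convex with nonempty interior. -/
theorem uniqueDiffOn_OmegaBar : UniqueDiffOn ℝ OmegaBar := by
  intro y hy
  have hy1 : 1 ≤ ‖y‖ := hy
  have hn : 0 < ‖y‖ := by linarith
  have hu : ‖(‖y‖⁻¹ • y)‖ = 1 := by rw [norm_smul, norm_inv, norm_norm, inv_mul_cancel₀ hn.ne']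
  set u : E3 := ‖y‖⁻¹ • y with hudef
  have hyu : inner ℝ u y = ‖y‖ := by
    rw [hudef, real_inner_smul_left, real_inner_self_eq_norm_sq]
    field_simp
  have hlin : Continuous fun x : E3 => inner ℝ u x := by fun_prop
  have hconv : Convex ℝ {x : E3 | 1 ≤ inner ℝ u x} :=
    convex_halfSpace_ge (f := fun x : E3 => inner ℝ u x) (innerSL ℝ u).isLinear 1
  have hint : (interior {x : E3 | 1 ≤ inner ℝ u x}).Nonempty := by
    refine ⟨(2 : ℝ) • u, interior_maximal (t := {x : E3 | 1 < inner ℝ u x})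
      (fun x hx => le_of_lt (show 1 < inner ℝ u x from hx))
      (isOpen_lt continuous_const hlin) ?_⟩
    rw [Set.mem_ofPred_eq, real_inner_smul_right, real_inner_self_eq_norm_sq, hu]
    norm_num
  refine (uniqueDiffWithinAt_convex hconv hint (subset_closure ?_)).mono fun x hx => ?_
  · rw [Set.mem_ofPred_eq, hyu]
    exact hy1
  · have := real_inner_le_norm u x
    rw [hu, one_mul] at this
    exact le_trans (show 1 ≤ inner ℝ u x from hx) this

theorem cutComm_sub {χ ψ : E3 → ℝ} (hχ : ContDiff ℝ 2 χ) (hψ : ContDiff ℝ 2 ψ) (g : E3 → ℝ)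
    (a b : Fin 3) (y : E3) :
    cutComm (fun y => χ y - ψ y) g a b y = cutComm χ g a b y - cutComm ψ g a b y := by
  have hd : ∀ {f : E3 → ℝ}, ContDiff ℝ 2 f → ∀ z, DifferentiableAt ℝ f z :=
    fun hf z => hf.differentiable (by norm_num) z
  have hd' : ∀ {f : E3 → ℝ}, ContDiff ℝ 2 f → DifferentiableAt ℝ (pd b f) y :=
    fun hf => (contDiff_pd (m := 1) hf (by norm_num) b).differentiable (by norm_num) y
  have h1 : ∀ l, pd l (fun y => χ y - ψ y) = fun y => pd l χ y - pd l ψ y := fun l =>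
    funext fun z => pd_sub (hd hχ z) (hd hψ z) l
  rw [cutComm, cutComm, cutComm, h1 a, h1 b, pd_sub (hd' hχ) (hd' hψ)]
  ring

section

variable {δ R : ℝ} (hδ : 0 < δ) (hR : δ < R)

include hδ hR

theorem tsupport_cut_sub_cut_subset :
    tsupport (fun y => cut δ y - cut R y) ⊆ {y | 1 + δ ≤ ‖y‖ ∧ ‖y‖ ≤ 1 + 2 * R} := by
  refine closure_minimal (fun y hy => ?_) ((isClosed_le continuous_const continuous_norm).inter
      (isClosed_le continuous_norm continuous_const))
  by_contra h
  refine hy ?_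
  rw [Set.mem_ofPred_eq, not_and_or, not_le, not_le] at h
  rcases h with h | h
  · simp only [cut_of_le hδ h.le, cut_of_le (hδ.trans hR) (y := y) (by linarith), sub_zero]
  · simp only [cut_of_ge hδ (y := y) (by linarith), cut_of_ge (hδ.trans hR) h.le, sub_self]

theorem hasCompactSupport_cut_sub_cut : HasCompactSupport fun y => cut δ y - cut R y :=
  (isCompact_closedBall (0 : E3) (1 + 2 * R)).of_isClosed_subset (isClosed_tsupport _)
    fun y hy => by simpa using (tsupport_cut_sub_cut_subset hδ hR hy).2

theorem tsupport_pd_cut_sub_cut_subset (l : Fin 3) :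
    tsupport (pd l fun y => cut δ y - cut R y) ⊆ shell δ ∪ shell R := by
  refine closure_minimal (fun y hy => ?_)
    ((isCompact_shell δ).isClosed.union (isCompact_shell R).isClosed)
  by_contra h
  rw [Set.mem_union, not_or] at h
  refine hy ?_
  have hd : ∀ {r}, 0 < r → DifferentiableAt ℝ (cut r) y :=
    fun hr => (contDiff_cut hr).differentiable (by norm_num) y
  rw [pd_sub (hd hδ) (hd (hδ.trans hR)),
    image_eq_zero_of_notMem_tsupport fun h' => h.1 (tsupport_pd_cut_subset hδ l h'),
    image_eq_zero_of_notMem_tsupport fun h' => h.2 (tsupport_pd_cut_subset (hδ.trans hR) l h'),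
    sub_zero]

end

theorem shell_subset {δ : ℝ} (hδ : 0 < δ) {s : E3} (hs : s ∉ shell δ) : shell δ ⊆ Omega \ {s} :=
  fun y hy => ⟨show 1 < ‖y‖ by linarith [hy.1], fun h => hs (h ▸ hy)⟩

section

variable {k : ℝ} {S : Matrix (Fin 3) (Fin 3) ℝ} {s : E3} {Φ : MatField}

theorem integrable_mul_cutComm_cut_greenReg {q : E3 → ℝ} (hq : ContinuousOn q Omega)
    (hΦ : ∀ i j, ContDiffOn ℝ 2 (fun y => Φ y i j) Omega) {δ : ℝ} (hδ : 0 < δ) (hs : s ∉ shell δ)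
    (a b p r : Fin 3) :
    Integrable fun y => q y * cutComm (cut δ) (fun z => greenReg k S s Φ 0 z p r) a b y := by
  have hU : IsOpen (Omega \ {s}) := isOpen_Omega.sdiff isClosed_singleton
  have hg : ContDiffOn ℝ 2 (fun z => greenReg k S s Φ 0 z p r) (Omega \ {s}) := fun y hy => by
    have h : 0 < ‖y - s‖ := norm_pos_iff.2 (sub_ne_zero.2 hy.2)
    exact ((contDiffAt_regFund_sub k S (by positivity) p r).sub
      (contDiffAt_corrector hΦ hy.1 p r)).contDiffWithinAt
  exact integrable_mul_cutComm hU (contDiff_cut hδ)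
    (fun l => (tsupport_pd_cut_subset hδ l).trans (shell_subset hδ hs)) (hq.mono Set.sdiff_subset)
    hg.continuousOn (fun l => (contDiffOn_pd (m := 1) hU hg (by norm_num) l).continuousOn)
    (fun l => (isCompact_shell δ).of_isClosed_subset (isClosed_tsupport _)
      (tsupport_pd_cut_subset hδ l)) a b

theorem half_norm_le_norm_sub {y s : E3} (h : 2 * ‖s‖ ≤ ‖y‖) : ‖y‖ / 2 ≤ ‖y - s‖ := by
  linarith [norm_sub_norm_le y s]

theorem greenReg_isBigO (p r : Fin 3)
    (hd : (fun y => Φ y p r) =O[Bornology.cobounded E3] fun y => ‖y‖⁻¹) :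
    (fun z => greenReg k S s Φ 0 z p r) =O[Bornology.cobounded E3] fun y => ‖y‖⁻¹ := by
  obtain ⟨C, hC, hF⟩ := exists_abs_regFund_le k S p r
  refine IsBigO.sub (IsBigO.of_bound (C * 2) ?_) hd
  filter_upwards [tendsto_norm_cobounded_atTop.eventually_ge_atTop (2 * ‖s‖),
    tendsto_norm_cobounded_atTop.eventually_ge_atTop 1] with y hy hy1
  have hle := half_norm_le_norm_sub hy
  have hpos : 0 < ‖y - s‖ := by linarith
  rw [Real.norm_eq_abs, norm_inv, norm_norm]
  refine ((hF 0 (y - s) (norm_pos_iff.1 hpos)).1).trans ?_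
  rw [mul_assoc]
  refine mul_le_mul_of_nonneg_left ?_ hC
  refine (inv_anti₀ (by linarith) hle).trans (le_of_eq ?_)
  rw [inv_div, div_eq_mul_inv]

theorem pd_greenReg_isBigO (hΦ : ∀ i j, ContDiffOn ℝ 2 (fun y => Φ y i j) Omega) (l p r : Fin 3)
    (hd : (fun y => fderiv ℝ (fun z => Φ z p r) y)
      =O[Bornology.cobounded E3] fun y => (‖y‖ ^ 2)⁻¹) :
    (pd l fun z => greenReg k S s Φ 0 z p r) =O[Bornology.cobounded E3] fun y => (‖y‖ ^ 2)⁻¹ := by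
  obtain ⟨C, hC, hF⟩ := exists_abs_regFund_le k S p r
  have h1 : (pd l fun z => Φ z p r) =O[Bornology.cobounded E3] fun y => (‖y‖ ^ 2)⁻¹ := by
    refine IsBigO.trans (IsBigO.of_bound 1 (Eventually.of_forall fun y => ?_)) hd
    refine (ContinuousLinearMap.le_opNorm _ _).trans ?_
    simp
  have h2 : (fun y => regFundPd k S 0 l p r (y - s))
      =O[Bornology.cobounded E3] fun y => (‖y‖ ^ 2)⁻¹ := by
    refine IsBigO.of_bound (C * 4) ?_
    filter_upwards [tendsto_norm_cobounded_atTop.eventually_ge_atTop (2 * ‖s‖),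
      tendsto_norm_cobounded_atTop.eventually_ge_atTop 1] with y hy hy1
    have hle := half_norm_le_norm_sub hy
    have hpos : 0 < ‖y - s‖ := by linarith
    rw [Real.norm_eq_abs, norm_inv, norm_pow, norm_norm]
    refine ((hF 0 (y - s) (norm_pos_iff.1 hpos)).2 l).trans ?_
    rw [mul_assoc]
    refine mul_le_mul_of_nonneg_left ?_ hC
    refine (inv_anti₀ (by positivity) (pow_le_pow_left₀ (by positivity) hle 2)).trans (le_of_eq ?_)
    field_simp
    norm_num
  refine (h2.sub h1).congr' ?_ EventuallyEq.rfl
  filter_upwards [tendsto_norm_cobounded_atTop.eventually_ge_atTop (2 * ‖s‖),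
    tendsto_norm_cobounded_atTop.eventually_gt_atTop 1] with y hy hy1
  have hpos : 0 < ‖y - s‖ := by linarith [half_norm_le_norm_sub hy]
  exact (hasPd_greenReg hΦ hy1 (by positivity) l p r).2.symm

/-- The derivative of the Green's function up to the boundary. -/
noncomputable def greenDeriv (k : ℝ) (S : Matrix (Fin 3) (Fin 3) ℝ) (s : E3) (Φ : MatField)
    (p r : Fin 3) (y : E3) : E3 →L[ℝ] ℝ :=
  fderiv ℝ (fun y => regFund k S 0 (y - s) p r) y - fderivWithin ℝ (fun y => Φ y p r) OmegaBar y

theorem hasFDerivWithinAt_greenReg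
    (hΦ1 : ∀ i j, ContDiffOn ℝ 1 (fun y => Φ y i j) OmegaBar) {y : E3} (hy : y ∈ OmegaBar)
    (hys : y ≠ s) (p r : Fin 3) :
    HasFDerivWithinAt (fun z => greenReg k S s Φ 0 z p r) (greenDeriv k S s Φ p r y) OmegaBar y := by
  have h : 0 < ‖y - s‖ := norm_pos_iff.2 (sub_ne_zero.2 hys)
  exact ((contDiffAt_regFund_sub (n := 1) k S (by positivity) p r).differentiableAt
    (by norm_num)).hasFDerivAt.hasFDerivWithinAt.sub
    ((hΦ1 p r).differentiableOn (by norm_num) y hy).hasFDerivWithinAt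

theorem continuousOn_greenDeriv
    (hΦ1 : ∀ i j, ContDiffOn ℝ 1 (fun y => Φ y i j) OmegaBar) (p r : Fin 3) :
    ContinuousOn (greenDeriv k S s Φ p r) (OmegaBar \ {s}) := by
  refine ContinuousOn.sub (fun y hy => ?_) (((hΦ1 p r).continuousOn_fderivWithin
    uniqueDiffOn_OmegaBar (by norm_num)).mono Set.sdiff_subset)
  have h : 0 < ‖y - s‖ := norm_pos_iff.2 (sub_ne_zero.2 hy.2)
  exact (((contDiffAt_regFund_sub (n := 2) k S (by positivity) p r).fderiv_right (m := 1)
    (by norm_num)).continuousAt).continuousWithinAt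

/-- The cut-off `cut δ - cut R` equals `1` at `s` as soon as `1 + 2δ < |s| < 1 + R`, and its
commutator splits into an inner and an outer part. The limit `R → ∞` is taken for fixed `δ`, then `δ
→ 0`. -/
theorem sum_add_adjForm_boundary {q : MatField} (hk2 : 2 + k ≠ 0) (hk3 : 3 + 2 * k ≠ 0)
    (hS : S.IsSymm) (hs : s ∈ Omega)
    (hq : ∀ i j, ContDiffOn ℝ 2 (fun y => q y i j) Omega) (hqs : ∀ y ∈ Omega, (q y).IsSymm)
    (hqc : ∀ i j, ContinuousOn (fun y => q y i j) OmegaBar)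
    (hqe : ∀ y ∈ Omega, ∀ i j, opD k q i j y = 0)
    (hq0 : ∀ i j, Tendsto (fun y => q y i j) (Bornology.cobounded E3) (𝓝 0))
    (hΦ : ∀ i j, ContDiffOn ℝ 2 (fun y => Φ y i j) Omega) (hΦs : ∀ y ∈ Omega, (Φ y).IsSymm)
    (hΦ1 : ∀ i j, ContDiffOn ℝ 1 (fun y => Φ y i j) OmegaBar)
    (hΦe : ∀ y ∈ Omega, ∀ i j, opDstar k Φ i j y = 0)
    (hΦb : ∀ y, ‖y‖ = 1 → Φ y = regFund k S 0 (y - s))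
    (hd0 : ∀ i j, (fun y => Φ y i j) =O[Bornology.cobounded E3] fun y => ‖y‖⁻¹)
    (hd1 : ∀ i j, (fun y => fderiv ℝ (fun z => Φ z i j) y)
      =O[Bornology.cobounded E3] fun y => (‖y‖ ^ 2)⁻¹) :
    (∑ i, ∑ j, S i j * q s i j)
      + adjForm k (fun a b i j p r => ∫ w : Metric.sphere (0 : E3) 1,
        q (w : E3) i j * ((w : E3) a * greenDeriv k S s Φ p r (w : E3) (EuclideanSpace.single b 1))
          ∂surf) = 0 := by
  have hs1 : 1 < ‖s‖ := hs
  set J : ℝ → Fin 3 → Fin 3 → Fin 3 → Fin 3 → Fin 3 → Fin 3 → ℝ := fun δ a b i j p r =>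
    ∫ y, q y i j * cutComm (cut δ) (fun z => greenReg k S s Φ 0 z p r) a b y with hJ
  have key : ∀ δ R, 0 < δ → δ < R → 1 + 2 * δ < ‖s‖ → ‖s‖ < 1 + R →
      (∑ i, ∑ j, S i j * q s i j) + (adjForm k (J δ) - adjForm k (J R)) = 0 := by
    intro δ R hδ hR h1 h2
    have hsδ : s ∉ shell δ := fun h => by linarith [h.2]
    have hsR : s ∉ shell R := fun h => by linarith [h.1]
    have h := sum_add_adjForm_cutComm_greenReg hk2 hk3 hS hq hqs hqe hΦ hΦs hΦe
      (χ := fun y => cut δ y - cut R y) (s := s)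
      ((contDiff_cut hδ).sub (contDiff_cut (hδ.trans hR))) (hasCompactSupport_cut_sub_cut hδ hR)
      (fun y hy => show 1 < ‖y‖ by linarith [(tsupport_cut_sub_cut_subset hδ hR hy).1])
      (fun l => (tsupport_pd_cut_sub_cut_subset hδ hR l).trans
        (Set.union_subset (shell_subset hδ hsδ) (shell_subset (hδ.trans hR) hsR)))
    rw [← adjForm_sub]
    rw [cut_of_ge hδ h1.le, cut_of_le (hδ.trans hR) h2.le] at h
    simp only [sub_zero, one_mul] at h
    rw [← h]
    refine congrArg₂ _ rfl (congrArg _ ?_)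
    funext a b i j p r
    simp only [hJ]
    rw [← integral_sub
      (integrable_mul_cutComm_cut_greenReg (hq i j).continuousOn hΦ hδ hsδ a b p r)
      (integrable_mul_cutComm_cut_greenReg (hq i j).continuousOn hΦ (hδ.trans hR) hsR a b p r)]
    refine integral_congr_ae (Eventually.of_forall fun y => ?_)
    simp only [cutComm_sub (contDiff_cut hδ) (contDiff_cut (hδ.trans hR)), mul_sub]
  have hinf : Tendsto (fun R => adjForm k (J R)) atTop (𝓝 (adjForm k fun _ _ _ _ _ _ => 0)) :=
    tendsto_adjForm k fun a b i j p r => tendsto_integral_cutComm_atTop (hq0 i j)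
      (greenReg_isBigO p r (hd0 p r)) (fun l => pd_greenReg_isBigO hΦ l p r (hd1 p r)) a b
  have hinf' : adjForm k (fun _ _ _ _ _ _ => 0) = 0 := by simp [adjForm]
  rw [hinf'] at hinf
  have hsmall : ∀ δ, 0 < δ → 1 + 2 * δ < ‖s‖ →
      (∑ i, ∑ j, S i j * q s i j) + adjForm k (J δ) = 0 := by
    intro δ hδ h1
    have ht := (hinf.const_sub (adjForm k (J δ))).const_add (∑ i, ∑ j, S i j * q s i j)
    rw [sub_zero] at ht
    refine tendsto_nhds_unique ht (tendsto_const_nhds.congr' ?_)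
    filter_upwards [eventually_gt_atTop δ, eventually_gt_atTop (‖s‖ - 1)] with R hR h2
    exact (key δ R hδ hR h1 (by linarith)).symm
  -- Half the distance from `s` to the sphere: the closed collar misses the pole, and `δ` below this
  -- value gives `1 + 2δ < |s|`.
  have hη : 0 < (‖s‖ - 1) / 2 := by linarith
  have hcol : collar ((‖s‖ - 1) / 2) ⊆ OmegaBar \ {s} := fun y hy =>
    ⟨hy.1, fun h => by
      rw [Set.mem_singleton_iff] at h
      rw [h] at hy
      linarith [hy.2]⟩
  have hzero := tendsto_adjForm k fun a b i j p r => tendsto_integral_cutComm_zero hη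
    ((hqc i j).mono fun y hy => (hcol hy).1)
    (fun y hy => hasFDerivWithinAt_greenReg (k := k) (S := S) hΦ1 (hcol hy).1 (hcol hy).2 p r)
    ((continuousOn_greenDeriv hΦ1 p r).mono hcol)
    (fun y hy => by rw [greenReg_apply, hΦb y hy, sub_self]) a b
  refine tendsto_nhds_unique (hzero.const_add (∑ i, ∑ j, S i j * q s i j))
    (tendsto_const_nhds.congr' ?_)
  filter_upwards [self_mem_nhdsWithin, nhdsWithin_le_nhds (Iio_mem_nhds hη)] with δ hδ hδ2
  have hδ2' : δ < (‖s‖ - 1) / 2 := hδ2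
  exact (hsmall δ hδ (by linarith)).symm

end

/-! ### The boundary kernel -/

theorem sum_symUnit_mul (m n : Fin 3) {A : Matrix (Fin 3) (Fin 3) ℝ} (hA : A.IsSymm) :
    ∑ i, ∑ j, symUnit m n i j * A i j = (if m = n then 1 else 2) * A m n := by
  have h1 := hA.apply 0 1
  have h2 := hA.apply 0 2
  have h3 := hA.apply 1 2
  fin_cases m <;> fin_cases n <;> simp [symUnit, Fin.sum_univ_three] <;> linarith

section

variable {k : ℝ} {m n : Fin 3} {s : E3} {Φ : MatField}

theorem hasFDerivWithinAt_green (hk2 : 2 + k ≠ 0) (hk3 : 3 + 2 * k ≠ 0)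
    (hΦ1 : ∀ i j, ContDiffOn ℝ 1 (fun y => Φ y i j) OmegaBar) {y : E3} (hy : y ∈ OmegaBar)
    (hys : y ≠ s) (i j : Fin 3) :
    HasFDerivWithinAt (fun z => green k m n s Φ z i j) (greenDeriv k (symUnit m n) s Φ i j y)
      OmegaBar y := by
  have he : ∀ z, z ≠ s → green k m n s Φ z i j = greenReg k (symUnit m n) s Φ 0 z i j := by
    intro z hz
    rw [greenReg_apply, ← fundSol_eq_regFund hk2 hk3 m n (sub_ne_zero.2 hz)]
    rfl
  exact (hasFDerivWithinAt_greenReg hΦ1 hy hys i j).congr_of_eventuallyEq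
    (nhdsWithin_le_nhds (mem_of_superset (isOpen_ne.mem_nhds hys) he)) (he y hys)

theorem bpd_green (hk2 : 2 + k ≠ 0) (hk3 : 3 + 2 * k ≠ 0)
    (hΦ1 : ∀ i j, ContDiffOn ℝ 1 (fun y => Φ y i j) OmegaBar) {y : E3} (hy : y ∈ OmegaBar)
    (hys : y ≠ s) (l i j : Fin 3) :
    bpd l (fun z => green k m n s Φ z i j) y
      = greenDeriv k (symUnit m n) s Φ i j y (EuclideanSpace.single l 1) := by
  rw [bpd, (hasFDerivWithinAt_green hk2 hk3 hΦ1 hy hys i j).fderivWithin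
    (uniqueDiffOn_OmegaBar y hy)]

theorem bpd_trace_green (hk2 : 2 + k ≠ 0) (hk3 : 3 + 2 * k ≠ 0)
    (hΦ1 : ∀ i j, ContDiffOn ℝ 1 (fun y => Φ y i j) OmegaBar) {y : E3} (hy : y ∈ OmegaBar)
    (hys : y ≠ s) (l : Fin 3) :
    bpd l (fun z => (green k m n s Φ z).trace) y
      = ∑ p, greenDeriv k (symUnit m n) s Φ p p y (EuclideanSpace.single l 1) := by
  have h := HasFDerivWithinAt.fun_sum (u := Finset.univ) fun p _ =>
    hasFDerivWithinAt_green (m := m) (n := n) hk2 hk3 hΦ1 hy hys p p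
  have h' : HasFDerivWithinAt (fun z => (green k m n s Φ z).trace)
      (∑ p, greenDeriv k (symUnit m n) s Φ p p y) OmegaBar y := h
  rw [bpd, h'.fderivWithin (uniqueDiffOn_OmegaBar y hy), _root_.sum_apply]

theorem greenDeriv_symm {S : Matrix (Fin 3) (Fin 3) ℝ} (hS : S.IsSymm)
    (hΦs : ∀ y ∈ OmegaBar, (Φ y).IsSymm) {y : E3} (hy : y ∈ OmegaBar) (p r : Fin 3) :
    greenDeriv k S s Φ p r y = greenDeriv k S s Φ r p y := by
  rw [greenDeriv, greenDeriv]
  have h1 : (fun y => regFund k S 0 (y - s) p r) = fun y => regFund k S 0 (y - s) r p :=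
    funext fun y => (regFund_isSymm k hS 0 (y - s)).apply r p
  rw [h1, fderivWithin_congr (fun z hz => (hΦs z hz).apply r p) ((hΦs y hy).apply r p)]

/-- Since `ν = -y`, every term of the kernel changes sign, and what is left is minus the `adjForm`
integrand with `∂_a ∂_b` replaced by `y_a ∂_b`, the form produced by the boundary limit. -/
theorem kernel_green (hk2 : 2 + k ≠ 0) (hk3 : 3 + 2 * k ≠ 0)
    (hΦ1 : ∀ i j, ContDiffOn ℝ 1 (fun y => Φ y i j) OmegaBar) {y : E3} (hy : y ∈ OmegaBar)
    (hys : y ≠ s) {D : Fin 3 → Fin 3 → Fin 3 → ℝ}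
    (hD : ∀ p r l, D p r l = greenDeriv k (symUnit m n) s Φ p r y (EuclideanSpace.single l 1))
    (c : ℝ) (i j : Fin 3) :
    c * kernel k (green k m n s Φ) i j y
      = -(-(∑ l, c * (y l * D i j l))
        - k / 2 * ((∑ l, c * (y i * D l j l)) + (∑ l, c * (y j * D l i l))
          - 2 / 3 * ∑ l, c * (y i * D l l j))) := by
  rw [kernel]
  simp only [bpd_green hk2 hk3 hΦ1 hy hys, bpd_trace_green hk2 hk3 hΦ1 hy hys, ← hD, nu,
    ← Finset.mul_sum, Finset.sum_add_distrib, ← Finset.sum_mul, neg_mul, Finset.sum_neg_distrib]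
  ring

/-- A finite expansion using the symmetry of `G` and `q = y ⊗ y - e₃ ⊗ e₃`, in which the multiples
of the identity cancel. -/
theorem sum_mul_kernel_eq_neg_expanded (hk2 : 2 + k ≠ 0) (hk3 : 3 + 2 * k ≠ 0)
    (hΦ1 : ∀ i j, ContDiffOn ℝ 1 (fun y => Φ y i j) OmegaBar)
    (hΦs : ∀ y ∈ OmegaBar, (Φ y).IsSymm) {y : E3} (hy : ‖y‖ = 1) (hys : y ≠ s) :
    ∑ i, ∑ j, (Qbdry y - Qinf) i j * kernel k (green k m n s Φ) i j y
      = -expanded k (green k m n s Φ) y := by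
  have hyb : y ∈ OmegaBar := hy.ge
  have hn : y 0 ^ 2 + y 1 ^ 2 + y 2 ^ 2 = 1 := by
    have := norm_sq_eq_sum y
    rw [hy, Fin.sum_univ_three] at this
    linarith
  obtain ⟨D, hD⟩ : ∃ D : Fin 3 → Fin 3 → Fin 3 → ℝ, ∀ p r l,
      D p r l = greenDeriv k (symUnit m n) s Φ p r y (EuclideanSpace.single l 1) :=
    ⟨_, fun _ _ _ => rfl⟩
  have hDs : ∀ p r l, D p r l = D r p l := fun p r l => by
    rw [hD, hD, greenDeriv_symm (symUnit_isSymm m n) hΦs hyb]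
  have hq : ∀ i j, (Qbdry y - Qinf) i j = y i * y j - if i = 2 ∧ j = 2 then 1 else 0 := by
    intro i j
    simp only [Qbdry, Qinf, Matrix.sub_apply, Matrix.vecMulVec_apply, Matrix.single_apply,
      sub_sub_sub_cancel_right, eq_comm]
  simp only [hq, kernel_green hk2 hk3 hΦ1 hyb hys hD, expanded, bpd_green hk2 hk3 hΦ1 hyb hys,
    ← hD, Fin.sum_univ_three]
  simp only [hDs 1 0, hDs 2 0, hDs 2 1]
  simp
  -- Contracting `y_i y_j` with the divergence and trace terms produces `|y|² y_j ∂_l G_{lj}` and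
  -- `|y|² y_j ∂_j Tr G`; these are the only places where `|y| = 1` is used in the reduction.
  linear_combination (k * (y 0 * (D 0 0 0 + D 0 1 1 + D 0 2 2)
    + y 1 * (D 0 1 0 + D 1 1 1 + D 1 2 2) + y 2 * (D 0 2 0 + D 1 2 1 + D 2 2 2))
    - k / 3 * (y 0 * (D 0 0 0 + D 1 1 0 + D 2 2 0)
    + y 1 * (D 0 0 1 + D 1 1 1 + D 2 2 1) + y 2 * (D 0 0 2 + D 1 1 2 + D 2 2 2))) * hn

end

/-! ### Differences of solutions with their limits -/

theorem opD_sub_const (k : ℝ) {A : MatField} {U : Set E3} (hU : IsOpen U)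
    (hA : ∀ i j, ContDiffOn ℝ 2 (fun y => A y i j) U) (C : Matrix (Fin 3) (Fin 3) ℝ)
    {x : E3} (hx : x ∈ U) (i j : Fin 3) : opD k (fun y => A y - C) i j x = opD k A i j x := by
  have h : ∀ l p q, pd l (fun y => (A y - C) p q) = pd l fun y => A y p q := fun l p q =>
    funext fun y => pd_sub_const (f := fun y => A y p q) (C p q) l
  rw [opD_eq k (A := fun y => A y - C) hU (fun i j => (hA i j).sub contDiffOn_const) hx,
    opD_eq k hU hA hx]
  simp only [h]

namespace IsSolution

variable {k : ℝ} {Qlim : Matrix (Fin 3) (Fin 3) ℝ} {Q : MatField}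

theorem limit_isSymm (hQ : IsSolution k Qlim Q) : Qlim.IsSymm := by
  ext i j
  refine tendsto_nhds_unique (hQ.tendsto j i) ((hQ.tendsto i j).congr' ?_)
  filter_upwards [tendsto_norm_cobounded_atTop.eventually_ge_atTop 1] with y hy
  exact (hQ.symm y hy).apply j i

end IsSolution

end ExteriorQ

/-! ### Proof of the representation formula and its expanded form -/

open ExteriorQ

theorem mainTheorem2 (k : ℝ) (hk2 : 2 + k ≠ 0) (hk3 : 3 + 2 * k ≠ 0)
    (Qlim : Matrix (Fin 3) (Fin 3) ℝ) (Q : ExteriorQ.MatField)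
    (hQ : ExteriorQ.IsSolution k Qlim Q)
    (s : ExteriorQ.E3) (hs : s ∈ ExteriorQ.Omega) (m n : Fin 3)
    (Φ : ExteriorQ.MatField) (hΦ : ExteriorQ.IsCorrector k m n s Φ) :
    ((if m = n then 1 else 2) * (Q s - Qlim) m n
        = ∑ i, ∑ j, ∫ y : Metric.sphere (0 : ExteriorQ.E3) 1,
            (Q (y : ExteriorQ.E3) - Qlim) i j
              * ExteriorQ.kernel k (ExteriorQ.green k m n s Φ) i j (y : ExteriorQ.E3)
            ∂ExteriorQ.surf) ∧
    (Qlim = ExteriorQ.Qinf →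
      (∀ y ∈ Metric.sphere (0 : ExteriorQ.E3) 1, Q y = ExteriorQ.Qbdry y) →
      (if m = n then 1 else 2) * (Q s - Qlim) m n
        = - ∫ y : Metric.sphere (0 : ExteriorQ.E3) 1,
            ExteriorQ.expanded k (ExteriorQ.green k m n s Φ) (y : ExteriorQ.E3)
            ∂ExteriorQ.surf) := by
  have hs1 : 1 < ‖s‖ := hs
  have hsph : ∀ y : E3, ‖y‖ = 1 → y ≠ s := fun y hy h => by
    rw [h] at hy
    exact hs1.ne' hy
  have hnorm : ∀ w : Metric.sphere (0 : E3) 1, ‖(w : E3)‖ = 1 := norm_coe_sphere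
  have hΦb : ∀ y, ‖y‖ = 1 → Φ y = regFund k (symUnit m n) 0 (y - s) := fun y hy => by
    rw [hΦ.boundary y (mem_sphere_zero_iff_norm.2 hy),
      fundSol_eq_regFund hk2 hk3 m n (sub_ne_zero.2 (hsph y hy))]
  have hqs : ∀ y ∈ OmegaBar, (Q y - Qlim).IsSymm := fun y hy =>
    (hQ.symm y hy).sub hQ.limit_isSymm
  have hqc : ∀ i j, ContinuousOn (fun y => (Q y - Qlim) i j) OmegaBar := fun i j =>
    (hQ.continuousOn i j).sub continuousOn_const
  have hmain := sum_add_adjForm_boundary (q := fun y => Q y - Qlim) hk2 hk3 (symUnit_isSymm m n) hs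
    (fun i j => (hQ.contDiffOn i j).sub contDiffOn_const)
    (fun y hy => hqs y (Omega_subset_OmegaBar hy)) hqc
    (fun y hy i j => by
      rw [opD_sub_const k isOpen_Omega hQ.contDiffOn Qlim hy, hQ.equation y hy])
    (fun i j => by
      rw [← sub_self (Qlim i j)]
      exact (hQ.tendsto i j).sub_const _)
    hΦ.contDiffOn (fun y hy => hΦ.symm y (Omega_subset_OmegaBar hy)) hΦ.contDiffOn_closed
    hΦ.equation hΦb hΦ.decay hΦ.decay_deriv
  rw [sum_symUnit_mul m n (hqs s (Omega_subset_OmegaBar hs))] at hmain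
  have hint : ∀ a b i j p r : Fin 3, Integrable (fun w : Metric.sphere (0 : E3) 1 =>
      (Q (w : E3) - Qlim) i j * ((w : E3) a
        * greenDeriv k (symUnit m n) s Φ p r (w : E3) (EuclideanSpace.single b 1))) surf := by
    intro a b i j p r
    have hw : Continuous fun w : Metric.sphere (0 : E3) 1 => (w : E3) := continuous_subtype_val
    have h1 := (hqc i j).comp_continuous hw fun w => (hnorm w).ge
    have h2 := (continuousOn_greenDeriv (k := k) (S := symUnit m n) (s := s)
      hΦ.contDiffOn_closed p r).comp_continuous hw
      fun w => ⟨(hnorm w).ge, hsph w (hnorm w)⟩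
    have h3 : Continuous fun w : Metric.sphere (0 : E3) 1 => (w : E3) a := by fun_prop
    exact (h1.mul (h3.mul (h2.clm_apply continuous_const))).integrable_of_hasCompactSupport
      (HasCompactSupport.of_compactSpace _)
  have hker : ∀ (w : Metric.sphere (0 : E3) 1) (i j : Fin 3),
      (Q (w : E3) - Qlim) i j * kernel k (green k m n s Φ) i j (w : E3) = _ := fun w i j =>
    kernel_green hk2 hk3 hΦ.contDiffOn_closed (hnorm w).ge (hsph w (hnorm w))
      (D := fun p r l => greenDeriv k (symUnit m n) s Φ p r w (EuclideanSpace.single l 1))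
      (fun _ _ _ => rfl) ((Q (w : E3) - Qlim) i j) i j
  have hfirst : (if m = n then 1 else 2) * (Q s - Qlim) m n
      = ∑ i, ∑ j, ∫ y : Metric.sphere (0 : E3) 1,
          (Q (y : E3) - Qlim) i j * kernel k (green k m n s Φ) i j (y : E3) ∂surf := by
    rw [integral_adjForm k surf hint] at hmain
    simp_rw [hker, integral_neg, Finset.sum_neg_distrib]
    exact eq_neg_of_add_eq_zero_left hmain
  refine ⟨hfirst, fun hlim hbd => hfirst.trans ?_⟩
  have hki : ∀ i j, Integrable (fun w : Metric.sphere (0 : E3) 1 =>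
      (Q (w : E3) - Qlim) i j * kernel k (green k m n s Φ) i j (w : E3)) surf := by
    intro i j
    simp_rw [hker]
    have hsum := fun (f : Fin 3 → Metric.sphere (0 : E3) 1 → ℝ)
      (h : ∀ l, Integrable (f l) surf) => integrable_finsetSum Finset.univ fun l _ => h l
    exact ((hsum _ fun l => hint l l i j i j).neg.sub ((((hsum _ fun l => hint i l i j l j).add
      (hsum _ fun l => hint j l i j l i)).sub
      ((hsum _ fun l => hint i j i j l l).const_mul _)).const_mul _)).neg
  -- The expanded integrand equals the kernel sum only after summation over `i` and `j`, so the sums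
  -- go under the integral before integrands are compared.
  simp_rw [← integral_finsetSum Finset.univ fun j _ => hki _ j]
  rw [← integral_finsetSum Finset.univ fun i _ => integrable_finsetSum _ fun j _ => hki i j,
    ← integral_neg]
  refine integral_congr_ae (Eventually.of_forall fun w => ?_)
  have hw : Q (w : E3) = Qbdry w := hbd w w.2
  simp only [hw, hlim]
  exact sum_mul_kernel_eq_neg_expanded hk2 hk3 hΦ.contDiffOn_closed hΦ.symm (hnorm w)
    (hsph w (hnorm w))
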